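/- **Setting.** Let $X$ be a second-countable locally compact Hausdorff space with its Borel $\sigma$-algebra and $Y$ a real separable Hilbert space. Let $\mathcal H$ be a real reproducing kernel Hilbert space of scalar functions on $X$ with kernel $k$ and feature map $\phi(x)=k(x,\cdot)\in\mathcal H$, where $\phi$ is strongly measurable and $k(x,x)\le\kappa^2$ for all $x\in X$, $\kappa\ge 0$. Let $\mathcal G$ be the $Y$-valued RKHS on $X$ with kernel $K(x,t)=k(x,t)\,\mathrm{Id}_Y$, and write $K_x:Y\to\mathcal G$ for $K_xy=K(\cdot,x)y$. $\mathcal S_2(\mathcal H,Y)$ denotes the Hilbert–Schmidt operators with norm $\|\cdot\|_{\mathcal S_2}$. Let $p_X,q_X$ be probability measures on $X$ and $p(dy\mid x)$ a Markov kernel from $X$ to $Y$; put $p(dx,dy)=p_X(dx)\,p(dy\mid x)$. Assume $dq_X=\beta\,dp_X$ with $\beta:X\to[0,\infty)$ measurable and $\beta\le b$ everywhere, $b>0$, and $\|y\|_Y\le M'$ for $p$-almost every $(x,y)$, $M'>0$. Put $$C_X=\int_X\phi(x)\otimes\phi(x)\,dq_X(x),\qquad \mathcal N(\lambda)=\mathrm{Tr}\big(C_X(C_X+\lambda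 I)^{-1}\big).$$ *Regularization.* Let $s\ge b\kappa^2$ and let $g_\lambda:[0,s]\to\mathbb R$, $0<\lambda\le s$, be functions with constants $D,B,\gamma>0$ such that, for all $0<\lambda\le s$ and $0<\sigma\le s$, $|\sigma g_\lambda(\sigma)|\le D$, $|g_\lambda(\sigma)|\le B/\lambda$ and $|1-\sigma g_\lambda(\sigma)|\le\gamma$. Let $\nu>0$ and $\gamma_\nu$ satisfy $|1-\sigma g_\lambda(\sigma)|\,\sigma^\nu\le\gamma_\nu\lambda^\nu$ for all such $\lambda,\sigma$ (for instance, $\nu$ is the qualification of the family, i.e. the largest such exponent). Let $\varphi:[0,\infty)\to[0,\infty)$ be an index function (continuous, strictly increasing, $\varphi(0)=0$) that is covered by $\nu$: for some $c>0$, $c\,t^\nu/\varphi(t)\le\inf_{t\le\sigma\le s}\sigma^\nu/\varphi(\sigma)$ for all $0<t\le s$. *Source condition.* Let $f^*\in\mathcal G$ be the regression function, $f^*(x)=\int_Y y\,p(dy\mid x)$ for $q_X$-almost every $x$. Write $f^*(x)=C_*\phi(x)$ for all $x\in X$, with $C_*:\mathcal H\to Y$ bounded linear, and assume $C_*=C_o\,\varphi(C_X)$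 for some $C_o\in\mathcal S_2(\mathcal H,Y)$. *Estimator.* Given a sample $\mathbf z=((x_i,y_i))_{i=1}^n$, $n\ge1$, let $S:\mathcal G\to Y^n$, $Sf=(f(x_i))_i$, $S^*\mathbf y=\frac1n\sum_iK_{x_i}y_i$, $\mathcal B=\mathrm{diag}(\beta(x_1),\dots,\beta(x_n))$ and $$\widehat f_{\mathbf z,\lambda}=g_\lambda(S^*\mathcal BS)\,S^*\mathcal B\mathbf y .$$ **Theorem.** Let $0<\delta<1$ and let $0<\lambda\le s$ satisfy $$2\left(\frac{2b\kappa^2}{\sqrt\lambda\,n}+\sqrt{\frac{b\kappa^2\mathcal N(\lambda)}{n}}\right)\log\frac2\delta\le\frac{\sqrt\lambda}{2}.$$ If $\mathbf z$ consists of $n$ independent samples from $p$, then with probability at least $1-\delta$ $$\big\|f^*-\widehat f_{\mathbf z,\lambda}\big\|_{\mathcal G}\le\left(\frac{A_1}{n\lambda}+A_2\sqrt{\frac{\mathcal N(\lambda)}{n\lambda}}\right)\log\frac2\delta+A_3\,\varphi(\lambda),$$ where, with $\bar\nu=\lfloor\nu\rfloor$ and $M=M'+\kappa\|C_*\|_{\mathcal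 S_2}$, $$A_1=2^{2\nu-\bar\nu+2}(\gamma_\nu+\gamma)\max\!\big(1,\tfrac1c\big)\,\bar\nu\,b\,\kappa^2\|C_*\|_{\mathcal S_2}+2\sqrt{10}\,b\,M\,\kappa\,(B+D),$$ $$A_2=2^{2\nu-\bar\nu+1}(\gamma_\nu+\gamma)\max\!\big(1,\tfrac1c\big)\,\bar\nu\,\sqrt b\,\kappa\,\|C_*\|_{\mathcal S_2}+\sqrt{10}\,\sqrt b\,M\,(B+D),$$ $$A_3=2^{2\nu-\bar\nu}(\gamma_\nu+\gamma)\max\!\big(1,\tfrac1c\big)\,\|C_o\|_{\mathcal S_2}.$$ (Precisely: the set of samples for which the bound fails has outer measure at most $\delta$ under the $n$-fold product of $p$.) -/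

import Mathlib

open MeasureTheory ProbabilityTheory
open scoped RealInnerProductSpace

noncomputable section

namespace CovShift

section Operators

variable {E F : Type*} [NormedAddCommGroup E] [InnerProductSpace ℝ E] [CompleteSpace E]
  [NormedAddCommGroup F] [InnerProductSpace ℝ F]

/-- Functional calculus `f(A) v = ∑_μ f(μ) P_μ v` of an operator `A` whose eigenspaces span a dense
subspace (compact self-adjoint operators, self-adjoint operators with finite spectrum); `P_μ` is the
orthogonal projection onto `ker (A - μ)`, which is zero unless `μ` is an eigenvalue. -/
def funcCalc (A : E →L[ℝ] E) (f : ℝ → ℝ) (v : E) : E :=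
  ∑' μ : ℝ, f μ • (A - μ • ContinuousLinearMap.id ℝ E).ker.starProjection v

variable (E) in
/-- Index set of a fixed orthonormal (Hilbert) basis of `E`. -/
def basisIndex : Set E := (exists_hilbertBasis ℝ E).choose

variable (E) in
/-- A fixed orthonormal (Hilbert) basis of `E`. -/
def onb : HilbertBasis (basisIndex E) ℝ E := (exists_hilbertBasis ℝ E).choose_spec.choose

/-- `T ∈ 𝒮₂(E, F)`; this does not depend on the orthonormal basis. -/
def IsHilbertSchmidt (T : E →L[ℝ] F) : Prop :=
  Summable fun i => ‖T (onb E i)‖ ^ 2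

/-- The Hilbert–Schmidt norm `‖T‖_{𝒮₂(E, F)}`; it does not depend on the orthonormal basis. -/
def hsNorm (T : E →L[ℝ] F) : ℝ :=
  Real.sqrt (∑' i, ‖T (onb E i)‖ ^ 2)

/-- The trace `∑ ⟪eᵢ, T eᵢ⟫` (used for positive trace class operators, where it does not depend on
the orthonormal basis). -/
def trace (T : E →L[ℝ] E) : ℝ :=
  ∑' i, ⟪onb E i, T (onb E i)⟫

/-- `𝒩(lam) = Tr (C (C + lam I)⁻¹)`. -/
def effDim (C : E →L[ℝ] E) (lam : ℝ) : ℝ :=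
  trace (C * Ring.inverse (C + lam • (1 : E →L[ℝ] E)))

end Operators

section Regularization

/-- The family `g lam : [0, s] → ℝ`, `0 < lam ≤ s`, is a regularization family with constants
`D`, `B`, `γ`. -/
structure IsRegularizationFamily (s : ℝ) (g : ℝ → ℝ → ℝ) (D B γ : ℝ) : Prop where
  D_pos : 0 < D
  B_pos : 0 < B
  γ_pos : 0 < γ
  bound_mul : ∀ lam ∈ Set.Ioc 0 s, ∀ σ ∈ Set.Ioc 0 s, |σ * g lam σ| ≤ D
  bound : ∀ lam ∈ Set.Ioc 0 s, ∀ σ ∈ Set.Ioc 0 s, |g lam σ| ≤ B / lam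
  bound_residual : ∀ lam ∈ Set.Ioc 0 s, ∀ σ ∈ Set.Ioc 0 s, |1 - σ * g lam σ| ≤ γ

/-- The inequality that defines the qualification, for the exponent `ν`, with constant `γν`. The
qualification is the largest such exponent; maximality is not required here, so that families with
infinite qualification are included. -/
def HasQualification (s : ℝ) (g : ℝ → ℝ → ℝ) (ν γν : ℝ) : Prop :=
  0 < ν ∧ ∀ lam ∈ Set.Ioc 0 s, ∀ σ ∈ Set.Ioc 0 s,
    |1 - σ * g lam σ| * σ ^ ν ≤ γν * lam ^ ν

/-- Index functions on `[0, ∞)`. -/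
structure IsIndexFunction (φ : ℝ → ℝ) : Prop where
  continuousOn : ContinuousOn φ (Set.Ici 0)
  strictMonoOn : StrictMonoOn φ (Set.Ici 0)
  map_zero : φ 0 = 0

/-- The exponent `ν` covers the index function `φ` on `(0, s]` with constant `c`. -/
def Covers (s ν : ℝ) (φ : ℝ → ℝ) (c : ℝ) : Prop :=
  0 < c ∧ ∀ t ∈ Set.Ioc 0 s, ∀ σ ∈ Set.Icc t s, c * (t ^ ν / φ t) ≤ σ ^ ν / φ σ

end Regularization

section Scalar

variable {X : Type*} (H : Type*) [NormedAddCommGroup H] [InnerProductSpace ℝ H] [CompleteSpace H]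
  [RKHS ℝ H X ℝ]

/-- The reproducing kernel `k(x, t)` of the scalar RKHS `H`. -/
def scalarKernel (x t : X) : ℝ := RKHS.kernel H x t 1

/-- The feature map `x ↦ k(x, ·) ∈ H`. -/
def feature (x : X) : H := RKHS.kerFun H x 1

/-- The covariance operator `C_X = 𝔼_q [feature x ⊗ feature x]`. -/
def covOp [MeasurableSpace X] (qX : Measure X) : H →L[ℝ] H :=
  ∫ x, InnerProductSpace.rankOne ℝ (feature H x) (feature H x) ∂qX

end Scalar

section Estimator

variable {X Y : Type*} [NormedAddCommGroup Y] [InnerProductSpace ℝ Y] [CompleteSpace Y]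
  (G : Type*) [NormedAddCommGroup G] [InnerProductSpace ℝ G] [CompleteSpace G] [RKHS ℝ G X Y]
  {n : ℕ}

/-- The sampling operator `S f = (f (x₁), …, f (xₙ))`. -/
def samplingOp (x : Fin n → X) : G →L[ℝ] (Fin n → Y) :=
  ContinuousLinearMap.pi fun i => (RKHS.kerFun G (x i)).adjoint

/-- `S* y = (1/n) ∑ᵢ K_{xᵢ} yᵢ`, the adjoint of `S` for `‖y‖ₙ² = (1/n) ∑ᵢ ‖yᵢ‖²`. -/
def samplingAdj (x : Fin n → X) : (Fin n → Y) →L[ℝ] G :=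
  (n : ℝ)⁻¹ • ∑ i, RKHS.kerFun G (x i) ∘L ContinuousLinearMap.proj i

/-- The diagonal operator `diag (w₁, …, wₙ)` on `Yⁿ`. -/
def diagOp (w : Fin n → ℝ) : (Fin n → Y) →L[ℝ] (Fin n → Y) :=
  ContinuousLinearMap.pi fun i => w i • ContinuousLinearMap.proj i

/-- The importance weighted estimator `g_lam (S* 𝓑 S) S* 𝓑 y` of the sample
`z = ((x₁, y₁), …, (xₙ, yₙ))`, where `gl = g_lam` and `𝓑 = diag (β (x₁), …, β (xₙ))`. -/
def estimator (β : X → ℝ) (gl : ℝ → ℝ) (z : Fin n → X × Y) : G :=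
  let S := samplingOp G fun i => (z i).1
  let Sadj := samplingAdj G fun i => (z i).1
  let W : (Fin n → Y) →L[ℝ] (Fin n → Y) := diagOp fun i => β (z i).1
  funcCalc (Sadj ∘L W ∘L S) gl (Sadj (W fun i => (z i).2))

end Estimator

end CovShift

end

/-! The kernel `k Id` makes `G` the Hilbert tensor product of `H` and `Y`, that is, the space of
Hilbert–Schmidt operators from `H` to `Y` (`exists_isTensor_rkhs`). Under this identification
`fstar` becomes `Cstar`. With `Ĉ` the weighted empirical covariance `empCov` and `Ĉ_YX` the cross
covariance `empCross`, the estimator becomes `Ĉ_YX g(Ĉ)`. The error is therefore a Hilbert–Schmidt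
norm (`norm_sub_estimator_le`), and it splits as `Cstar (1 - Ĉ g(Ĉ)) - (Ĉ_YX - Cstar Ĉ) g(Ĉ)`.

Put `T = C + lam` and `T̂ = Ĉ + lam`. For the first term (`hsLe_residual`) write `ν = m + r` with `m
= ⌊ν⌋` and factor the residual as `T̂^(-m) T̂^(-r)` times a bounded function of `Ĉ`. Replacing
`T̂^(-m)` by `T^(-m)` costs `m` times the relative perturbation `‖T⁻¹ (Ĉ - C)‖`. After the
replacement the source condition applies: `φ(C) T^(-ν)` is controlled by covering, and `‖T^r
T̂^(-r)‖ ≤ 2^r` by the Cordes–Heinz inequality, which holds only for exponents up to `1` and so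
explains the integer part of `ν` in the constants. For the second term (`hsLe_filter`) the noise is
measured after multiplication by `T^(-1/2)`, and Cordes–Heinz with `r = 1/2` gives the factor `√2`.

Two random quantities remain: `T^(-1/2) (Ĉ - C)` and `(Ĉ_YX - Cstar Ĉ) T^(-1/2)`. Both are averages
of independent bounded vectors in a tensor product, and their second moments are multiples of `N`,
because `N` is the mean of `‖T^(-1/2) feature‖²` under `qX` (`effDim_eq`). One factor `β` is bounded
by `b`; the other changes `pX` into `qX`. `meas_norm_sum_gt_union_le` controls both at total failure
probability `δ`, and the sample size condition says exactly that the relative perturbation is at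
most `1/2`. -/

namespace CovShift

/-! ### Orthonormal bases and the spectral theorem for compact self-adjoint operators. -/

section Bases

variable {E F : Type*} [NormedAddCommGroup E] [InnerProductSpace ℝ E]
  [NormedAddCommGroup F] [InnerProductSpace ℝ F]

theorem hasSum_inner_sq {ι : Type*} (e : HilbertBasis ι ℝ E) (v : E) :
    HasSum (fun i => ⟪e i, v⟫ ^ 2) (‖v‖ ^ 2) := by
  have h := e.hasSum_inner_mul_inner v v
  rw [real_inner_self_eq_norm_sq] at h
  refine h.congr_fun ?_
  intro i
  rw [real_inner_comm v (e i), sq]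

theorem hasSum_inner_smul {ι : Type*} (e : HilbertBasis ι ℝ E) (v : E) :
    HasSum (fun i => ⟪e i, v⟫ • e i) v := by
  simpa only [HilbertBasis.repr_apply_apply] using e.hasSum_repr v

theorem ext_inner_basis {ι : Type*} (e : HilbertBasis ι ℝ E) {v w : E}
    (h : ∀ i, ⟪e i, v⟫ = ⟪e i, w⟫) : v = w := by
  refine (hasSum_inner_smul e v).unique ?_
  simpa only [h] using hasSum_inner_smul e w

theorem ext_basis {ι : Type*} (e : HilbertBasis ι ℝ E) {S T : E →L[ℝ] F}
    (h : ∀ i, S (e i) = T (e i)) : S = T := by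
  ext v
  refine (S.hasSum (hasSum_inner_smul e v)).unique ?_
  simpa only [map_smul, h] using T.hasSum (hasSum_inner_smul e v)

theorem inner_basis_ite {ι : Type*} [DecidableEq ι] (e : HilbertBasis ι ℝ E) (i j : ι) :
    ⟪e i, e j⟫ = if i = j then 1 else 0 :=
  orthonormal_iff_ite.mp e.orthonormal i j

/-- Distinct basis vectors lie at distance `√2`, so the balls of radius `1/2` around them are
disjoint. Countability is needed later to exchange sums over a basis with integrals. -/
theorem countable_of_hilbertBasis [TopologicalSpace.SeparableSpace E] {ι : Type*}
    (e : HilbertBasis ι ℝ E) : Countable ι := by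
  refine Pairwise.countable_of_isOpen_disjoint (s := fun i => Metric.ball (e i) (1 / 2)) ?_
    (fun i => Metric.isOpen_ball) (fun i => ⟨e i, Metric.mem_ball_self (by norm_num)⟩)
  intro i j hij
  refine Metric.ball_disjoint_ball ?_
  have h : ‖e i - e j‖ ^ 2 = 2 := by
    rw [norm_sub_sq_real, e.orthonormal.2 hij, e.orthonormal.1, e.orthonormal.1]; norm_num
  rw [dist_eq_norm]
  nlinarith [norm_nonneg (e i - e j)]

/-- A Hilbert basis adapted to an orthogonal family of closed subspaces with dense span. -/
theorem exists_adapted_hilbertBasis.{u, v} {E : Type u} [NormedAddCommGroup E]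
    [InnerProductSpace ℝ E] [CompleteSpace E] {κ : Type v} (V : κ → Submodule ℝ E)
    [∀ μ, CompleteSpace (V μ)] (hV : OrthogonalFamily ℝ (fun μ => V μ) fun μ => (V μ).subtypeₗᵢ)
    (hbot : (⨆ μ, V μ)ᗮ = ⊥) :
    ∃ (ι : Type (max v u)) (e : HilbertBasis ι ℝ E) (p : ι → κ), ∀ i, e i ∈ V (p i) := by
  have ho := hV.orthonormal_sigma_orthonormal (v_family := fun μ i => onb (V μ) i)
    (fun μ => (onb (V μ)).orthonormal)
  refine ⟨Σ μ, basisIndex (V μ), HilbertBasis.mkOfOrthogonalEqBot ho ?_, fun q => q.1,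
    fun q => ?_⟩
  · rw [eq_bot_iff, ← hbot]
    intro v hv
    rw [Submodule.mem_orthogonal'] at hv
    rw [← Submodule.iInf_orthogonal, Submodule.mem_iInf]
    intro μ
    rw [Submodule.mem_orthogonal']
    intro x hx
    have h2 := (innerSL ℝ v).hasSum ((V μ).subtypeL.hasSum (hasSum_inner_smul (onb (V μ)) ⟨x, hx⟩))
    refine h2.unique ?_
    convert hasSum_zero with i
    simp only [map_smul, Submodule.subtypeL_apply, innerSL_apply_apply, smul_eq_mul]
    have : ⟪v, (onb (V μ) i : E)⟫ = 0 := hv _ (Submodule.subset_span ⟨⟨μ, i⟩, rfl⟩)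
    rw [this, mul_zero]
  · rw [HilbertBasis.coe_mkOfOrthogonalEqBot]
    exact (onb (V q.1) q.2).2

/-- A compact self-adjoint operator has an orthonormal basis of eigenvectors. -/
theorem exists_eigenbasis.{u} {E : Type u} [NormedAddCommGroup E] [InnerProductSpace ℝ E]
    [CompleteSpace E] (T : E →L[ℝ] E) (hT : IsCompactOperator T)
    (hs : (T : E →ₗ[ℝ] E).IsSymmetric) :
    ∃ (ι : Type u) (e : HilbertBasis ι ℝ E) (a : ι → ℝ), ∀ i, T (e i) = a i • e i := by
  have hcl : ∀ μ : ℝ, CompleteSpace (Module.End.eigenspace (T : E →ₗ[ℝ] E) μ) := fun μ => by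
    have : (Module.End.eigenspace (T : E →ₗ[ℝ] E) μ)
        = (T - μ • ContinuousLinearMap.id ℝ E).ker := by
      ext v; simp [sub_eq_zero]
    rw [this]
    exact (ContinuousLinearMap.isClosed_ker _).completeSpace_coe
  obtain ⟨ι, e, a, h⟩ := exists_adapted_hilbertBasis _ hs.orthogonalFamily_eigenspaces
    (ContinuousLinearMap.orthogonalComplement_iSup_eigenspaces_eq_bot hT hs)
  exact ⟨ι, e, a, fun i => Module.End.mem_eigenspace_iff.mp (h i)⟩

end Bases

/-! ### The functional calculus evaluated on sums of eigenvectors. -/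

section FuncCalc

variable {E : Type*} [NormedAddCommGroup E] [InnerProductSpace ℝ E] [CompleteSpace E]

theorem starProjection_ker_sub_smul (A : E →L[ℝ] E) (hs : (A : E →ₗ[ℝ] E).IsSymmetric) {v : E}
    {μ : ℝ} (hv : A v = μ • v) (ξ : ℝ) :
    (A - ξ • ContinuousLinearMap.id ℝ E).ker.starProjection v = if μ = ξ then v else 0 := by
  split_ifs with h
  · refine Submodule.starProjection_eq_self_iff.mpr ?_
    simp [hv, h]
  · rw [Submodule.starProjection_apply_eq_zero_iff, Submodule.mem_orthogonal]
    intro u hu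
    have hu' : A u = ξ • u := by
      have : A u - ξ • u = 0 := by simpa using hu
      exact sub_eq_zero.mp this
    have h1 : ⟪A u, v⟫ = ⟪u, A v⟫ := hs u v
    rw [hu', hv, real_inner_smul_left, real_inner_smul_right] at h1
    have : (ξ - μ) * ⟪u, v⟫ = 0 := by linarith
    rcases mul_eq_zero.mp this with h2 | h2
    · exact absurd (sub_eq_zero.mp h2).symm h
    · exact h2

/-- The functional calculus on a sum of eigenvectors. -/
theorem funcCalc_eq (A : E →L[ℝ] E) (hs : (A : E →ₗ[ℝ] E).IsSymmetric) (f : ℝ → ℝ) {ι : Type*}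
    {x : ι → E} {μ : ι → ℝ} (hx : ∀ i, A (x i) = μ i • x i) {v w : E} (hv : HasSum x v)
    (hw : HasSum (fun i => f (μ i) • x i) w) : funcCalc A f v = w := by
  -- Group the target sum by eigenvalue: the fibre over `ξ` is what the projection onto `ker (A -
  -- ξ)` retains from `v`.
  have h1 := hw.tsum_fiberwise μ
  refine Eq.trans ?_ h1.tsum_eq
  unfold funcCalc
  congr 1
  ext1 ξ
  have h2 := ((A - ξ • ContinuousLinearMap.id ℝ E).ker.starProjection.hasSum hv).const_smul (f ξ)
  rw [← h2.tsum_eq, tsum_subtype (μ ⁻¹' {ξ}) (fun i => f (μ i) • x i)]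
  congr 1
  ext1 i
  simp only [starProjection_ker_sub_smul A hs (hx i), Set.indicator]
  by_cases h : μ i = ξ <;> simp [h]

end FuncCalc

/-! ### Operators that are diagonal in an orthonormal basis. -/

section Diagonal

variable {E F : Type*} [NormedAddCommGroup E] [InnerProductSpace ℝ E]
  [NormedAddCommGroup F] [InnerProductSpace ℝ F] {ι : Type*}

theorem summable_sq_mul_inner_sq (e : HilbertBasis ι ℝ E) {m : ι → ℝ} {M : ℝ}
    (hm : ∀ i, |m i| ≤ M) (v : E) : Summable fun i => (m i * ⟪e i, v⟫) ^ 2 := by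
  refine Summable.of_nonneg_of_le (fun i => sq_nonneg _) (fun i => ?_)
    ((hasSum_inner_sq e v).summable.mul_left (M ^ 2))
  rw [mul_pow]
  exact mul_le_mul_of_nonneg_right (sq_le_sq' (abs_le.mp (hm i)).1 (abs_le.mp (hm i)).2)
    (sq_nonneg _)

theorem exists_diagonal (e : HilbertBasis ι ℝ E) (m : ι → ℝ) (hm : ∃ M, ∀ i, |m i| ≤ M) :
    ∃ D : E →L[ℝ] E, ∀ i v, ⟪e i, D v⟫ = m i * ⟪e i, v⟫ := by
  obtain ⟨M, hM⟩ := hm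
  have hmem : ∀ v : E, Memℓp (fun i => m i * ⟪e i, v⟫) 2 := fun v => by
    refine memℓp_gen ?_
    convert summable_sq_mul_inner_sq e hM v with i
    simp [mul_pow]
  let x : E → E := fun v => e.repr.symm ⟨fun i => m i * ⟪e i, v⟫, hmem v⟩
  have hx : ∀ i v, ⟪e i, x v⟫ = m i * ⟪e i, v⟫ := fun i v => by
    rw [← HilbertBasis.repr_apply_apply]; simp [x]
  let lx : E →ₗ[ℝ] E :=
    { toFun := x
      map_add' := fun v w => ext_inner_basis e fun i => by
        rw [inner_add_right, hx, hx, hx, inner_add_right, mul_add]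
      map_smul' := fun r v => ext_inner_basis e fun i => by
        rw [RingHom.id_apply, real_inner_smul_right, hx, hx, real_inner_smul_right]; ring }
  refine ⟨lx.mkContinuous |M| fun v => ?_, hx⟩
  refine abs_le_of_sq_le_sq' ?_ (by positivity) |>.2
  rw [mul_pow, sq_abs]
  refine hasSum_le (fun i => ?_) (hasSum_inner_sq e (x v)) ((hasSum_inner_sq e v).mul_left (M ^ 2))
  rw [hx, mul_pow]
  exact mul_le_mul_of_nonneg_right (sq_le_sq' (abs_le.mp (hM i)).1 (abs_le.mp (hM i)).2)
    (sq_nonneg _)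

open Classical in
/-- The operator `e i ↦ m i • e i` for a bounded family `m`. -/
noncomputable def diagonal (e : HilbertBasis ι ℝ E) (m : ι → ℝ) : E →L[ℝ] E :=
  if hm : ∃ M, ∀ i, |m i| ≤ M then (exists_diagonal e m hm).choose else 0

theorem inner_diagonal (e : HilbertBasis ι ℝ E) {m : ι → ℝ} {M : ℝ} (hm : ∀ i, |m i| ≤ M) (i : ι)
    (v : E) : ⟪e i, diagonal e m v⟫ = m i * ⟪e i, v⟫ := by
  have h : ∃ M, ∀ i, |m i| ≤ M := ⟨M, hm⟩
  rw [diagonal, dif_pos h]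
  exact (exists_diagonal e m h).choose_spec i v

theorem diagonal_apply_basis (e : HilbertBasis ι ℝ E) {m : ι → ℝ} {M : ℝ} (hm : ∀ i, |m i| ≤ M)
    (i : ι) : diagonal e m (e i) = m i • e i := by
  classical
  refine ext_inner_basis e fun j => ?_
  rw [inner_diagonal e hm, real_inner_smul_right, inner_basis_ite]
  split_ifs with h
  · rw [h]
  · simp

theorem inner_diagonal_left (e : HilbertBasis ι ℝ E) {m : ι → ℝ} {M : ℝ} (hm : ∀ i, |m i| ≤ M)
    (v w : E) : ⟪diagonal e m v, w⟫ = ⟪v, diagonal e m w⟫ := by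
  refine (e.hasSum_inner_mul_inner _ w).unique ?_
  convert! e.hasSum_inner_mul_inner v (diagonal e m w) using 2 with i
  rw [inner_diagonal e hm, real_inner_comm, inner_diagonal e hm, real_inner_comm v]
  ring

theorem norm_diagonal_sq (e : HilbertBasis ι ℝ E) {m : ι → ℝ} {M : ℝ} (hm : ∀ i, |m i| ≤ M)
    (v : E) : HasSum (fun i => m i ^ 2 * ⟪e i, v⟫ ^ 2) (‖diagonal e m v‖ ^ 2) := by
  convert! hasSum_inner_sq e (diagonal e m v) using 2 with i
  rw [inner_diagonal e hm, mul_pow]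

theorem norm_diagonal_le (e : HilbertBasis ι ℝ E) {m : ι → ℝ} {M : ℝ} (hM : 0 ≤ M)
    (hm : ∀ i, |m i| ≤ M) : ‖diagonal e m‖ ≤ M := by
  refine ContinuousLinearMap.opNorm_le_bound _ hM fun v => ?_
  refine abs_le_of_sq_le_sq' ?_ (by positivity) |>.2
  rw [mul_pow]
  refine hasSum_le (fun i => ?_) (norm_diagonal_sq e hm v) ((hasSum_inner_sq e v).mul_left (M ^ 2))
  exact mul_le_mul_of_nonneg_right (sq_le_sq' (abs_le.mp (hm i)).1 (abs_le.mp (hm i)).2)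
    (sq_nonneg _)

theorem diagonal_comp (e : HilbertBasis ι ℝ E) {m m' : ι → ℝ} {M M' : ℝ} (hm : ∀ i, |m i| ≤ M)
    (hm' : ∀ i, |m' i| ≤ M') :
    diagonal e m ∘L diagonal e m' = diagonal e fun i => m i * m' i := by
  refine ext_basis e fun i => ?_
  have h : ∀ i, |m i * m' i| ≤ M * M' := fun i => by
    rw [abs_mul]
    exact mul_le_mul (hm i) (hm' i) (abs_nonneg _) ((abs_nonneg _).trans (hm i))
  rw [diagonal_apply_basis e h, ContinuousLinearMap.comp_apply, diagonal_apply_basis e hm',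
    map_smul, diagonal_apply_basis e hm, smul_smul, mul_comm]

theorem eq_diagonal (e : HilbertBasis ι ℝ E) {a : ι → ℝ} {T : E →L[ℝ] E}
    (hT : ∀ i, T (e i) = a i • e i) : (∀ i, |a i| ≤ ‖T‖) ∧ T = diagonal e a := by
  have h : ∀ i, |a i| ≤ ‖T‖ := fun i => by
    have := T.le_opNorm (e i)
    rwa [hT, norm_smul, e.orthonormal.1, mul_one, mul_one, Real.norm_eq_abs] at this
  exact ⟨h, ext_basis e fun i => by rw [hT, diagonal_apply_basis e h]⟩

end Diagonal

/-! ### The Cordes–Heinz inequality by real interpolation. -/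

section Interpolation

variable {E : Type*} [NormedAddCommGroup E] [InnerProductSpace ℝ E] {ι ι' : Type*}

/-- Complete the square in `y`; the minimum of the right side is attained at `y = t x / (t + a²)`.
This is the quadratic `K`-functional in one coordinate. -/
theorem div_mul_sq_le_sq_sub_add {a t : ℝ} (ht : 0 < t) (x y : ℝ) :
    a ^ 2 / (t + a ^ 2) * x ^ 2 ≤ (x - y) ^ 2 + t⁻¹ * (a ^ 2 * y ^ 2) := by
  have h : 0 < t + a ^ 2 := by positivity
  have h1 : (x - y) ^ 2 + t⁻¹ * (a ^ 2 * y ^ 2) - a ^ 2 / (t + a ^ 2) * x ^ 2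
      = (t * x - (t + a ^ 2) * y) ^ 2 / (t * (t + a ^ 2)) := by
    field_simp
    ring
  have h2 : 0 ≤ (t * x - (t + a ^ 2) * y) ^ 2 / (t * (t + a ^ 2)) := by positivity
  linarith

theorem sq_div_mem_Icc {a t : ℝ} (ht : 0 < t) :
    0 ≤ a ^ 2 / (t + a ^ 2) ∧ a ^ 2 / (t + a ^ 2) ≤ 1 :=
  ⟨by positivity, div_le_one_of_le₀ (by linarith) (by positivity)⟩

theorem summable_sq_div_mul (e : HilbertBasis ι ℝ E) (α : ι → ℝ) {t : ℝ} (ht : 0 < t) (v : E) :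
    Summable fun i => α i ^ 2 / (t + α i ^ 2) * ⟪e i, v⟫ ^ 2 :=
  Summable.of_nonneg_of_le (fun _ => mul_nonneg (sq_div_mem_Icc ht).1 (sq_nonneg _))
    (fun _ => mul_le_of_le_one_left (sq_nonneg _) (sq_div_mem_Icc ht).2)
    (hasSum_inner_sq e v).summable

/-- Comparison of the quadratic `K`-functionals of two diagonal operators. -/
theorem tsum_sq_div_mul_le (e : HilbertBasis ι ℝ E) (u : HilbertBasis ι' ℝ E) {α : ι → ℝ}
    {β : ι' → ℝ} {a b c : ℝ} (hα : ∀ i, |α i| ≤ a) (hβ : ∀ j, |β j| ≤ b)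
    (h : ∀ v, ‖diagonal e α v‖ ≤ c * ‖diagonal u β v‖) {t : ℝ} (ht : 0 < t) (v : E) :
    ∑' i, α i ^ 2 / (t + α i ^ 2) * ⟪e i, v⟫ ^ 2
      ≤ ∑' j, (c * β j) ^ 2 / (t + (c * β j) ^ 2) * ⟪u j, v⟫ ^ 2 := by
  have hm : ∀ j, |t / (t + (c * β j) ^ 2)| ≤ 1 := fun j => by
    rw [abs_of_nonneg (by positivity)]
    exact div_le_one_of_le₀ (by nlinarith [sq_nonneg (c * β j)]) (by positivity)
  -- The exact minimizer for the operator `c β`. It gives equality on the right side, while on the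
  -- left any competitor yields an upper bound.
  set w := diagonal u (fun j => t / (t + (c * β j) ^ 2)) v with hw
  have hwj : ∀ j, ⟪u j, w⟫ = t / (t + (c * β j) ^ 2) * ⟪u j, v⟫ := fun j => inner_diagonal u hm j v
  have h1 : ∑' i, α i ^ 2 / (t + α i ^ 2) * ⟪e i, v⟫ ^ 2
      ≤ ‖v - w‖ ^ 2 + t⁻¹ * ‖diagonal e α w‖ ^ 2 := by
    refine hasSum_le (fun i => ?_) (summable_sq_div_mul e α ht v).hasSum
      ((hasSum_inner_sq e (v - w)).add ((norm_diagonal_sq e hα w).mul_left t⁻¹))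
    rw [inner_sub_right]
    exact div_mul_sq_le_sq_sub_add ht _ _
  have h2 : ‖diagonal e α w‖ ^ 2 ≤ c ^ 2 * ‖diagonal u β w‖ ^ 2 := by
    rw [← mul_pow]
    exact pow_le_pow_left₀ (norm_nonneg _) (h w) 2
  have h3 : ‖v - w‖ ^ 2 + t⁻¹ * (c ^ 2 * ‖diagonal u β w‖ ^ 2)
      = ∑' j, (c * β j) ^ 2 / (t + (c * β j) ^ 2) * ⟪u j, v⟫ ^ 2 := by
    refine ((hasSum_inner_sq u (v - w)).add
      (((norm_diagonal_sq u hβ w).mul_left (c ^ 2)).mul_left t⁻¹)).unique ?_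
    convert! (summable_sq_div_mul u (fun j => c * β j) ht v).hasSum using 2 with j
    rw [inner_sub_right, hwj]
    have : 0 < t + (c * β j) ^ 2 := by positivity
    field_simp
    ring
  rw [← h3]
  have := inv_nonneg.mpr ht.le
  nlinarith

open Real in
theorem lintegral_rpowIntegrand {r x : ℝ} (hr : r ∈ Set.Ioo 0 1) (hx : 0 ≤ x) :
    ∫⁻ t in Set.Ioi 0, ENNReal.ofReal (rpowIntegrand₀₁ r t x)
      = ENNReal.ofReal (∫ t in Set.Ioi 0, rpowIntegrand₀₁ r t 1) * ENNReal.ofReal (x ^ r) := by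
  rw [← ofReal_integral_eq_lintegral_ofReal (integrableOn_rpowIntegrand₀₁_Ioi hr hx),
    integral_rpowIntegrand₀₁_eq_rpow_mul_const hr hx, mul_comm,
    ENNReal.ofReal_mul (integral_rpowIntegrand₀₁_one_pos hr).le]
  exact ae_restrict_of_forall_mem measurableSet_Ioi fun t ht =>
    rpowIntegrand₀₁_nonneg hr.1 (le_of_lt ht) hx

open Real in
-- Integrates the `K`-functionals against `t^(r-1)`, using that `∫ t^(r-1) x / (t + x) dt` is a
-- constant multiple of `x^r` for `0 < r < 1`. Extended nonnegative values make the exchange of sum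
-- and integral free of summability conditions.
theorem lintegral_tsum_rpowIntegrand [Countable ι] (e : HilbertBasis ι ℝ E) (α : ι → ℝ)
    {r : ℝ} (hr : r ∈ Set.Ioo 0 1) (v : E) :
    ∫⁻ t in Set.Ioi 0, ENNReal.ofReal (t ^ (r - 1)) *
        ENNReal.ofReal (∑' i, α i ^ 2 / (t + α i ^ 2) * ⟪e i, v⟫ ^ 2)
      = ENNReal.ofReal (∫ t in Set.Ioi 0, rpowIntegrand₀₁ r t 1) *
        ∑' i, ENNReal.ofReal ((α i ^ 2) ^ r) * ENNReal.ofReal (⟪e i, v⟫ ^ 2) := by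
  have h : ∀ t ∈ Set.Ioi (0 : ℝ), ENNReal.ofReal (t ^ (r - 1)) *
        ENNReal.ofReal (∑' i, α i ^ 2 / (t + α i ^ 2) * ⟪e i, v⟫ ^ 2)
      = ∑' i, ENNReal.ofReal (rpowIntegrand₀₁ r t (α i ^ 2)) * ENNReal.ofReal (⟪e i, v⟫ ^ 2) := by
    intro t ht
    have ht : 0 < t := ht
    rw [ENNReal.ofReal_tsum_of_nonneg
      (fun i => mul_nonneg (sq_div_mem_Icc ht).1 (sq_nonneg _)) (summable_sq_div_mul e α ht v),
      ← ENNReal.tsum_mul_left]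
    congr 1
    ext1 i
    rw [ENNReal.ofReal_mul (sq_div_mem_Icc ht).1, ← mul_assoc, ← ENNReal.ofReal_mul (by positivity),
      rpowIntegrand₀₁_eq_pow_div hr ht.le (sq_nonneg _), mul_div_assoc]
  rw [setLIntegral_congr_fun measurableSet_Ioi h, lintegral_tsum, ← ENNReal.tsum_mul_left]
  · congr 1
    ext1 i
    rw [lintegral_mul_const', lintegral_rpowIntegrand hr (sq_nonneg _), mul_assoc]
    exact ENNReal.ofReal_ne_top
  · intro i
    exact (aestronglyMeasurable_rpowIntegrand₀₁ hr
      (sq_nonneg _)).aemeasurable.ennreal_ofReal.mul_const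
      _

/-- The Cordes–Heinz inequality for diagonal operators. -/
theorem norm_diagonal_rpow_le [TopologicalSpace.SeparableSpace E] (e : HilbertBasis ι ℝ E)
    (u : HilbertBasis ι' ℝ E) {α : ι → ℝ} {β : ι' → ℝ} {a b c : ℝ}
    (hα0 : ∀ i, 0 ≤ α i) (hα : ∀ i, α i ≤ a) (hβ0 : ∀ j, 0 ≤ β j) (hβ : ∀ j, β j ≤ b) (hc : 0 ≤ c)
    (h : ∀ v, ‖diagonal e α v‖ ≤ c * ‖diagonal u β v‖) {r : ℝ} (hr : r ∈ Set.Ioo 0 1) (v : E) :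
    ‖diagonal e (fun i => α i ^ r) v‖ ≤ c ^ r * ‖diagonal u (fun j => β j ^ r) v‖ := by
  have := countable_of_hilbertBasis e
  have := countable_of_hilbertBasis u
  have hα' : ∀ i, |α i| ≤ a := fun i => by rw [abs_of_nonneg (hα0 i)]; exact hα i
  have hβ' : ∀ i, |β i| ≤ b := fun i => by rw [abs_of_nonneg (hβ0 i)]; exact hβ i
  have hαr : ∀ i, |α i ^ r| ≤ a ^ r := fun i => by
    rw [abs_of_nonneg (Real.rpow_nonneg (hα0 i) r)]
    exact Real.rpow_le_rpow (hα0 i) (hα i) hr.1.le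
  have hβr : ∀ i, |β i ^ r| ≤ b ^ r := fun i => by
    rw [abs_of_nonneg (Real.rpow_nonneg (hβ0 i) r)]
    exact Real.rpow_le_rpow (hβ0 i) (hβ i) hr.1.le
  have hK := Real.integral_rpowIntegrand₀₁_one_pos hr
  have key : ENNReal.ofReal (∫ t in Set.Ioi 0, Real.rpowIntegrand₀₁ r t 1) *
        ∑' i, ENNReal.ofReal ((α i ^ 2) ^ r) * ENNReal.ofReal (⟪e i, v⟫ ^ 2)
      ≤ ENNReal.ofReal (∫ t in Set.Ioi 0, Real.rpowIntegrand₀₁ r t 1) *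
        ∑' j, ENNReal.ofReal (((c * β j) ^ 2) ^ r) * ENNReal.ofReal (⟪u j, v⟫ ^ 2) := by
    rw [← lintegral_tsum_rpowIntegrand e α hr v,
      ← lintegral_tsum_rpowIntegrand u (fun j => c * β j) hr v]
    refine setLIntegral_mono' measurableSet_Ioi fun t ht => ?_
    gcongr
    exact tsum_sq_div_mul_le e u hα' hβ' h ht v
  rw [ENNReal.mul_le_mul_iff_right (by simpa using hK) ENNReal.ofReal_ne_top] at key
  have e1 : ∑' i, ENNReal.ofReal ((α i ^ 2) ^ r) * ENNReal.ofReal (⟪e i, v⟫ ^ 2)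
      = ENNReal.ofReal (‖diagonal e (fun i => α i ^ r) v‖ ^ 2) := by
    have hs := norm_diagonal_sq e hαr v
    rw [← hs.tsum_eq, ENNReal.ofReal_tsum_of_nonneg (fun i => by positivity) hs.summable]
    congr 1
    ext1 i
    rw [← ENNReal.ofReal_mul (by positivity), ← Real.rpow_natCast, ← Real.rpow_mul (hα0 i),
      mul_comm _ r, Real.rpow_mul (hα0 i), Real.rpow_natCast]
  have e2 : ∑' j, ENNReal.ofReal (((c * β j) ^ 2) ^ r) * ENNReal.ofReal (⟪u j, v⟫ ^ 2)
      = ENNReal.ofReal ((c ^ r * ‖diagonal u (fun j => β j ^ r) v‖) ^ 2) := by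
    have hs := (norm_diagonal_sq u hβr v).mul_left ((c ^ r) ^ 2)
    rw [mul_pow, ← hs.tsum_eq, ENNReal.ofReal_tsum_of_nonneg (fun i => by positivity) hs.summable]
    congr 1
    ext1 j
    have h0 := mul_nonneg hc (hβ0 j)
    rw [← ENNReal.ofReal_mul (by positivity), ← mul_assoc, ← mul_pow,
      ← Real.mul_rpow hc (hβ0 j), ← Real.rpow_natCast, ← Real.rpow_mul h0,
      mul_comm _ r, Real.rpow_mul h0, Real.rpow_natCast]
  rw [e1, e2, ENNReal.ofReal_le_ofReal_iff (by positivity)] at key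
  exact abs_le_of_sq_le_sq' key (by positivity) |>.2

end Interpolation

/-! ### Hilbert–Schmidt bounds and their independence of the basis. -/

section HilbertSchmidt

variable {E F F' E' : Type*} [NormedAddCommGroup E] [InnerProductSpace ℝ E] [CompleteSpace E]
  [NormedAddCommGroup F] [InnerProductSpace ℝ F] [CompleteSpace F]
  [NormedAddCommGroup E'] [InnerProductSpace ℝ E'] [CompleteSpace E']
  {ι ι' : Type*}

omit [CompleteSpace E] in
theorem tsum_inner_sq (e : HilbertBasis ι ℝ E) (v : E) :
    ∑' i, ENNReal.ofReal (⟪e i, v⟫ ^ 2) = ENNReal.ofReal (‖v‖ ^ 2) := by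
  have hs := hasSum_inner_sq e v
  rw [← hs.tsum_eq, ENNReal.ofReal_tsum_of_nonneg (fun i => by positivity) hs.summable]

/-- Parseval in both spaces turns either side into the double sum of squared matrix entries, and
Tonelli exchanges the sums. Passing through the adjoint twice gives independence of the basis. -/
theorem tsum_norm_sq_adjoint (e : HilbertBasis ι ℝ E) (f : HilbertBasis ι' ℝ F) (T : E →L[ℝ] F) :
    ∑' i, ENNReal.ofReal (‖T (e i)‖ ^ 2)
      = ∑' j, ENNReal.ofReal (‖T.adjoint (f j)‖ ^ 2) := by
  simp_rw [← tsum_inner_sq f, ← tsum_inner_sq e]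
  rw [ENNReal.tsum_comm]
  simp_rw [ContinuousLinearMap.adjoint_inner_right, real_inner_comm]

theorem tsum_norm_sq_basis (e : HilbertBasis ι ℝ E) (e' : HilbertBasis ι' ℝ E) (T : E →L[ℝ] F) :
    ∑' i, ENNReal.ofReal (‖T (e i)‖ ^ 2) = ∑' j, ENNReal.ofReal (‖T (e' j)‖ ^ 2) := by
  rw [tsum_norm_sq_adjoint e (onb F), tsum_norm_sq_adjoint e' (onb F)]

/-- The Hilbert–Schmidt norm of `T` is at most `B`. -/
def HSLe (T : E →L[ℝ] F) (B : ℝ) : Prop :=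
  0 ≤ B ∧ ∑' i, ENNReal.ofReal (‖T (onb E i)‖ ^ 2) ≤ ENNReal.ofReal (B ^ 2)

/-- The real form keeps summability as a separate clause, since a divergent real `tsum` has value
`0` and would make the bound vacuous. The basis is arbitrary, so an eigenbasis can be used. -/
theorem hsLe_iff_hasSum (e : HilbertBasis ι ℝ E) {T : E →L[ℝ] F} {B : ℝ} :
    HSLe T B ↔ 0 ≤ B ∧ Summable (fun i => ‖T (e i)‖ ^ 2) ∧ ∑' i, ‖T (e i)‖ ^ 2 ≤ B ^ 2 := by
  unfold HSLe
  rw [tsum_norm_sq_basis (onb E) e]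
  refine and_congr_right fun hB => ⟨fun h => ?_, fun h => ?_⟩
  · have hs : Summable (fun i => ‖T (e i)‖ ^ 2) := by
      have := ENNReal.summable_toReal (ne_top_of_le_ne_top ENNReal.ofReal_ne_top h)
      simpa using this
    refine ⟨hs, ?_⟩
    rw [← ENNReal.ofReal_tsum_of_nonneg (fun i => by positivity) hs] at h
    exact (ENNReal.ofReal_le_ofReal_iff (by positivity)).mp h
  · rw [← ENNReal.ofReal_tsum_of_nonneg (fun i => by positivity) h.1]
    exact ENNReal.ofReal_le_ofReal h.2

theorem IsHilbertSchmidt.hsLe {T : E →L[ℝ] F} (h : IsHilbertSchmidt T) : HSLe T (hsNorm T) := by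
  refine (hsLe_iff_hasSum (onb E)).mpr ⟨Real.sqrt_nonneg _, h, ?_⟩
  rw [hsNorm, Real.sq_sqrt (tsum_nonneg fun i => by positivity)]

theorem HSLe.isHilbertSchmidt {T : E →L[ℝ] F} {B : ℝ} (h : HSLe T B) : IsHilbertSchmidt T :=
  ((hsLe_iff_hasSum (onb E)).mp h).2.1

theorem HSLe.adjoint {T : E →L[ℝ] F} {B : ℝ} (h : HSLe T B) : HSLe T.adjoint B :=
  ⟨h.1, by rw [← tsum_norm_sq_adjoint (onb E) (onb F)]; exact h.2⟩

omit [CompleteSpace F] [CompleteSpace E'] in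
theorem HSLe.comp_left {T : E →L[ℝ] F} {B : ℝ} (h : HSLe T B) {S : F →L[ℝ] E'} {c : ℝ}
    (hS : ‖S‖ ≤ c) : HSLe (S ∘L T) (B * c) := by
  have hc := (norm_nonneg S).trans hS
  refine ⟨mul_nonneg h.1 hc, ?_⟩
  rw [mul_pow, ENNReal.ofReal_mul (by positivity)]
  refine le_trans ?_ (mul_le_mul_left h.2 _)
  rw [← ENNReal.tsum_mul_right]
  refine ENNReal.tsum_le_tsum fun i => ?_
  rw [← ENNReal.ofReal_mul (by positivity), ← mul_pow, mul_comm]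
  refine ENNReal.ofReal_le_ofReal (pow_le_pow_left₀ (norm_nonneg _) ?_ 2)
  exact S.le_of_opNorm_le hS _

theorem HSLe.comp {T : E →L[ℝ] F} {B : ℝ} (h : HSLe T B) {S : E' →L[ℝ] E} {c : ℝ}
    (hS : ‖S‖ ≤ c) : HSLe (T ∘L S) (B * c) := by
  have := (h.adjoint.comp_left (S := S.adjoint) (c := c) (by
    rwa [LinearIsometryEquiv.norm_map])).adjoint
  rwa [ContinuousLinearMap.adjoint_comp, ContinuousLinearMap.adjoint_adjoint,
    ContinuousLinearMap.adjoint_adjoint] at this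

/-- Minkowski's inequality, from Cauchy–Schwarz on finite partial sums. -/
theorem HSLe.add {S T : E →L[ℝ] F} {A B : ℝ} (hS : HSLe S A) (hT : HSLe T B) :
    HSLe (S + T) (A + B) := by
  refine ⟨add_nonneg hS.1 hT.1, ?_⟩
  rw [ENNReal.tsum_eq_iSup_sum]
  refine iSup_le fun s => ?_
  rw [← ENNReal.ofReal_sum_of_nonneg fun i _ => by positivity]
  refine ENNReal.ofReal_le_ofReal ?_
  have h1 := ((hsLe_iff_hasSum (onb E)).mp hS).2
  have h2 := ((hsLe_iff_hasSum (onb E)).mp hT).2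
  have h1' := (h1.1.sum_le_tsum s fun i _ => by positivity).trans h1.2
  have h2' := (h2.1.sum_le_tsum s fun i _ => by positivity).trans h2.2
  have h3 := Finset.sum_mul_sq_le_sq_mul_sq s (fun i => ‖S (onb E i)‖) (fun i => ‖T (onb E i)‖)
  have h4 : ∑ i ∈ s, ‖S (onb E i)‖ * ‖T (onb E i)‖ ≤ A * B := by
    refine abs_le_of_sq_le_sq' ?_ (mul_nonneg hS.1 hT.1) |>.2
    rw [mul_pow]
    exact h3.trans (mul_le_mul h1' h2' (by positivity) (by positivity))
  calc ∑ i ∈ s, ‖(S + T) (onb E i)‖ ^ 2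
      ≤ ∑ i ∈ s, (‖S (onb E i)‖ ^ 2 + 2 * (‖S (onb E i)‖ * ‖T (onb E i)‖)
        + ‖T (onb E i)‖ ^ 2) := by
        refine Finset.sum_le_sum fun i _ => ?_
        have := norm_add_le (S (onb E i)) (T (onb E i))
        rw [add_apply]
        nlinarith [norm_nonneg (S (onb E i) + T (onb E i))]
    _ ≤ (A + B) ^ 2 := by
        rw [Finset.sum_add_distrib, Finset.sum_add_distrib, ← Finset.mul_sum]
        linarith

theorem HSLe.norm_le {T : E →L[ℝ] F} {B : ℝ} (h : HSLe T B) : ‖T‖ ≤ B := by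
  refine ContinuousLinearMap.opNorm_le_bound _ h.1 fun v => ?_
  have h1 := (hsLe_iff_hasSum (onb F)).mp h.adjoint
  have h2 := hasSum_inner_sq (onb F) (T v)
  have : ‖T v‖ ^ 2 ≤ (B * ‖v‖) ^ 2 := by
    rw [mul_pow, ← h2.tsum_eq]
    refine (h2.summable.tsum_le_tsum (fun j => ?_) (h1.2.1.mul_right (‖v‖ ^ 2))).trans ?_
    · rw [← ContinuousLinearMap.adjoint_inner_left, ← mul_pow, ← sq_abs]
      exact pow_le_pow_left₀ (abs_nonneg _) (abs_real_inner_le_norm _ _) 2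
    · rw [tsum_mul_right]
      exact mul_le_mul_of_nonneg_right h1.2.2 (by positivity)
  exact abs_le_of_sq_le_sq' this (mul_nonneg h.1 (norm_nonneg _)) |>.2

end HilbertSchmidt

/-! ### Spectral filters of a perturbed covariance operator. -/

section Perturbation

variable {E F : Type*} [NormedAddCommGroup E] [InnerProductSpace ℝ E] [CompleteSpace E]
  [NormedAddCommGroup F] [InnerProductSpace ℝ F] [CompleteSpace F] {ι ι' : Type*}

omit [CompleteSpace E] in
theorem diagonal_pow (e : HilbertBasis ι ℝ E) {m : ι → ℝ} {M : ℝ} (hm : ∀ i, |m i| ≤ M) (k : ℕ) :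
    diagonal e m ^ k = diagonal e fun i => m i ^ k := by
  induction k with
  | zero =>
    refine ext_basis e fun i => ?_
    have h : ∀ i, |m i ^ 0| ≤ 1 := fun i => by simp
    rw [diagonal_apply_basis e h]; simp
  | succ k ih =>
    have h : ∀ i, |m i ^ k| ≤ M ^ k := fun i => by
      rw [abs_pow]; exact pow_le_pow_left₀ (abs_nonneg _) (hm i) k
    rw [pow_succ, ih, ContinuousLinearMap.mul_def, diagonal_comp e h hm]
    simp only [pow_succ]

/-- Telescoping: each of the `m` steps exchanges one factor and costs `ε q^m`. The unit is only
required to have norm at most `1` because the identity of the zero space has norm `0`. -/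
theorem norm_pow_sub_pow_le {A : Type*} [NormedRing A] (hone : ‖(1 : A)‖ ≤ 1) {P Q : A} {q ε : ℝ}
    (hP : ‖P‖ ≤ q) (hQ : ‖Q‖ ≤ q) (h : ‖Q - P‖ ≤ ε * q) (m : ℕ) :
    ‖Q ^ m - P ^ m‖ ≤ m * ε * q ^ m := by
  have hq := (norm_nonneg P).trans hP
  have hpow : ∀ k, ‖P ^ k‖ ≤ q ^ k := fun k => by
    induction k with
    | zero => simpa using hone
    | succ k ih =>
      rw [pow_succ, pow_succ]
      exact (norm_mul_le _ _).trans (mul_le_mul ih hP (norm_nonneg _) (by positivity))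
  induction m with
  | zero => simp
  | succ m ih =>
    have h1 : Q ^ (m + 1) - P ^ (m + 1) = (Q ^ m - P ^ m) * Q + P ^ m * (Q - P) := by
      rw [pow_succ, pow_succ]; noncomm_ring
    have h2 : ‖P ^ m‖ ≤ q ^ m := hpow m
    calc ‖Q ^ (m + 1) - P ^ (m + 1)‖ ≤ ‖Q ^ m - P ^ m‖ * ‖Q‖ + ‖P ^ m‖ * ‖Q - P‖ := by
          rw [h1]
          exact (norm_add_le _ _).trans (add_le_add (norm_mul_le _ _) (norm_mul_le _ _))
      _ ≤ m * ε * q ^ m * q + q ^ m * (ε * q) :=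
          add_le_add (mul_le_mul ih hQ (norm_nonneg _) ((norm_nonneg _).trans ih))
            (mul_le_mul h2 h (norm_nonneg _) (by positivity))
      _ = (m + 1 : ℕ) * ε * q ^ (m + 1) := by push_cast; ring

omit [CompleteSpace E] in
/-- The inverse of `C + lam` is diagonal in an eigenbasis of `C`. -/
theorem shift_diagonal_mul (e : HilbertBasis ι ℝ E) {a : ι → ℝ} {C : E →L[ℝ] E}
    (hC : ∀ i, C (e i) = a i • e i) (ha : ∀ i, 0 ≤ a i) {lam : ℝ} (hlam : 0 < lam) :
    (C + lam • 1) * diagonal e (fun i => (a i + lam)⁻¹) = 1 ∧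
      diagonal e (fun i => (a i + lam)⁻¹) * (C + lam • 1) = 1 ∧
      C + lam • 1 = diagonal e (fun i => a i + lam) ∧
      (∀ i, |(a i + lam)⁻¹| ≤ lam⁻¹) ∧ (∀ i, |a i + lam| ≤ ‖C‖ + lam) ∧
      ‖diagonal e (fun i => (a i + lam)⁻¹)‖ ≤ lam⁻¹ := by
  have hpos : ∀ i, 0 < a i + lam := fun i => by linarith [ha i]
  have hb : ∀ i, |(a i + lam)⁻¹| ≤ lam⁻¹ := fun i => by
    rw [abs_of_pos (inv_pos.mpr (hpos i))]
    exact inv_anti₀ hlam (by linarith [ha i])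
  have hCi : ∀ i, (C + lam • 1 : E →L[ℝ] E) (e i) = (a i + lam) • e i := fun i => by
    simp [hC, add_smul]
  have hb' : ∀ i, |a i + lam| ≤ ‖C‖ + lam := fun i => by
    rw [abs_of_pos (hpos i)]
    have := (abs_le.mp ((eq_diagonal e hC).1 i)).2
    linarith
  refine ⟨ext_basis e fun i => ?_, ext_basis e fun i => ?_, ext_basis e fun i => ?_, hb, hb',
    norm_diagonal_le e (inv_nonneg.mpr hlam.le) hb⟩
  · rw [ContinuousLinearMap.mul_def, ContinuousLinearMap.comp_apply, diagonal_apply_basis e hb,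
      map_smul, hCi, smul_smul,
      inv_mul_cancel₀ (hpos i).ne', one_smul, one_apply_eq_self]
  · rw [ContinuousLinearMap.mul_def, ContinuousLinearMap.comp_apply, hCi, map_smul,
      diagonal_apply_basis e hb, smul_smul,
      mul_inv_cancel₀ (hpos i).ne', one_smul, one_apply_eq_self]
  · rw [hCi, diagonal_apply_basis e hb']

omit [CompleteSpace E] in
-- Split the inverse into two inverse square roots; one of them is spent on the factor `1 / √lam`.
theorem norm_shift_inv_mul_le (e : HilbertBasis ι ℝ E) {a : ι → ℝ} (ha : ∀ i, 0 ≤ a i) {lam : ℝ}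
    (hlam : 0 < lam) {S : E →L[ℝ] E} {τ : ℝ} (hτ :
      ‖diagonal e (fun i => (a i + lam) ^ (-(1 / 2) : ℝ)) * S‖ ≤ τ) :
    ‖diagonal e (fun i => (a i + lam)⁻¹) * S‖ ≤ τ / √lam := by
  have hpos : ∀ i, 0 < a i + lam := fun i => by linarith [ha i]
  have hb : ∀ i, |(a i + lam) ^ (-(1 / 2) : ℝ)| ≤ (√lam)⁻¹ := fun i => by
    rw [abs_of_pos (Real.rpow_pos_of_pos (hpos i) _), Real.rpow_neg (hpos i).le,
      ← Real.sqrt_eq_rpow]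
    exact inv_anti₀ (Real.sqrt_pos.mpr hlam) (Real.sqrt_le_sqrt (by linarith [ha i]))
  have h : diagonal e (fun i => (a i + lam)⁻¹) = diagonal e (fun i => (a i + lam) ^ (-(1 / 2) : ℝ))
      * diagonal e (fun i => (a i + lam) ^ (-(1 / 2) : ℝ)) := by
    rw [ContinuousLinearMap.mul_def, diagonal_comp e hb hb]
    congr 1
    ext1 i
    rw [← Real.rpow_add (hpos i), ← Real.rpow_neg_one]
    norm_num
  have hD := norm_diagonal_le e (by positivity) hb
  rw [h, mul_assoc, div_eq_inv_mul τ]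
  exact (norm_mul_le _ _).trans (mul_le_mul hD hτ (norm_nonneg _) (by positivity))

variable (e : HilbertBasis ι ℝ E) (u : HilbertBasis ι' ℝ E) {a : ι → ℝ} {σ : ι' → ℝ}
  {C Chat : E →L[ℝ] E} (hC : ∀ i, C (e i) = a i • e i) (hChat : ∀ j, Chat (u j) = σ j • u j)
  (ha : ∀ i, 0 ≤ a i) (hσ : ∀ j, 0 ≤ σ j) {lam : ℝ} (hlam : 0 < lam)
include hC hChat ha hσ hlam

omit [CompleteSpace E] in
-- The resolvent identity `Q - P = -P (Chat - C) Q`, with `‖Q‖ ≤ lam⁻¹`.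
theorem norm_resolvent_sub_le {ε : ℝ}
    (hε : ‖diagonal e (fun i => (a i + lam)⁻¹) * (Chat - C)‖ ≤ ε) :
    ‖diagonal u (fun j => (σ j + lam)⁻¹) - diagonal e (fun i => (a i + lam)⁻¹)‖ ≤ ε * lam⁻¹ := by
  obtain ⟨-, h1, -, -⟩ := shift_diagonal_mul e hC ha hlam
  obtain ⟨h2, -, -, -, -, h3⟩ := shift_diagonal_mul u hChat hσ hlam
  set P := diagonal e (fun i => (a i + lam)⁻¹)
  set Q := diagonal u (fun j => (σ j + lam)⁻¹)
  have h : Q - P = -((P * (Chat - C)) * Q) := by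
    calc Q - P = (P * (C + lam • 1)) * Q - P * ((Chat + lam • 1) * Q) := by
          rw [h1, h2, one_mul, mul_one]
      _ = -((P * (Chat - C)) * Q) := by noncomm_ring
  rw [h, norm_neg]
  exact (norm_mul_le _ _).trans
    (mul_le_mul hε h3 (norm_nonneg _) ((norm_nonneg _).trans hε))

/-- By taking adjoints, `(Chat - C) (C + lam)⁻¹` also has norm at most `1/2`. Hence `(Chat - C) v`
is at most half of `(C + lam) v` in norm and can be absorbed. This is the hypothesis that
Cordes–Heinz needs. -/
theorem norm_shift_le (hε : ‖diagonal e (fun i => (a i + lam)⁻¹) * (Chat - C)‖ ≤ 1 / 2) (v : E) :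
    ‖diagonal e (fun i => a i + lam) v‖ ≤ 2 * ‖diagonal u (fun j => σ j + lam) v‖ := by
  obtain ⟨-, h1, h2, hb, -⟩ := shift_diagonal_mul e hC ha hlam
  obtain ⟨-, -, h4, -⟩ := shift_diagonal_mul u hChat hσ hlam
  rw [← h2, ← h4]
  have hsym : ∀ (x y : E), ⟪(Chat - C) x, y⟫ = ⟪x, (Chat - C) y⟫ := fun x y => by
    obtain ⟨b1, e1⟩ := eq_diagonal e hC
    obtain ⟨b2, e2⟩ := eq_diagonal u hChat
    have k1 : ⟪C x, y⟫ = ⟪x, C y⟫ := by rw [e1]; exact inner_diagonal_left e b1 x y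
    have k2 : ⟪Chat x, y⟫ = ⟪x, Chat y⟫ := by rw [e2]; exact inner_diagonal_left u b2 x y
    rw [sub_apply, sub_apply, inner_sub_left, inner_sub_right, k1, k2]
  have hadj : (Chat - C) * diagonal e (fun i => (a i + lam)⁻¹)
      = (diagonal e (fun i => (a i + lam)⁻¹) * (Chat - C)).adjoint := by
    rw [ContinuousLinearMap.eq_adjoint_iff]
    intro x y
    rw [ContinuousLinearMap.mul_def, ContinuousLinearMap.mul_def,
      ContinuousLinearMap.comp_apply, ContinuousLinearMap.comp_apply, hsym,
      inner_diagonal_left e hb]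
  have hn : ‖(Chat - C) * diagonal e (fun i => (a i + lam)⁻¹)‖ ≤ 1 / 2 := by
    rwa [hadj, LinearIsometryEquiv.norm_map]
  have h5 : (Chat - C) v = ((Chat - C) * diagonal e (fun i => (a i + lam)⁻¹))
      ((C + lam • 1 : E →L[ℝ] E) v) := by
    rw [← ContinuousLinearMap.comp_apply, ← ContinuousLinearMap.mul_def, mul_assoc, h1, mul_one]
  have h6 := ContinuousLinearMap.le_of_opNorm_le _ hn ((C + lam • 1 : E →L[ℝ] E) v)
  rw [← h5] at h6
  have h7 : (C + lam • 1 : E →L[ℝ] E) v = (Chat + lam • 1 : E →L[ℝ] E) v - (Chat - C) v := by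
    rw [add_apply, add_apply, sub_apply]; abel
  have h8 := norm_sub_le ((Chat + lam • 1 : E →L[ℝ] E) v) ((Chat - C) v)
  rw [← h7] at h8
  linarith

theorem norm_rpow_mul_rpow_neg_le [TopologicalSpace.SeparableSpace E]
    (hε : ‖diagonal e (fun i => (a i + lam)⁻¹) * (Chat - C)‖ ≤ 1 / 2) {r : ℝ}
    (hr : r ∈ Set.Ico 0 1) :
    ‖diagonal e (fun i => (a i + lam) ^ r) ∘L diagonal u (fun j => (σ j + lam) ^ (-r))‖
      ≤ 2 ^ r := by
  have hpos : ∀ i, 0 < a i + lam := fun i => by linarith [ha i]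
  have hpos' : ∀ j, 0 < σ j + lam := fun j => by linarith [hσ j]
  obtain ⟨-, -, -, -, hA, -⟩ := shift_diagonal_mul e hC ha hlam
  obtain ⟨-, -, -, -, hS, -⟩ := shift_diagonal_mul u hChat hσ hlam
  have hbS : ∀ j, |(σ j + lam) ^ (-r)| ≤ lam ^ (-r) := fun j => by
    rw [abs_of_pos (Real.rpow_pos_of_pos (hpos' j) _)]
    exact Real.rpow_le_rpow_of_nonpos hlam (by linarith [hσ j]) (by linarith [hr.1])
  have hbS' : ∀ j, |(σ j + lam) ^ r| ≤ (‖Chat‖ + lam) ^ r := fun j => by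
    rw [abs_of_pos (Real.rpow_pos_of_pos (hpos' j) _)]
    exact Real.rpow_le_rpow (hpos' j).le ((le_abs_self _).trans (hS j)) hr.1
  -- The exponent `0`, which occurs when `ν` is an integer, lies outside the range of the integral
  -- representation.
  rcases hr.1.eq_or_lt with rfl | hr0
  · simp only [Real.rpow_zero, neg_zero]
    refine (ContinuousLinearMap.opNorm_comp_le _ _).trans ?_
    have h1 := norm_diagonal_le e (m := fun _ => (1 : ℝ)) zero_le_one (by simp)
    have h2 := norm_diagonal_le u (m := fun _ => (1 : ℝ)) zero_le_one (by simp)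
    nlinarith [norm_nonneg (diagonal e fun _ => (1 : ℝ)), norm_nonneg (diagonal u fun _ => (1 : ℝ))]
  · refine ContinuousLinearMap.opNorm_le_bound _ (by positivity) fun v => ?_
    rw [ContinuousLinearMap.comp_apply]
    refine (norm_diagonal_rpow_le e u (fun i => (hpos i).le) (fun i => (le_abs_self _).trans (hA i))
      (fun j => (hpos' j).le) (fun j => (le_abs_self _).trans (hS j)) zero_le_two
      (norm_shift_le e u hC hChat ha hσ hlam hε) ⟨hr0, hr.2⟩ _).trans (le_of_eq ?_)
    rw [← ContinuousLinearMap.comp_apply, diagonal_comp u hbS' hbS]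
    congr 2
    refine ext_inner_basis u fun j => ?_
    have : ∀ j, (σ j + lam) ^ r * (σ j + lam) ^ (-r) = 1 := fun j => by
      rw [← Real.rpow_add (hpos' j), add_neg_cancel, Real.rpow_zero]
    simp only [this]
    rw [inner_diagonal u (M := 1) (by simp), one_mul]

/-- The approximation error of a spectral filter with residuals `ρ j`, applied to an operator that
satisfies a source condition with respect to a perturbed covariance. -/
theorem hsLe_residual [TopologicalSpace.SeparableSpace E] {ε : ℝ}
    (hε : ‖diagonal e (fun i => (a i + lam)⁻¹) * (Chat - C)‖ ≤ ε) (hε2 : ε ≤ 1 / 2)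
    {Cstar Co : E →L[ℝ] F} {Bs Bo ν R Φ Ψ : ℝ} (hν : 0 ≤ ν) (hCs : HSLe Cstar Bs)
    (hCo : HSLe Co Bo) {ψ : ι → ℝ} (hψ : ∀ i, |ψ i| ≤ Ψ) (hsrc : Cstar = Co ∘L diagonal e ψ)
    (hΦ : 0 ≤ Φ) (hψν : ∀ i, |ψ i| * (a i + lam) ^ (-ν) ≤ Φ * lam ^ (-ν)) {ρ : ι' → ℝ}
    (hR : 0 ≤ R) (hρ : ∀ j, |ρ j| * (σ j + lam) ^ ν ≤ R * lam ^ ν) :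
    HSLe (Cstar ∘L diagonal u ρ) (Bs * (⌊ν⌋₊ * ε * R) + Bo * (Φ * 2 ^ (ν - ⌊ν⌋₊) * R)) := by
  set m := ⌊ν⌋₊
  set r := ν - m with hr
  have hr01 : r ∈ Set.Ico 0 1 :=
    ⟨sub_nonneg.mpr (Nat.floor_le hν), by rw [hr]; linarith [Nat.lt_floor_add_one ν]⟩
  have hpos : ∀ i, 0 < a i + lam := fun i => by linarith [ha i]
  have hpos' : ∀ j, 0 < σ j + lam := fun j => by linarith [hσ j]
  obtain ⟨-, -, -, hPb, hA, hP⟩ := shift_diagonal_mul e hC ha hlam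
  obtain ⟨-, -, -, hQb, -, hQ⟩ := shift_diagonal_mul u hChat hσ hlam
  have hPQ := norm_resolvent_sub_le e u hC hChat ha hσ hlam hε
  have hcordes := norm_rpow_mul_rpow_neg_le e u hC hChat ha hσ hlam (hε.trans hε2) hr01
  have hε0 := (norm_nonneg _).trans hε
  set P := diagonal e (fun i => (a i + lam)⁻¹)
  set Q := diagonal u (fun j => (σ j + lam)⁻¹)
  have hbr : ∀ j, |(σ j + lam) ^ (-r)| ≤ lam ^ (-r) := fun j => by
    rw [abs_of_pos (Real.rpow_pos_of_pos (hpos' j) _)]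
    exact Real.rpow_le_rpow_of_nonpos hlam (by linarith [hσ j]) (by linarith [hr01.1])
  have hbρ : ∀ j, |ρ j * (σ j + lam) ^ ν| ≤ R * lam ^ ν := fun j => by
    rw [abs_mul, abs_of_pos (Real.rpow_pos_of_pos (hpos' j) ν)]; exact hρ j
  have hbQm : ∀ j, |(σ j + lam)⁻¹ ^ m| ≤ lam⁻¹ ^ m := fun j => by
    rw [abs_pow]; exact pow_le_pow_left₀ (abs_nonneg _) (hQb j) m
  have hbPm : ∀ i, |(a i + lam)⁻¹ ^ m| ≤ lam⁻¹ ^ m := fun j => by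
    rw [abs_pow]; exact pow_le_pow_left₀ (abs_nonneg _) (hPb j) m
  have hbψ : ∀ i, |ψ i * (a i + lam) ^ (-ν)| ≤ Φ * lam ^ (-ν) := fun i => by
    rw [abs_mul, abs_of_pos (Real.rpow_pos_of_pos (hpos i) (-ν))]; exact hψν i
  have hbar : ∀ i, |(a i + lam) ^ r| ≤ (‖C‖ + lam) ^ r := fun i => by
    rw [abs_of_pos (Real.rpow_pos_of_pos (hpos i) _)]
    exact Real.rpow_le_rpow (hpos i).le ((le_abs_self _).trans (hA i)) hr01.1
  set U := diagonal u (fun j => (σ j + lam) ^ (-r))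
  set V := diagonal u (fun j => ρ j * (σ j + lam) ^ ν)
  -- The exponents `-m`, `-r` and `ν` add up to `0`.
  have hfac : diagonal u ρ = (Q ^ m) ∘L (U ∘L V) := by
    rw [diagonal_pow u hQb, diagonal_comp u hbr hbρ, diagonal_comp u hbQm (M' := lam ^ (-r) *
      (R * lam ^ ν)) (fun j => by
        rw [abs_mul]; exact mul_le_mul (hbr j) (hbρ j) (abs_nonneg _) (by positivity))]
    congr 1
    ext1 j
    rw [inv_pow, ← Real.rpow_natCast, ← Real.rpow_neg (hpos' j).le]
    calc ρ j = ρ j * (σ j + lam) ^ (-(m : ℝ) + -r + ν) := by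
          rw [hr]; ring_nf; rw [Real.rpow_zero, mul_one]
      _ = _ := by rw [Real.rpow_add (hpos' j), Real.rpow_add (hpos' j)]; ring
  -- Here `-m = -ν + r`: the source function absorbs the full power `-ν`, and the surplus `r < 1` is
  -- left for Cordes–Heinz.
  have hsrcfac : diagonal e ψ ∘L (P ^ m) = diagonal e (fun i => ψ i * (a i + lam) ^ (-ν)) ∘L
      diagonal e (fun i => (a i + lam) ^ r) := by
    rw [diagonal_pow e hPb, diagonal_comp e hψ hbPm, diagonal_comp e hbψ hbar]
    congr 1
    ext1 i
    rw [inv_pow, ← Real.rpow_natCast, ← Real.rpow_neg (hpos i).le, mul_assoc,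
      ← Real.rpow_add (hpos i)]
    congr 2
    rw [hr]; ring
  -- Replace `Q ^ m` by `P ^ m`. The difference is charged to `Cstar`; in the main part `P ^ m` is
  -- diagonal in the same basis as the source function, so the factorization through `Co` applies.
  have hsplit : Cstar ∘L diagonal u ρ = Cstar ∘L ((Q ^ m - P ^ m) ∘L (U ∘L V)) +
      Co ∘L (diagonal e (fun i => ψ i * (a i + lam) ^ (-ν)) ∘L
        ((diagonal e (fun i => (a i + lam) ^ r) ∘L U) ∘L V)) := by
    have : Cstar ∘L ((P ^ m) ∘L (U ∘L V)) = Co ∘L (diagonal e (fun i => ψ i * (a i + lam) ^ (-ν)) ∘L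
        ((diagonal e (fun i => (a i + lam) ^ r) ∘L U) ∘L V)) := by
      calc Cstar ∘L ((P ^ m) ∘L (U ∘L V)) = Co ∘L ((diagonal e ψ ∘L (P ^ m)) ∘L (U ∘L V)) := by
            rw [hsrc]; rfl
        _ = _ := by rw [hsrcfac]; rfl
    rw [← this, ← ContinuousLinearMap.comp_add, ← ContinuousLinearMap.add_comp, sub_add_cancel,
      hfac]
  have hU : ‖U‖ ≤ lam ^ (-r) := norm_diagonal_le u (by positivity) hbr
  have hV : ‖V‖ ≤ R * lam ^ ν := norm_diagonal_le u (by positivity) hbρ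
  have hpow := norm_pow_sub_pow_le ContinuousLinearMap.norm_id_le hP hQ hPQ m
  have h1 : ‖(Q ^ m - P ^ m) ∘L (U ∘L V)‖ ≤ m * ε * R := by
    calc ‖(Q ^ m - P ^ m) ∘L (U ∘L V)‖ ≤ (m * ε * lam⁻¹ ^ m) * (lam ^ (-r) * (R * lam ^ ν)) := by
          refine (ContinuousLinearMap.opNorm_comp_le _ _).trans
            (mul_le_mul hpow ?_ (norm_nonneg _) (by positivity))
          exact (ContinuousLinearMap.opNorm_comp_le _ _).trans
            (mul_le_mul hU hV (norm_nonneg _) (by positivity))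
      _ = m * ε * R * lam ^ (-(m : ℝ) + -r + ν) := by
          rw [Real.rpow_add hlam, Real.rpow_add hlam, inv_pow, ← Real.rpow_natCast lam m,
            ← Real.rpow_neg hlam.le]
          ring
      _ = m * ε * R := by rw [hr]; ring_nf; rw [Real.rpow_zero, mul_one]
  have h2 : ‖diagonal e (fun i => ψ i * (a i + lam) ^ (-ν)) ∘L
        ((diagonal e (fun i => (a i + lam) ^ r) ∘L U) ∘L V)‖ ≤ Φ * 2 ^ r * R := by
    calc _ ≤ (Φ * lam ^ (-ν)) * (2 ^ r * (R * lam ^ ν)) := by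
          refine (ContinuousLinearMap.opNorm_comp_le _ _).trans
            (mul_le_mul (norm_diagonal_le e (by positivity) hbψ) ?_ (norm_nonneg _) (by positivity))
          exact (ContinuousLinearMap.opNorm_comp_le _ _).trans
            (mul_le_mul hcordes hV (norm_nonneg _) (by positivity))
      _ = Φ * 2 ^ r * R * lam ^ (-ν + ν) := by rw [Real.rpow_add hlam]; ring
      _ = Φ * 2 ^ r * R := by rw [neg_add_cancel, Real.rpow_zero, mul_one]
  rw [hsplit]
  exact (hCs.comp h1).add (hCo.comp h2)

/-- The sample error of a spectral filter with values `g j`. -/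
theorem hsLe_filter [TopologicalSpace.SeparableSpace E]
    (hε : ‖diagonal e (fun i => (a i + lam)⁻¹) * (Chat - C)‖ ≤ 1 / 2)
    {W : E →L[ℝ] F} {η Γ : ℝ}
    (hW : HSLe (W ∘L diagonal e (fun i => (a i + lam) ^ (-(1 / 2) : ℝ))) η) {g : ι' → ℝ}
    (hΓ : 0 ≤ Γ) (hg : ∀ j, |g j| * √(σ j + lam) ≤ Γ) :
    HSLe (W ∘L diagonal u g) (η * (√2 * Γ)) := by
  have hpos : ∀ i, 0 < a i + lam := fun i => by linarith [ha i]
  have hpos' : ∀ j, 0 < σ j + lam := fun j => by linarith [hσ j]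
  obtain ⟨-, -, -, -, hA, -⟩ := shift_diagonal_mul e hC ha hlam
  have hcordes := norm_rpow_mul_rpow_neg_le e u hC hChat ha hσ hlam hε (r := 1 / 2) (by norm_num)
  have hb : ∀ i, |(a i + lam) ^ (-(1 / 2) : ℝ)| ≤ lam ^ (-(1 / 2) : ℝ) := fun i => by
    rw [abs_of_pos (Real.rpow_pos_of_pos (hpos i) _)]
    exact Real.rpow_le_rpow_of_nonpos hlam (by linarith [ha i]) (by norm_num)
  have hbσ : ∀ j, |(σ j + lam) ^ (-(1 / 2) : ℝ)| ≤ lam ^ (-(1 / 2) : ℝ) := fun i => by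
    rw [abs_of_pos (Real.rpow_pos_of_pos (hpos' i) _)]
    exact Real.rpow_le_rpow_of_nonpos hlam (by linarith [hσ i]) (by norm_num)
  have hb' : ∀ i, |(a i + lam) ^ (1 / 2 : ℝ)| ≤ (‖C‖ + lam) ^ (1 / 2 : ℝ) := fun i => by
    rw [abs_of_pos (Real.rpow_pos_of_pos (hpos i) _)]
    exact Real.rpow_le_rpow (hpos i).le ((le_abs_self _).trans (hA i)) (by norm_num)
  have hbg : ∀ j, |g j * (σ j + lam) ^ (1 / 2 : ℝ)| ≤ Γ := fun j => by
    rw [abs_mul, abs_of_pos (Real.rpow_pos_of_pos (hpos' j) _), ← Real.sqrt_eq_rpow]; exact hg j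
  have h1 : W ∘L diagonal u g = (W ∘L diagonal e (fun i => (a i + lam) ^ (-(1 / 2) : ℝ))) ∘L
      ((diagonal e (fun i => (a i + lam) ^ (1 / 2 : ℝ)) ∘L
        diagonal u (fun j => (σ j + lam) ^ (-(1 / 2) : ℝ))) ∘L
        diagonal u (fun j => g j * (σ j + lam) ^ (1 / 2 : ℝ))) := by
    have e1 : diagonal e (fun i => (a i + lam) ^ (-(1 / 2) : ℝ)) ∘L
        diagonal e (fun i => (a i + lam) ^ (1 / 2 : ℝ)) = ContinuousLinearMap.id ℝ E := by
      rw [diagonal_comp e hb hb']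
      refine ext_basis e fun i => ?_
      have h0 : ∀ i, (a i + lam) ^ (-(1 / 2) : ℝ) * (a i + lam) ^ (1 / 2 : ℝ) = 1 := fun i => by
        rw [← Real.rpow_add (hpos i)]; norm_num
      simp only [h0]
      rw [diagonal_apply_basis e (M := 1) (by simp), one_smul, ContinuousLinearMap.id_apply]
    have e2 : diagonal u (fun j => (σ j + lam) ^ (-(1 / 2) : ℝ)) ∘L
        diagonal u (fun j => g j * (σ j + lam) ^ (1 / 2 : ℝ)) = diagonal u g := by
      rw [diagonal_comp u hbσ hbg]
      congr 1
      ext1 j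
      rw [mul_left_comm, ← Real.rpow_add (hpos' j)]
      norm_num
    rw [← e2]
    calc _ = W ∘L (ContinuousLinearMap.id ℝ E ∘L
          (diagonal u (fun j => (σ j + lam) ^ (-(1 / 2) : ℝ)) ∘L
          diagonal u (fun j => g j * (σ j + lam) ^ (1 / 2 : ℝ)))) := by
          rw [ContinuousLinearMap.id_comp]
      _ = _ := by rw [← e1]; rfl
  rw [h1]
  refine hW.comp ((ContinuousLinearMap.opNorm_comp_le _ _).trans ?_)
  rw [Real.sqrt_eq_rpow]
  exact mul_le_mul hcordes (norm_diagonal_le u hΓ hbg) (norm_nonneg _) (by positivity)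

end Perturbation

/-! ### Concentration of sums of independent vectors in a Hilbert space. -/

section Concentration

open scoped ENNReal

variable {K : Type*} [NormedAddCommGroup K] [InnerProductSpace ℝ K]

omit [InnerProductSpace ℝ K] in
-- The function `cosh √t = ∑ t^k / (2k)!` is convex in `t ≥ 0`, term by term.
theorem cosh_norm_le_of_norm_sq_eq {x : K} {w₁ w₂ p q : ℝ} (h₁ : 0 ≤ w₁) (h₂ : 0 ≤ w₂)
    (hw : w₁ + w₂ = 1) (hx : ‖x‖ ^ 2 = w₁ * p ^ 2 + w₂ * q ^ 2) :
    Real.cosh ‖x‖ ≤ w₁ * Real.cosh p + w₂ * Real.cosh q := by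
  refine hasSum_le (fun k => ?_) (Real.hasSum_cosh ‖x‖)
    (((Real.hasSum_cosh p).mul_left w₁).add ((Real.hasSum_cosh q).mul_left w₂))
  have h := (convexOn_pow k).2 (sq_nonneg p) (sq_nonneg q) h₁ h₂ hw
  simp only [smul_eq_mul] at h
  rw [pow_mul, hx, pow_mul, pow_mul, ← mul_div_assoc, ← mul_div_assoc, ← add_div]
  exact div_le_div_of_nonneg_right h (by positivity)

/-- With `κ` the cosine of the angle between `x` and `y`, `‖x + y‖²` is the convex combination of
`(‖x‖ ± ‖y‖)²` with weights `(1 ± κ) / 2`. The part linear in `y` is kept apart because it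
integrates to zero for centred `y`; the rest is of second order. -/
theorem cosh_norm_add_le (x y : K) :
    Real.cosh ‖x + y‖ ≤ Real.cosh ‖x‖ + Real.sinh ‖x‖ / ‖x‖ * ⟪x, y⟫
      + Real.cosh ‖x‖ * (Real.exp ‖y‖ - 1 - ‖y‖) := by
  obtain ⟨κ, hκ1, hκ2, hκ⟩ : ∃ κ : ℝ, -1 ≤ κ ∧ κ ≤ 1 ∧ ⟪x, y⟫ = κ * (‖x‖ * ‖y‖) := by
    have h := abs_le.mp (abs_real_inner_div_norm_mul_norm_le_one x y)
    refine ⟨_, h.1, h.2, ?_⟩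
    rcases eq_or_ne (‖x‖ * ‖y‖) 0 with h0 | h0
    · rcases mul_eq_zero.mp h0 with h1 | h1
      · simp [norm_eq_zero.mp h1]
      · simp [norm_eq_zero.mp h1]
    · rw [div_mul_cancel₀ _ h0]
  have h1 := cosh_norm_le_of_norm_sq_eq (x := x + y) (w₁ := (1 + κ) / 2) (w₂ := (1 - κ) / 2)
    (p := ‖x‖ + ‖y‖) (q := ‖x‖ - ‖y‖) (by linarith) (by linarith) (by ring)
    (by rw [norm_add_sq_real, hκ]; ring)
  rw [Real.cosh_add, Real.cosh_sub] at h1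
  have h2 : Real.sinh ‖x‖ / ‖x‖ * ⟪x, y⟫ = κ * (Real.sinh ‖x‖ * ‖y‖) := by
    rcases eq_or_ne ‖x‖ 0 with h0 | h0
    · simp [h0]
    · rw [hκ]; field_simp
  have h3 : ‖y‖ ≤ Real.sinh ‖y‖ := Real.self_le_sinh_iff.mpr (norm_nonneg y)
  have h4 : 0 ≤ Real.sinh ‖x‖ := Real.sinh_nonneg_iff.mpr (norm_nonneg x)
  have h5 : Real.sinh ‖x‖ ≤ Real.cosh ‖x‖ := (Real.sinh_lt_cosh ‖x‖).le
  have h6 : Real.exp ‖y‖ = Real.cosh ‖y‖ + Real.sinh ‖y‖ := (Real.cosh_add_sinh _).symm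
  have h7 : κ * (Real.sinh ‖x‖ * (Real.sinh ‖y‖ - ‖y‖))
      ≤ Real.cosh ‖x‖ * (Real.sinh ‖y‖ - ‖y‖) := by
    have := mul_nonneg h4 (sub_nonneg.mpr h3)
    have := mul_le_mul_of_nonneg_right h5 (sub_nonneg.mpr h3)
    nlinarith
  rw [h2, h6]
  nlinarith

variable {Ω : Type*} [MeasurableSpace Ω] {μ : Measure Ω} [IsProbabilityMeasure μ]

omit [InnerProductSpace ℝ K] in
/-- Iterated one-step bounds for functionals of sums of independent random vectors. -/
theorem lintegral_pi_sum_le {ξ : Ω → K} (hξ : StronglyMeasurable ξ) {V : ℕ → K → ℝ≥0∞}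
    (hV : Continuous (V 0)) (h : ∀ k x, ∫⁻ ω, V k (x + ξ ω) ∂μ ≤ V (k + 1) x) (n : ℕ) (x : K) :
    ∫⁻ z, V 0 (x + ∑ i, ξ (z i)) ∂(Measure.pi fun _ : Fin n => μ) ≤ V n x := by
  induction n generalizing x with
  | zero => simp
  | succ n ih =>
    have hm : ∀ m : ℕ, ∀ x : K, StronglyMeasurable fun z : Fin m → Ω => x + ∑ i, ξ (z i) :=
      fun m x => stronglyMeasurable_const.add
        (Finset.stronglyMeasurable_fun_sum _ fun i _ => hξ.comp_measurable (measurable_pi_apply i))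
    have hmp := (measurePreserving_piFinSuccAbove (fun _ : Fin (n + 1) => μ) 0).symm
    -- Peel off the first sample point and treat it as a shift of the starting point, which is why
    -- the statement carries a general `x`.
    rw [← hmp.lintegral_comp ((hV.comp_stronglyMeasurable (hm _ x)).measurable),
      lintegral_prod]
    · refine le_trans (lintegral_mono fun ω => ?_) (h n x)
      refine le_trans (le_of_eq ?_) (ih (x + ξ ω))
      refine lintegral_congr fun z => ?_
      simp [Fin.sum_univ_succ, add_assoc]
    · exact ((hV.comp_stronglyMeasurable (hm _ x)).measurable.comp
        (MeasurableEquiv.measurable _)).aemeasurable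

variable [CompleteSpace K]

omit [InnerProductSpace ℝ K] [CompleteSpace K] in
theorem integrable_of_norm_le {ξ : Ω → K} (hξ : StronglyMeasurable ξ) {L : ℝ}
    (hL : ∀ᵐ ω ∂μ, ‖ξ ω‖ ≤ L) : Integrable ξ μ :=
  Integrable.of_bound hξ.aestronglyMeasurable L hL

omit [InnerProductSpace ℝ K] [CompleteSpace K] in
theorem integrable_norm_sq_of_norm_le {ξ : Ω → K} (hξ : StronglyMeasurable ξ) {L : ℝ}
    (hL : ∀ᵐ ω ∂μ, ‖ξ ω‖ ≤ L) : Integrable (fun ω => ‖ξ ω‖ ^ 2) μ := by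
  refine Integrable.of_bound (hξ.norm.pow 2).aestronglyMeasurable (L ^ 2) ?_
  filter_upwards [hL] with ω h
  rw [norm_pow, norm_norm]
  exact pow_le_pow_left₀ (norm_nonneg _) h 2

/-- The iteration runs with the potential `‖x‖² + k v`; the cross term vanishes because `ξ` is
centred. -/
theorem lintegral_norm_sum_sq_le {ξ : Ω → K} (hξ : StronglyMeasurable ξ) {L v : ℝ}
    (hL : ∀ᵐ ω ∂μ, ‖ξ ω‖ ≤ L) (h0 : ∫ ω, ξ ω ∂μ = 0) (hv : ∫ ω, ‖ξ ω‖ ^ 2 ∂μ ≤ v) (n : ℕ) :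
    ∫⁻ z, ENNReal.ofReal (‖∑ i, ξ (z i)‖ ^ 2) ∂(Measure.pi fun _ : Fin n => μ)
      ≤ ENNReal.ofReal (n * v) := by
  have hv0 : 0 ≤ v := (integral_nonneg fun ω => by positivity).trans hv
  have hi := integrable_of_norm_le hξ hL
  have hi2 := integrable_norm_sq_of_norm_le hξ hL
  have h := lintegral_pi_sum_le (μ := μ) hξ
    (V := fun k x => ENNReal.ofReal (‖x‖ ^ 2 + k * v))
    (ENNReal.continuous_ofReal.comp (by fun_prop)) (fun k x => ?_) n 0
  · simpa using h
  · have e1 : ∀ ω, ‖x + ξ ω‖ ^ 2 + k * v = ‖x‖ ^ 2 + k * v + 2 * ⟪x, ξ ω⟫ + ‖ξ ω‖ ^ 2 := fun ω => by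
      rw [norm_add_sq_real]; ring
    have hint : Integrable (fun ω => ‖x‖ ^ 2 + k * v + 2 * ⟪x, ξ ω⟫) μ :=
      (integrable_const _).add ((hi.const_inner x).const_mul 2)
    rw [← ofReal_integral_eq_lintegral_ofReal (by simp only [e1]; exact hint.add hi2)
      (ae_of_all _ fun ω => by positivity)]
    refine ENNReal.ofReal_le_ofReal ?_
    simp only [e1]
    rw [integral_add hint hi2, integral_add (integrable_const _) ((hi.const_inner x).const_mul 2),
      integral_const_mul, integral_inner hi, h0]
    simp
    linarith

/-- Chebyshev's inequality for sums of independent random vectors. -/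
theorem meas_norm_sum_gt_le_chebyshev {ξ : Ω → K} (hξ : StronglyMeasurable ξ) {L v : ℝ}
    (hL : ∀ᵐ ω ∂μ, ‖ξ ω‖ ≤ L) (h0 : ∫ ω, ξ ω ∂μ = 0) (hv : ∫ ω, ‖ξ ω‖ ^ 2 ∂μ ≤ v) (n : ℕ)
    {a : ℝ} (ha : 0 < a) :
    (Measure.pi fun _ : Fin n => μ) {z | a * √(n * v) < ‖∑ i, ξ (z i)‖}
      ≤ ENNReal.ofReal (1 / a ^ 2) := by
  have hv0 : 0 ≤ v := (integral_nonneg fun ω => by positivity).trans hv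
  have hle := lintegral_norm_sum_sq_le hξ hL h0 hv n
  have hm : StronglyMeasurable fun z : Fin n → Ω => ∑ i, ξ (z i) :=
    Finset.stronglyMeasurable_fun_sum _ fun i _ => hξ.comp_measurable (measurable_pi_apply i)
  have hm2 : Measurable fun z : Fin n → Ω => ENNReal.ofReal (‖∑ i, ξ (z i)‖ ^ 2) :=
    (hm.norm.pow 2).measurable.ennreal_ofReal
  -- Markov's inequality needs a positive level. When `n v = 0` the sum vanishes almost everywhere
  -- instead.
  rcases (mul_nonneg n.cast_nonneg hv0 : 0 ≤ (n : ℝ) * v).eq_or_lt with hnv | hnv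
  · rw [← hnv] at hle ⊢
    rw [ENNReal.ofReal_zero, nonpos_iff_eq_zero, lintegral_eq_zero_iff hm2] at hle
    refine le_trans (le_of_eq (measure_mono_null ?_ (ae_iff.mp hle))) zero_le
    intro z hz
    have hz : 0 < ‖∑ i, ξ (z i)‖ := by simpa using hz
    simpa using hz
  · have hpos : 0 < a ^ 2 * (n * v) := by positivity
    calc (Measure.pi fun _ : Fin n => μ) {z | a * √(n * v) < ‖∑ i, ξ (z i)‖}
        ≤ (Measure.pi fun _ : Fin n => μ)
          {z | ENNReal.ofReal (a ^ 2 * (n * v)) ≤ ENNReal.ofReal (‖∑ i, ξ (z i)‖ ^ 2)} := by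
          refine measure_mono fun z hz => ENNReal.ofReal_le_ofReal ?_
          have hz : a * √(n * v) < ‖∑ i, ξ (z i)‖ := hz
          have := pow_le_pow_left₀ (by positivity) hz.le 2
          rwa [mul_pow, Real.sq_sqrt hnv.le] at this
      _ ≤ (∫⁻ z, ENNReal.ofReal (‖∑ i, ξ (z i)‖ ^ 2) ∂(Measure.pi fun _ : Fin n => μ))
          / ENNReal.ofReal (a ^ 2 * (n * v)) :=
          meas_ge_le_lintegral_div hm2.aemeasurable (by simpa using hpos) ENNReal.ofReal_ne_top
      _ ≤ ENNReal.ofReal (n * v) / ENNReal.ofReal (a ^ 2 * (n * v)) := by gcongr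
      _ = ENNReal.ofReal (1 / a ^ 2) := by
          rw [← ENNReal.ofReal_div_of_pos hpos]
          congr 1
          rw [div_mul_cancel_right₀ hnv.ne', one_div]

/-- The iteration runs with the potential `(1 + v)^k cosh ‖x‖`: the linear term of
`cosh_norm_add_le` has mean zero, and `exp y - 1 - y ≤ y²` for `y ≤ 1` turns the remainder into a
second moment. -/
theorem lintegral_cosh_norm_sum_le {ξ : Ω → K} (hξ : StronglyMeasurable ξ) {v : ℝ}
    (hL : ∀ᵐ ω ∂μ, ‖ξ ω‖ ≤ 1) (h0 : ∫ ω, ξ ω ∂μ = 0) (hv : ∫ ω, ‖ξ ω‖ ^ 2 ∂μ ≤ v) (n : ℕ) :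
    ∫⁻ z, ENNReal.ofReal (Real.cosh ‖∑ i, ξ (z i)‖) ∂(Measure.pi fun _ : Fin n => μ)
      ≤ ENNReal.ofReal (Real.exp (n * v)) := by
  have hv0 : 0 ≤ v := (integral_nonneg fun ω => by positivity).trans hv
  have hi := integrable_of_norm_le hξ hL
  have hi2 := integrable_norm_sq_of_norm_le hξ hL
  have h := lintegral_pi_sum_le (μ := μ) hξ
    (V := fun k x => ENNReal.ofReal ((1 + v) ^ k * Real.cosh ‖x‖))
    (ENNReal.continuous_ofReal.comp
      (continuous_const.mul (Real.continuous_cosh.comp continuous_norm))) (fun k x => ?_) n 0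
  · refine le_trans (by simpa using h) (ENNReal.ofReal_le_ofReal ?_)
    rw [Real.exp_nat_mul]
    refine pow_le_pow_left₀ (by linarith) ?_ n
    linarith [Real.add_one_le_exp v]
  · have hint : Integrable (fun ω => Real.cosh ‖x‖ + Real.sinh ‖x‖ / ‖x‖ * ⟪x, ξ ω⟫) μ :=
      (integrable_const _).add ((hi.const_inner x).const_mul _)
    have hint2 : Integrable (fun ω => (1 + v) ^ k * (Real.cosh ‖x‖ + Real.sinh ‖x‖ / ‖x‖ * ⟪x, ξ ω⟫
        + Real.cosh ‖x‖ * ‖ξ ω‖ ^ 2)) μ := (hint.add (hi2.const_mul _)).const_mul _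
    have hle : ∀ᵐ ω ∂μ, (1 + v) ^ k * Real.cosh ‖x + ξ ω‖ ≤ (1 + v) ^ k *
        (Real.cosh ‖x‖ + Real.sinh ‖x‖ / ‖x‖ * ⟪x, ξ ω⟫ + Real.cosh ‖x‖ * ‖ξ ω‖ ^ 2) := by
      filter_upwards [hL] with ω hω
      refine mul_le_mul_of_nonneg_left ((cosh_norm_add_le x (ξ ω)).trans ?_) (by positivity)
      have h1 := Real.abs_exp_sub_one_sub_id_le (x := ‖ξ ω‖) (by rwa [abs_norm])
      have h2 := mul_le_mul_of_nonneg_left ((le_abs_self _).trans h1) (Real.cosh_pos ‖x‖).le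
      linarith
    calc ∫⁻ ω, ENNReal.ofReal ((1 + v) ^ k * Real.cosh ‖x + ξ ω‖) ∂μ
        ≤ ∫⁻ ω, ENNReal.ofReal ((1 + v) ^ k * (Real.cosh ‖x‖ + Real.sinh ‖x‖ / ‖x‖ * ⟪x, ξ ω⟫
            + Real.cosh ‖x‖ * ‖ξ ω‖ ^ 2)) ∂μ :=
          lintegral_mono_ae (hle.mono fun ω h => ENNReal.ofReal_le_ofReal h)
      _ = ENNReal.ofReal (∫ ω, (1 + v) ^ k * (Real.cosh ‖x‖ + Real.sinh ‖x‖ / ‖x‖ * ⟪x, ξ ω⟫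
            + Real.cosh ‖x‖ * ‖ξ ω‖ ^ 2) ∂μ) := by
          refine (ofReal_integral_eq_lintegral_ofReal hint2 ?_).symm
          filter_upwards [hle] with ω h
          have := Real.cosh_pos ‖x + ξ ω‖
          exact le_trans (by positivity) h
      _ ≤ ENNReal.ofReal ((1 + v) ^ (k + 1) * Real.cosh ‖x‖) := by
          refine ENNReal.ofReal_le_ofReal ?_
          rw [integral_const_mul, integral_add hint (hi2.const_mul _),
            integral_add (integrable_const _) ((hi.const_inner x).const_mul _),
            integral_const_mul, integral_inner hi, h0, integral_const_mul]
          simp only [integral_const, probReal_univ, smul_eq_mul, one_mul, inner_zero_right,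
            mul_zero, add_zero]
          rw [pow_succ, mul_assoc]
          refine mul_le_mul_of_nonneg_left ?_ (by positivity)
          have := mul_le_mul_of_nonneg_left hv (Real.cosh_pos ‖x‖).le
          linarith

/-- Pinelis' inequality for sums of independent bounded random vectors. -/
theorem meas_norm_sum_gt_le_exp {ξ : Ω → K} (hξ : StronglyMeasurable ξ) {L v : ℝ} (hL0 : 0 ≤ L)
    (hL : ∀ᵐ ω ∂μ, ‖ξ ω‖ ≤ L) (h0 : ∫ ω, ξ ω ∂μ = 0) (hv : ∫ ω, ‖ξ ω‖ ^ 2 ∂μ ≤ v) {n : ℕ} {l : ℝ} :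
    (Measure.pi fun _ : Fin n => μ) {z | 2 * (L + √(n * v)) * l < ‖∑ i, ξ (z i)‖}
      ≤ ENNReal.ofReal (2 * Real.exp (1 - 2 * l)) := by
  have hv0 : 0 ≤ v := (integral_nonneg fun ω => by positivity).trans hv
  have hnv : 0 ≤ n * v := by positivity
  rcases (add_nonneg hL0 (Real.sqrt_nonneg (n * v))).eq_or_lt with hS | hS
  · have hL1 : L = 0 := by linarith [Real.sqrt_nonneg (n * v)]
    have hz : ∀ᵐ ω ∂μ, ‖ξ ω‖ ≤ 0 := by rwa [hL1] at hL
    have hae : ∀ᵐ z ∂(Measure.pi fun _ : Fin n => μ), ∀ i, ‖ξ (z i)‖ ≤ 0 :=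
      ae_all_iff.mpr fun i => (Measure.quasiMeasurePreserving_eval (fun _ : Fin n => μ) i).ae hz
    refine le_trans (le_of_eq (measure_mono_null ?_ (ae_iff.mp hae))) zero_le
    intro z hz' hz
    have hz' : 2 * (L + √(n * v)) * l < ‖∑ i, ξ (z i)‖ := hz'
    rw [← hS, Finset.sum_eq_zero fun i _ => norm_le_zero_iff.mp (hz i)] at hz'
    simp at hz'
  -- After division by `S` the vectors have norm at most `1` and total variance at most `1`, so the
  -- mean of `cosh` is at most `e`. Markov's inequality with `cosh u ≥ exp u / 2` at `u = 2 l` gives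
  -- the tail.
  · set S := L + √(n * v) with hSdef
    have hSi : 0 ≤ S⁻¹ := (inv_pos.mpr hS).le
    have h1 := lintegral_cosh_norm_sum_le (μ := μ) (ξ := fun ω => S⁻¹ • ξ ω) (v := S⁻¹ ^ 2 * v)
      (hξ.const_smul _) (by
        filter_upwards [hL] with ω h
        rw [norm_smul, Real.norm_of_nonneg hSi, inv_mul_le_one₀ hS]
        linarith [Real.sqrt_nonneg (n * v)])
      (by rw [integral_smul, h0, smul_zero])
      (by
        simp only [norm_smul, mul_pow, integral_const_mul, Real.norm_of_nonneg hSi]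
        exact mul_le_mul_of_nonneg_left hv (by positivity)) n
    have h2 : n * (S⁻¹ ^ 2 * v) ≤ 1 := by
      have : n * v ≤ S ^ 2 := by
        rw [← Real.sq_sqrt hnv]
        exact pow_le_pow_left₀ (Real.sqrt_nonneg _) (by linarith) 2
      rw [inv_pow, mul_left_comm, inv_mul_le_one₀ (by positivity)]
      exact this
    have hm : StronglyMeasurable fun z : Fin n → Ω => ∑ i, S⁻¹ • ξ (z i) :=
      Finset.stronglyMeasurable_fun_sum _ fun i _ =>
        (hξ.comp_measurable (measurable_pi_apply i)).const_smul _
    have hm2 : Measurable fun z : Fin n → Ω =>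
        ENNReal.ofReal (Real.cosh ‖∑ i, S⁻¹ • ξ (z i)‖) :=
      (Real.continuous_cosh.comp_stronglyMeasurable hm.norm).measurable.ennreal_ofReal
    have hpos : 0 < Real.exp (2 * l) / 2 := by positivity
    calc (Measure.pi fun _ : Fin n => μ) {z | 2 * S * l < ‖∑ i, ξ (z i)‖}
        ≤ (Measure.pi fun _ : Fin n => μ) {z | ENNReal.ofReal (Real.exp (2 * l) / 2)
          ≤ ENNReal.ofReal (Real.cosh ‖∑ i, S⁻¹ • ξ (z i)‖)} := by
          refine measure_mono fun z hz => ENNReal.ofReal_le_ofReal ?_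
          have hz : 2 * S * l < ‖∑ i, ξ (z i)‖ := hz
          have h3 : 2 * l ≤ ‖∑ i, S⁻¹ • ξ (z i)‖ := by
            rw [← Finset.smul_sum, norm_smul, Real.norm_of_nonneg hSi, le_inv_mul_iff₀ hS]
            linarith
          rw [Real.cosh_eq]
          have := Real.exp_le_exp.mpr h3
          have := Real.exp_pos (-‖∑ i, S⁻¹ • ξ (z i)‖)
          linarith
      _ ≤ (∫⁻ z, ENNReal.ofReal (Real.cosh ‖∑ i, S⁻¹ • ξ (z i)‖) ∂(Measure.pi fun _ : Fin n => μ))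
          / ENNReal.ofReal (Real.exp (2 * l) / 2) :=
          meas_ge_le_lintegral_div hm2.aemeasurable (by simpa using hpos) ENNReal.ofReal_ne_top
      _ ≤ ENNReal.ofReal (Real.exp 1) / ENNReal.ofReal (Real.exp (2 * l) / 2) := by
          gcongr
          exact h1.trans (ENNReal.ofReal_le_ofReal (Real.exp_le_exp.mpr h2))
      _ = ENNReal.ofReal (2 * Real.exp (1 - 2 * l)) := by
          rw [← ENNReal.ofReal_div_of_pos hpos, Real.exp_sub]
          congr 1
          field_simp

/-- With `y = log (1/δ) ∈ [0, 1]` the claim is `9/20 exp y ≤ (log 2 + y)²`, where `9/20 = 1/4 +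
1/5`. The constant `√5` matters: with `2` in both places the coefficient would be `1/2`, which
exceeds `(log 2)² ≈ 0.48` as `y` tends to `0`. -/
theorem chebyshev_le_of_log {δ : ℝ} (hδ : δ ∈ Set.Ioo (0 : ℝ) 1)
    (hl : Real.log (2 / δ) ≤ 1 + Real.log 2) :
    1 / (2 * Real.log (2 / δ)) ^ 2 + 1 / (√5 * Real.log (2 / δ)) ^ 2 ≤ δ := by
  have h2 := Real.log_two_gt_d9
  have hδ0 := hδ.1
  set y := Real.log δ⁻¹ with hy
  have hl2 : Real.log (2 / δ) = Real.log 2 + y := by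
    rw [div_eq_mul_inv, Real.log_mul two_ne_zero (inv_ne_zero hδ0.ne')]
  have hy0 : 0 ≤ y := Real.log_nonneg ((one_le_inv₀ hδ0).mpr hδ.2.le)
  have hy1 : y ≤ 1 := by linarith
  have hδy : δ⁻¹ = Real.exp y := (Real.exp_log (inv_pos.mpr hδ0)).symm
  have hexp : Real.exp y ≤ 1 + y + y ^ 2 := by
    have := Real.abs_exp_sub_one_sub_id_le (x := y) (by rwa [abs_of_nonneg hy0])
    linarith [(le_abs_self _).trans this]
  rw [hl2]
  have hpos : 0 < (Real.log 2 + y) ^ 2 := by positivity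
  rw [mul_pow, mul_pow, Real.sq_sqrt (by norm_num)]
  have h3 : 1 / (2 ^ 2 * (Real.log 2 + y) ^ 2) + 1 / (5 * (Real.log 2 + y) ^ 2)
      = (9 / 20) / (Real.log 2 + y) ^ 2 := by
    field_simp
    norm_num
  rw [h3, div_le_iff₀ hpos]
  have h4 : 9 / 20 * δ⁻¹ ≤ (Real.log 2 + y) ^ 2 := by
    rw [hδy]
    nlinarith
  calc (9 / 20 : ℝ) = δ * (9 / 20 * δ⁻¹) := by field_simp
    _ ≤ δ * (Real.log 2 + y) ^ 2 := mul_le_mul_of_nonneg_left h4 hδ0.le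

/-- For `l = log (2/δ) ≥ 1 + log 2` the exponent `1 - 2 l` is at most `-log 2 - l`, so each
exponential is at most `δ / 4`. -/
theorem exp_le_of_log {δ : ℝ} (hδ : δ ∈ Set.Ioo (0 : ℝ) 1)
    (hl : 1 + Real.log 2 ≤ Real.log (2 / δ)) :
    2 * Real.exp (1 - 2 * Real.log (2 / δ)) + 2 * Real.exp (1 - 2 * Real.log (2 / δ)) ≤ δ := by
  have hδ0 := hδ.1
  have h1 : Real.exp (1 - 2 * Real.log (2 / δ)) ≤ Real.exp (-Real.log 2 - Real.log (2 / δ)) :=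
    Real.exp_le_exp.mpr (by linarith)
  have h2 : Real.exp (-Real.log 2 - Real.log (2 / δ)) = δ / 4 := by
    rw [Real.exp_sub, Real.exp_neg, Real.exp_log two_pos, Real.exp_log (by positivity)]
    field_simp
    norm_num
  linarith

/-- Simultaneous concentration of two sums of independent random vectors: by Chebyshev's inequality
when `δ` is not small, otherwise by Pinelis' inequality. -/
theorem meas_norm_sum_gt_union_le {K' : Type*} [NormedAddCommGroup K'] [InnerProductSpace ℝ K']
    [CompleteSpace K'] {ξ : Ω → K} {ξ' : Ω → K'} (hξ : StronglyMeasurable ξ)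
    (hξ' : StronglyMeasurable ξ') {L v L' v' : ℝ} (hL0 : 0 ≤ L) (hL0' : 0 ≤ L')
    (hL : ∀ᵐ ω ∂μ, ‖ξ ω‖ ≤ L) (h0 : ∫ ω, ξ ω ∂μ = 0) (hv : ∫ ω, ‖ξ ω‖ ^ 2 ∂μ ≤ v)
    (hL' : ∀ᵐ ω ∂μ, ‖ξ' ω‖ ≤ L') (h0' : ∫ ω, ξ' ω ∂μ = 0) (hv' : ∫ ω, ‖ξ' ω‖ ^ 2 ∂μ ≤ v')
    {n : ℕ} {δ : ℝ} (hδ : δ ∈ Set.Ioo (0 : ℝ) 1) :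
    (Measure.pi fun _ : Fin n => μ)
      ({z | 2 * (L + √(n * v)) * Real.log (2 / δ) < ‖∑ i, ξ (z i)‖} ∪
        {z | √5 * (L' + √(n * v')) * Real.log (2 / δ) < ‖∑ i, ξ' (z i)‖}) ≤ ENNReal.ofReal δ := by
  have hδ0 := hδ.1
  have hl : 0 < Real.log (2 / δ) := by
    refine Real.log_pos ?_
    rw [lt_div_iff₀ hδ0]
    linarith [hδ.2]
  have h5 : 2 ≤ √5 := Real.le_sqrt_of_sq_le (by norm_num)
  refine (measure_union_le _ _).trans ?_
  -- The two regimes meet at `δ = 1/e`.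
  rcases le_total (Real.log (2 / δ)) (1 + Real.log 2) with h | h
  · refine le_trans (add_le_add
      ((measure_mono ?_).trans (meas_norm_sum_gt_le_chebyshev hξ hL h0 hv n
        (a := 2 * Real.log (2 / δ)) (by positivity)))
      ((measure_mono ?_).trans (meas_norm_sum_gt_le_chebyshev hξ' hL' h0' hv' n
        (a := √5 * Real.log (2 / δ)) (by positivity)))) ?_
    · intro z hz
      have hz : 2 * (L + √(n * v)) * Real.log (2 / δ) < ‖∑ i, ξ (z i)‖ := hz
      show 2 * Real.log (2 / δ) * √(n * v) < ‖∑ i, ξ (z i)‖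
      nlinarith [mul_nonneg hL0 hl.le]
    · intro z hz
      have hz : √5 * (L' + √(n * v')) * Real.log (2 / δ) < ‖∑ i, ξ' (z i)‖ := hz
      show √5 * Real.log (2 / δ) * √(n * v') < ‖∑ i, ξ' (z i)‖
      nlinarith [mul_nonneg (mul_nonneg hL0' hl.le) (Real.sqrt_nonneg 5)]
    · rw [← ENNReal.ofReal_add (by positivity) (by positivity)]
      exact ENNReal.ofReal_le_ofReal (chebyshev_le_of_log hδ h)
  · refine le_trans (add_le_add (meas_norm_sum_gt_le_exp hξ hL0 hL h0 hv)
      ((measure_mono ?_).trans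
        (meas_norm_sum_gt_le_exp (l := Real.log (2 / δ)) hξ' hL0' hL' h0' hv'))) ?_
    · intro z hz
      have hz : √5 * (L' + √(n * v')) * Real.log (2 / δ) < ‖∑ i, ξ' (z i)‖ := hz
      refine lt_of_le_of_lt ?_ hz
      have := Real.sqrt_nonneg (n * v')
      gcongr
    · rw [← ENNReal.ofReal_add (by positivity) (by positivity)]
      exact ENNReal.ofReal_le_ofReal (exp_le_of_log hδ h)

end Concentration

/-! ### Hilbert tensor products presented by bilinear maps. -/

section Tensor

variable {H F K : Type*} [NormedAddCommGroup H] [InnerProductSpace ℝ H]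
  [NormedAddCommGroup F] [InnerProductSpace ℝ F] [NormedAddCommGroup K] [InnerProductSpace ℝ K]
  {ι : Type*}

/-- A bilinear map that identifies its values with elementary tensors. -/
def IsTensor (A : H →L[ℝ] F →L[ℝ] K) : Prop :=
  ∀ h h' y y', ⟪A h y, A h' y'⟫ = ⟪h, h'⟫ * ⟪y, y'⟫

theorem IsTensor.norm_apply {A : H →L[ℝ] F →L[ℝ] K} (hA : IsTensor A) (h : H) (y : F) :
    ‖A h y‖ = ‖h‖ * ‖y‖ := by
  have h1 : ‖A h y‖ ^ 2 = (‖h‖ * ‖y‖) ^ 2 := by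
    rw [← real_inner_self_eq_norm_sq, hA, real_inner_self_eq_norm_sq, real_inner_self_eq_norm_sq,
      mul_pow]
  exact (pow_left_inj₀ (norm_nonneg _) (by positivity) two_ne_zero).mp h1

/-- The vectors `A (u j) (w j)` are mutually orthogonal with norms `‖w j‖`. Taking `w j = S (u j)`
for an operator `S`, norms in `K` become Hilbert–Schmidt norms. -/
theorem IsTensor.hasSum_norm_sq {A : H →L[ℝ] F →L[ℝ] K} (hA : IsTensor A)
    (u : HilbertBasis ι ℝ H) {w : ι → F} {k : K} (hk : HasSum (fun j => A (u j) (w j)) k) :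
    HasSum (fun j => ‖w j‖ ^ 2) (‖k‖ ^ 2) := by
  classical
  have h1 : ∀ j, ⟪k, A (u j) (w j)⟫ = ‖w j‖ ^ 2 := fun j => by
    have h2 : HasSum (fun i => ⟪A (u j) (w j), A (u i) (w i)⟫) ⟪A (u j) (w j), k⟫ :=
      (innerSL ℝ (A (u j) (w j))).hasSum hk
    rw [real_inner_comm]
    refine h2.unique ?_
    convert! hasSum_ite_eq j (‖w j‖ ^ 2) using 2 with i
    rw [hA, inner_basis_ite]
    by_cases h : i = j
    · simp [h]
    · rw [if_neg (Ne.symm h), if_neg h, zero_mul]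
  have h3 := (innerSL ℝ k).hasSum hk
  simpa only [innerSL_apply_apply, h1, real_inner_self_eq_norm_sq] using h3

theorem IsTensor.summable [CompleteSpace K] {A : H →L[ℝ] F →L[ℝ] K} (hA : IsTensor A)
    (u : HilbertBasis ι ℝ H) {w : ι → F} (hw : Summable fun j => ‖w j‖ ^ 2) :
    Summable fun j => A (u j) (w j) := by
  have hV : OrthogonalFamily ℝ (fun _ : ι => F) fun j =>
      ({ toLinearMap := (A (u j)).toLinearMap
         norm_map' := fun y => by
          simp [hA.norm_apply, u.orthonormal.1] } : F →ₗᵢ[ℝ] K) := by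
    intro i j hij y y'
    exact (hA _ _ _ _).trans (by rw [u.orthonormal.2 hij, zero_mul])
  exact (hV.summable_iff_norm_sq_summable w).mpr hw

/-- A finite sum of elementary tensors corresponds to the finite rank operator `v ↦ ∑ i, ⟪h i, v⟫ y
i`. -/
theorem hasSum_apply_basis (A : H →L[ℝ] F →L[ℝ] K) (u : HilbertBasis ι ℝ H) {n : ℕ}
    (h : Fin n → H) (y : Fin n → F) :
    HasSum (fun j => A (u j) (∑ i, ⟪h i, u j⟫ • y i)) (∑ i, A (h i) (y i)) := by
  simp only [map_sum]
  refine hasSum_sum fun i _ => ?_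
  have h1 := (A.flip (y i)).hasSum (hasSum_inner_smul u (h i))
  convert! h1 using 2 with j
  rw [ContinuousLinearMap.flip_apply, map_smul, map_smul, smul_apply, real_inner_comm]

variable (H F) in
/-- The tensor product in the space of `F`-valued square summable families. -/
theorem exists_isTensor_lp [CompleteSpace H] :
    ∃ A : H →L[ℝ] F →L[ℝ] lp (fun _ : basisIndex H => F) 2, IsTensor A := by
  have hmem : ∀ (h : H) (y : F), Memℓp (fun i : basisIndex H => ⟪onb H i, h⟫ • y) 2 := fun h y => by
    refine memℓp_gen ?_
    refine (summable_congr fun i => ?_).mpr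
      ((hasSum_inner_sq (onb H) h).summable.mul_right (‖y‖ ^ 2))
    rw [norm_smul, Real.norm_eq_abs, ENNReal.toReal_ofNat, Real.rpow_ofNat, mul_pow, sq_abs]
  let A₀ : H →ₗ[ℝ] F →ₗ[ℝ] lp (fun _ : basisIndex H => F) 2 :=
    LinearMap.mk₂ ℝ (fun h y => ⟨_, hmem h y⟩)
      (fun h h' y => Subtype.ext <| funext fun i => by
        show ⟪onb H i, h + h'⟫ • y = ⟪onb H i, h⟫ • y + ⟪onb H i, h'⟫ • y
        rw [inner_add_right, add_smul])
      (fun c h y => Subtype.ext <| funext fun i => by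
        show ⟪onb H i, c • h⟫ • y = c • ⟪onb H i, h⟫ • y
        rw [real_inner_smul_right, mul_smul])
      (fun h y y' => Subtype.ext <| funext fun i => by
        show ⟪onb H i, h⟫ • (y + y') = ⟪onb H i, h⟫ • y + ⟪onb H i, h⟫ • y'
        rw [smul_add])
      (fun c h y => Subtype.ext <| funext fun i => by
        show ⟪onb H i, h⟫ • c • y = c • ⟪onb H i, h⟫ • y
        rw [smul_comm])
  have hA₀ : ∀ h h' y y', ⟪A₀ h y, A₀ h' y'⟫ = ⟪h, h'⟫ * ⟪y, y'⟫ := fun h h' y y' => by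
    refine (lp.hasSum_inner _ _).unique ?_
    convert! ((onb H).hasSum_inner_mul_inner h h').mul_right ⟪y, y'⟫ using 2 with i
    show ⟪⟪onb H i, h⟫ • y, ⟪onb H i, h'⟫ • y'⟫ = _
    rw [real_inner_smul_left, real_inner_smul_right, real_inner_comm h, mul_assoc]
  refine ⟨A₀.mkContinuous₂ 1 fun h y => ?_, hA₀⟩
  refine abs_le_of_sq_le_sq' (le_of_eq ?_) (by positivity) |>.2
  rw [← real_inner_self_eq_norm_sq, hA₀, real_inner_self_eq_norm_sq, real_inner_self_eq_norm_sq]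
  ring

end Tensor

/-! ### The scalar kernel space, and `G` as its tensor product with `Y`. -/

section KernelTensor

variable {X Y H G : Type*} [NormedAddCommGroup Y] [InnerProductSpace ℝ Y] [CompleteSpace Y]
  [NormedAddCommGroup H] [InnerProductSpace ℝ H] [CompleteSpace H] [RKHS ℝ H X ℝ]
  [NormedAddCommGroup G] [InnerProductSpace ℝ G] [CompleteSpace G] [RKHS ℝ G X Y]

theorem inner_feature (h : H) (x : X) : ⟪h, feature H x⟫ = h x := by
  rw [feature, RKHS.inner_kerFun]; simp

theorem inner_feature_feature (x t : X) :
    ⟪feature H x, feature H t⟫ = scalarKernel H x t := by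
  rw [scalarKernel, ← RKHS.kerFun_apply, ← inner_feature, real_inner_comm]
  rfl

theorem norm_feature_le {κ : ℝ} (hκ : 0 ≤ κ) (hk : ∀ x, scalarKernel H x x ≤ κ ^ 2) (x : X) :
    ‖feature H x‖ ≤ κ := by
  refine abs_le_of_sq_le_sq' ?_ hκ |>.2
  rw [← real_inner_self_eq_norm_sq, inner_feature_feature]
  exact hk x

variable (H) in
theorem denseRange_linearCombination_feature :
    DenseRange (Finsupp.linearCombination ℝ (feature H : X → H)) := by
  have h := RKHS.kerFun_dense (𝕜 := ℝ) (X := X) (V := ℝ) H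
  have hle : Submodule.span ℝ {RKHS.kerFun H x v | (x : X) (v : ℝ)}
      ≤ LinearMap.range (Finsupp.linearCombination ℝ (feature H : X → H)) := by
    rw [Submodule.span_le]
    rintro _ ⟨x, v, rfl⟩
    refine ⟨Finsupp.single x v, ?_⟩
    rw [Finsupp.linearCombination_single, feature, ← map_smul, smul_eq_mul, mul_one]
  intro v
  have hv : v ∈ (Submodule.span ℝ {RKHS.kerFun H x v | (x : X) (v : ℝ)}).topologicalClosure := by
    rw [h]; trivial
  exact closure_mono (fun w hw => hle hw) hv

/-- A strongly measurable map has separable range, and the features span a dense subspace. -/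
theorem separableSpace_of_stronglyMeasurable_feature [MeasurableSpace X]
    (hmeas : StronglyMeasurable (feature H : X → H)) : TopologicalSpace.SeparableSpace H := by
  have h1 := hmeas.isSeparable_range.span (R := ℝ)
  have h2 : closure (Submodule.span ℝ (Set.range (feature H : X → H)) : Set H) = Set.univ := by
    rw [← Finsupp.range_linearCombination]
    exact (denseRange_linearCombination_feature H).closure_eq
  have h3 := h1.closure
  rw [h2] at h3
  exact TopologicalSpace.isSeparable_univ_iff.mp h3

/-- The vector-valued reproducing kernel Hilbert space with kernel `k Id` as a tensor product. -/
theorem exists_isTensor_rkhs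
    (hG : ∀ (x t : X) (y : Y), RKHS.kernel G x t y = scalarKernel H x t • y) :
    ∃ A : H →L[ℝ] Y →L[ℝ] G, IsTensor A ∧ (∀ x y, A (feature H x) y = RKHS.kerFun G x y) ∧
      ∀ h y x, (A h y) x = h x • y := by
  let e := Finsupp.linearCombination ℝ (feature H : X → H)
  let f := Finsupp.linearCombination ℝ (RKHS.kerFun G : X → Y →L[ℝ] G)
  have hinner : ∀ c c' y y', ⟪f c y, f c' y'⟫ = ⟪e c, e c'⟫ * ⟪y, y'⟫ := by
    intro c c' y y'
    induction c using Finsupp.induction_linear with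
    | zero => simp
    | add c₁ c₂ h₁ h₂ =>
      rw [map_add, map_add, add_apply, inner_add_left, inner_add_left, h₁, h₂, add_mul]
    | single x a =>
      induction c' using Finsupp.induction_linear with
      | zero => simp
      | add c₁ c₂ h₁ h₂ =>
        rw [map_add, map_add, add_apply, inner_add_right, inner_add_right, h₁, h₂, add_mul]
      | single t b =>
        simp only [e, f, Finsupp.linearCombination_single, smul_apply, real_inner_smul_left,
          real_inner_smul_right]
        rw [← RKHS.kernel_inner, hG, real_inner_smul_left, real_inner_comm (feature H t),
          inner_feature_feature]
        ring
  have hdense : DenseRange e := denseRange_linearCombination_feature H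
  -- By the Gram identity `hinner`, `f` factors through `e` without increasing norms, so it extends
  -- from the dense span of the features to all of `H`.
  have hnorm : ∀ c, ‖f c‖ ≤ 1 * ‖e c‖ := fun c => by
    rw [one_mul]
    refine ContinuousLinearMap.opNorm_le_bound _ (norm_nonneg _) fun y => ?_
    refine abs_le_of_sq_le_sq' (le_of_eq ?_) (by positivity) |>.2
    rw [← real_inner_self_eq_norm_sq, hinner, real_inner_self_eq_norm_sq,
      real_inner_self_eq_norm_sq, mul_pow]
  let A := f.extendOfNorm e
  have hAe : ∀ c, A (e c) = f c := fun c => LinearMap.extendOfNorm_eq hdense ⟨1, hnorm⟩ c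
  have hA : IsTensor A := by
    intro h h' y y'
    refine hdense.induction_on₂ (p := fun h h' => ⟪A h y, A h' y'⟫ = ⟪h, h'⟫ * ⟪y, y'⟫) ?_ ?_ h h'
    · exact isClosed_eq (by fun_prop) (by fun_prop)
    · intro c c'
      rw [hAe, hAe, hinner]
  have hAf : ∀ x y, A (feature H x) y = RKHS.kerFun G x y := fun x y => by
    have := hAe (Finsupp.single x 1)
    simp only [e, f, Finsupp.linearCombination_single, one_smul] at this
    rw [this]
  refine ⟨A, hA, hAf, fun h y x => ext_inner_right ℝ fun y' => ?_⟩
  rw [← RKHS.inner_kerFun, ← hAf, hA, inner_feature, real_inner_smul_left]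

end KernelTensor

/-! ### The estimator as a Hilbert–Schmidt operator. -/

section Estimator

variable {X Y H G : Type*} [NormedAddCommGroup Y] [InnerProductSpace ℝ Y] [CompleteSpace Y]
  [NormedAddCommGroup H] [InnerProductSpace ℝ H] [CompleteSpace H] [RKHS ℝ H X ℝ]
  [NormedAddCommGroup G] [InnerProductSpace ℝ G] [CompleteSpace G] [RKHS ℝ G X Y] {n : ℕ}

variable (H) in
/-- The weighted empirical covariance operator. -/
noncomputable def empCov (β : X → ℝ) (z : Fin n → X × Y) : H →L[ℝ] H :=
  (n : ℝ)⁻¹ • ∑ i, β (z i).1 • InnerProductSpace.rankOne ℝ (feature H (z i).1) (feature H (z i).1)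

variable (H) in
/-- The weighted empirical cross covariance operator. -/
noncomputable def empCross (β : X → ℝ) (z : Fin n → X × Y) : H →L[ℝ] Y :=
  (n : ℝ)⁻¹ • ∑ i, β (z i).1 • InnerProductSpace.rankOne ℝ (z i).2 (feature H (z i).1)

omit [NormedAddCommGroup Y] [InnerProductSpace ℝ Y] [CompleteSpace Y] in
theorem empCov_apply (β : X → ℝ) (z : Fin n → X × Y) (h : H) : empCov H β z h
    = (n : ℝ)⁻¹ • ∑ i, (β (z i).1 * ⟪feature H (z i).1, h⟫) • feature H (z i).1 := by
  simp [empCov, sum_apply, mul_smul]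

omit [CompleteSpace Y] in
theorem empCross_apply (β : X → ℝ) (z : Fin n → X × Y) (h : H) : empCross H β z h
    = (n : ℝ)⁻¹ • ∑ i, (β (z i).1 * ⟪feature H (z i).1, h⟫) • (z i).2 := by
  simp [empCross, sum_apply, mul_smul]

omit [NormedAddCommGroup Y] [InnerProductSpace ℝ Y] [CompleteSpace Y] in
theorem inner_empCov (β : X → ℝ) (z : Fin n → X × Y) (h h' : H) : ⟪empCov H β z h, h'⟫
    = (n : ℝ)⁻¹ * ∑ i, β (z i).1 * (⟪feature H (z i).1, h⟫ * ⟪feature H (z i).1, h'⟫) := by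
  rw [empCov_apply, real_inner_smul_left, sum_inner]
  simp only [real_inner_smul_left, mul_assoc]

omit [NormedAddCommGroup Y] [InnerProductSpace ℝ Y] [CompleteSpace Y] in
theorem empCov_isSymmetric (β : X → ℝ) (z : Fin n → X × Y) :
    (empCov H β z : H →ₗ[ℝ] H).IsSymmetric := by
  intro h h'
  show ⟪empCov H β z h, h'⟫ = ⟪h, empCov H β z h'⟫
  rw [inner_empCov, real_inner_comm, inner_empCov]
  simp only [mul_comm ⟪_, h⟫]

omit [CompleteSpace H] in
theorem isCompactOperator_rankOne (x y : H) :
    IsCompactOperator (InnerProductSpace.rankOne ℝ x y : H →L[ℝ] H) := by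
  rw [InnerProductSpace.rankOne_def']
  exact (isCompactOperator_of_locallyCompactSpace_rng
    (ContinuousLinearMap.toSpanSingleton ℝ x)).comp_clm (innerSL ℝ y)

omit [NormedAddCommGroup Y] [InnerProductSpace ℝ Y] [CompleteSpace Y] in
theorem empCov_isCompactOperator (β : X → ℝ) (z : Fin n → X × Y) :
    IsCompactOperator (empCov H β z) := by
  have : empCov H β z ∈ compactOperator (RingHom.id ℝ) H H :=
    Submodule.smul_mem _ _ (Submodule.sum_mem _ fun i _ => Submodule.smul_mem _ _
      (isCompactOperator_rankOne _ _))
  exact this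

omit [NormedAddCommGroup Y] [InnerProductSpace ℝ Y] [CompleteSpace Y] in
theorem empCov_eigenvalue_nonneg {β : X → ℝ} (hβ : ∀ x, 0 ≤ β x) (z : Fin n → X × Y) {v : H}
    (hv : ‖v‖ = 1) {a : ℝ} (h : empCov H β z v = a • v) :
    a = (n : ℝ)⁻¹ * ∑ i, β (z i).1 * ⟪feature H (z i).1, v⟫ ^ 2 ∧ 0 ≤ a := by
  have h1 := inner_empCov β z v v
  rw [h, real_inner_smul_left, real_inner_self_eq_norm_sq, hv, one_pow, mul_one] at h1
  simp only [← sq] at h1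
  refine ⟨h1, ?_⟩
  rw [h1]
  exact mul_nonneg (by positivity)
    (Finset.sum_nonneg fun i _ => mul_nonneg (hβ _) (sq_nonneg _))

omit [CompleteSpace Y] in
-- The quadratic form of `empCov` at `v` is a sum of nonnegative terms, so each weighted coefficient
-- of `v` vanishes. Consequently the value of the filter at `0`, on which nothing is assumed, never
-- enters the estimator.
theorem empCross_eq_zero_of_eigenvalue_zero {β : X → ℝ} (hβ : ∀ x, 0 ≤ β x) (hn : 0 < n)
    (z : Fin n → X × Y) {v : H} (h : empCov H β z v = 0) : empCross H β z v = 0 := by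
  have h1 := inner_empCov β z v v
  rw [h, inner_zero_left] at h1
  have hn' : (n : ℝ)⁻¹ ≠ 0 := by positivity
  have h2 := (mul_eq_zero.mp h1.symm).resolve_left hn'
  rw [Finset.sum_eq_zero_iff_of_nonneg fun i _ => mul_nonneg (hβ _) (mul_self_nonneg _)] at h2
  rw [empCross_apply, Finset.sum_eq_zero fun i hi => ?_, smul_zero]
  rcases mul_eq_zero.mp (h2 i hi) with h3 | h3
  · rw [h3, zero_mul, zero_smul]
  · rw [mul_self_eq_zero.mp h3, mul_zero, zero_smul]

/-- Under the tensor identification `S* 𝓑 S` acts as `empCov ⊗ Id` and `S* 𝓑 y` is the tensor of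
`empCross`, so the functional calculus acts on the first factor. The function `gt` is the filter
with its value at `0` free, so that a bound `Γ` can be had on the whole spectrum. -/
theorem estimator_eq (β : X → ℝ) (hβ : ∀ x, 0 ≤ β x) (hn : 0 < n) (z : Fin n → X × Y)
    (gl gt : ℝ → ℝ) {Γ : ℝ} (hgt : ∀ t, t ≠ 0 → gt t = gl t)
    {A : H →L[ℝ] Y →L[ℝ] G} (hA : IsTensor A)
    (hAf : ∀ x y, A (feature H x) y = RKHS.kerFun G x y) (hAe : ∀ h y x, (A h y) x = h x • y)
    {ι : Type*} (u : HilbertBasis ι ℝ H) {σ : ι → ℝ} (hu : ∀ j, empCov H β z (u j) = σ j • u j)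
    (hΓ : ∀ j, |gt (σ j)| ≤ Γ) :
    HasSum (fun j => A (u j) (gt (σ j) • empCross H β z (u j))) (estimator G β gl z) := by
  set T : G →L[ℝ] G := samplingAdj G (fun i => (z i).1) ∘L
    (diagOp fun i => β (z i).1) ∘L samplingOp G (fun i => (z i).1) with hT
  have hTapp : ∀ f : G, T f = (n : ℝ)⁻¹ • ∑ i, β (z i).1 • RKHS.kerFun G (z i).1 (f (z i).1) := by
    intro f
    simp [hT, samplingAdj, diagOp, samplingOp, sum_apply]
  have hTs : (T : G →ₗ[ℝ] G).IsSymmetric := by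
    intro f f'
    rw [ContinuousLinearMap.coe_coe, hTapp, hTapp, real_inner_smul_left, real_inner_smul_right,
      sum_inner, inner_sum]
    simp only [real_inner_smul_left, real_inner_smul_right, RKHS.kerFun_inner, RKHS.inner_kerFun]
  have hTA : ∀ j y, T (A (u j) y) = σ j • A (u j) y := by
    intro j y
    rw [← smul_apply, ← map_smul, ← hu, empCov_apply, hTapp, map_smul, map_sum,
      smul_apply, sum_apply]
    congr 1
    refine Finset.sum_congr rfl fun i _ => ?_
    rw [hAe, map_smul, map_smul, smul_apply, hAf, smul_smul, ← inner_feature,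
      real_inner_comm (u j)]
  have hv : HasSum (fun j => A (u j) (empCross H β z (u j)))
      (samplingAdj G (fun i => (z i).1) ((diagOp fun i => β (z i).1) fun i => (z i).2)) := by
    have h1 := (hasSum_apply_basis A u (fun i => feature H (z i).1)
      (fun i => β (z i).1 • (z i).2)).const_smul (n : ℝ)⁻¹
    convert! h1 using 2 with j
    · rw [empCross_apply, map_smul]
      simp only [smul_smul, mul_comm]
    · simp [samplingAdj, diagOp, sum_apply, hAf]
  have hw : Summable fun j => A (u j) (gt (σ j) • empCross H β z (u j)) := by
    refine hA.summable u (Summable.of_nonneg_of_le (fun j => by positivity) (fun j => ?_)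
      ((hA.hasSum_norm_sq u hv).summable.mul_left (Γ ^ 2)))
    rw [norm_smul, mul_pow, Real.norm_eq_abs]
    gcongr
    exact hΓ j
  have hgl : (fun j => gl (σ j) • A (u j) (empCross H β z (u j)))
      = fun j => A (u j) (gt (σ j) • empCross H β z (u j)) := by
    ext1 j
    rw [map_smul]
    by_cases h : σ j = 0
    · rw [empCross_eq_zero_of_eigenvalue_zero hβ hn z (by rw [hu, h, zero_smul])]
      simp
    · rw [hgt _ h]
  have hest := funcCalc_eq T hTs gl (fun j => hTA j _) hv (hgl ▸ hw.hasSum)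
  have : estimator G β gl z = funcCalc T gl (samplingAdj G (fun i => (z i).1)
      ((diagOp fun i => β (z i).1) fun i => (z i).2)) := rfl
  rw [this, hest, hgl]
  exact hw.hasSum

/-- Elements of `G` are determined by their values and evaluation is continuous, so it suffices to
sum the series at each point. -/
theorem hasSum_of_apply_eq {A : H →L[ℝ] Y →L[ℝ] G} (hA : IsTensor A)
    (hAe : ∀ h y x, (A h y) x = h x • y) {ι : Type*} (u : HilbertBasis ι ℝ H) {f : G}
    {T : H →L[ℝ] Y} {B : ℝ} (hT : HSLe T B) (hf : ∀ x, f x = T (feature H x)) :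
    HasSum (fun j => A (u j) (T (u j))) f := by
  have hs := hA.summable u ((hsLe_iff_hasSum u).mp hT).2.1
  convert! hs.hasSum
  refine RKHS.ext fun x => ?_
  rw [hf]
  have h1 : HasSum (fun j => (A (u j) (T (u j))) x) ((∑' j, A (u j) (T (u j)) : G) x) := by
    have := (RKHS.kerFun G x).adjoint.hasSum hs.hasSum
    simpa only [RKHS.adjoint_kerFun] using this
  refine HasSum.unique ?_ h1
  have h2 := T.hasSum (hasSum_inner_smul u (feature H x))
  simpa only [hAe, map_smul, inner_feature] using h2

/-- The error of the estimator in terms of Hilbert–Schmidt operators. -/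
theorem norm_sub_estimator_le (β : X → ℝ) (hβ : ∀ x, 0 ≤ β x) (hn : 0 < n) (z : Fin n → X × Y)
    (gl gt : ℝ → ℝ) {Γ : ℝ} (hgt : ∀ t, t ≠ 0 → gt t = gl t)
    {A : H →L[ℝ] Y →L[ℝ] G} (hA : IsTensor A)
    (hAf : ∀ x y, A (feature H x) y = RKHS.kerFun G x y) (hAe : ∀ h y x, (A h y) x = h x • y)
    {ι : Type*} (u : HilbertBasis ι ℝ H) {σ : ι → ℝ} (hu : ∀ j, empCov H β z (u j) = σ j • u j)
    (hΓ : ∀ j, |gt (σ j)| ≤ Γ) {f : G} {T : H →L[ℝ] Y} {B R : ℝ} (hT : HSLe T B)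
    (hf : ∀ x, f x = T (feature H x))
    (hR : HSLe (T - empCross H β z ∘L diagonal u fun j => gt (σ j)) R) :
    ‖f - estimator G β gl z‖ ≤ R := by
  have h1 := (hasSum_of_apply_eq hA hAe u hT hf).sub
    (estimator_eq β hβ hn z gl gt hgt hA hAf hAe u hu hΓ)
  simp only [← map_sub] at h1
  have h2 := hA.hasSum_norm_sq u h1
  obtain ⟨hR0, -, h3⟩ := (hsLe_iff_hasSum u).mp hR
  refine abs_le_of_sq_le_sq' ?_ hR0 |>.2
  rw [← h2.tsum_eq]
  convert! h3 using 5 with j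
  rw [sub_apply, ContinuousLinearMap.comp_apply, diagonal_apply_basis u hΓ, map_smul]

end Estimator

/-! ### The population covariance operator and the effective dimension. -/

section Population

variable {X H : Type*} [MeasurableSpace X] [NormedAddCommGroup H] [InnerProductSpace ℝ H]
  [CompleteSpace H] [RKHS ℝ H X ℝ] {q : Measure X} [IsProbabilityMeasure q] {κ : ℝ}
  (hmeas : StronglyMeasurable (feature H : X → H)) (hκ : ∀ x : X, ‖feature H x‖ ≤ κ)
include hmeas hκ

theorem integrable_rankOne_feature :
    Integrable (fun x => InnerProductSpace.rankOne ℝ (feature H x) (feature H x)) q := by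
  refine Integrable.of_bound (C := κ * κ) ?_ (ae_of_all _ fun x => ?_)
  · have hc : Continuous fun h : H => InnerProductSpace.rankOne ℝ h h :=
      (InnerProductSpace.rankOne ℝ).continuous.clm_apply continuous_id
    exact (hc.comp_stronglyMeasurable hmeas).aestronglyMeasurable
  · rw [InnerProductSpace.norm_rankOne]
    exact mul_le_mul (hκ x) (hκ x) (norm_nonneg _) ((norm_nonneg _).trans (hκ x))

theorem inner_covOp (h h' : H) :
    ⟪covOp H q h, h'⟫ = ∫ x, ⟪feature H x, h⟫ * ⟪feature H x, h'⟫ ∂q := by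
  have hi := integrable_rankOne_feature (q := q) hmeas hκ
  rw [covOp, ContinuousLinearMap.integral_apply hi, real_inner_comm,
    ← integral_inner (hi.apply_continuousLinearMap h)]
  refine integral_congr_ae (ae_of_all _ fun x => ?_)
  simp only [InnerProductSpace.rankOne_apply, real_inner_smul_right]
  rw [real_inner_comm h']

theorem covOp_isSymmetric : (covOp H q : H →ₗ[ℝ] H).IsSymmetric := by
  intro h h'
  show ⟪covOp H q h, h'⟫ = ⟪h, covOp H q h'⟫
  rw [inner_covOp hmeas hκ, real_inner_comm, inner_covOp hmeas hκ]
  simp only [mul_comm]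

/-- A Bochner integral of rank one operators stays in the closed subspace of compact operators. -/
theorem covOp_isCompactOperator : IsCompactOperator (covOp H q) := by
  have h : covOp H q ∈ (compactOperator (RingHom.id ℝ) H H : Set (H →L[ℝ] H)) :=
    (compactOperator (RingHom.id ℝ) H H).convex.integral_mem isClosed_setOfPred_isCompactOperator
      (ae_of_all _ fun x => isCompactOperator_rankOne _ _)
      (integrable_rankOne_feature (q := q) hmeas hκ)
  exact h

theorem covOp_eigenvalue_mem {v : H} (hv : ‖v‖ = 1) {a : ℝ} (h : covOp H q v = a • v) :
    a ∈ Set.Icc 0 (κ ^ 2) := by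
  have h1 := inner_covOp (q := q) hmeas hκ v v
  rw [h, real_inner_smul_left, real_inner_self_eq_norm_sq, hv, one_pow, mul_one] at h1
  refine ⟨h1 ▸ integral_nonneg fun x => mul_self_nonneg _, ?_⟩
  have h2 : ∀ x : X, ⟪feature H x, v⟫ * ⟪feature H x, v⟫ ≤ κ ^ 2 := fun x => by
    have h3 := abs_real_inner_le_norm (feature H x) v
    rw [hv, mul_one] at h3
    rw [← sq, ← sq_abs]
    exact pow_le_pow_left₀ (abs_nonneg _) (h3.trans (hκ x)) 2
  calc a = ∫ x, ⟪feature H x, v⟫ * ⟪feature H x, v⟫ ∂q := h1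
    _ ≤ ∫ _, κ ^ 2 ∂q := integral_mono_of_nonneg (ae_of_all _ fun x => mul_self_nonneg _)
        (integrable_const _) (ae_of_all _ h2)
    _ = κ ^ 2 := by simp

/-- The effective dimension as a second moment. -/
theorem effDim_eq [TopologicalSpace.SeparableSpace H] {ι : Type*} (e : HilbertBasis ι ℝ H)
    {a : ι → ℝ} (hC : ∀ i, covOp H q (e i) = a i • e i) {lam : ℝ} (hlam : 0 < lam) :
    effDim (covOp H q) lam
      = ∫ x, ‖diagonal e (fun i => (a i + lam) ^ (-(1 / 2) : ℝ)) (feature H x)‖ ^ 2 ∂q := by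
  have := countable_of_hilbertBasis (onb H)
  have ha : ∀ i, 0 ≤ a i := fun i =>
    (covOp_eigenvalue_mem (q := q) hmeas hκ (e.orthonormal.1 i) (hC i)).1
  have hpos : ∀ i, 0 < a i + lam := fun i => by linarith [ha i]
  obtain ⟨h1, h2, -, hb, -, -⟩ := shift_diagonal_mul e hC ha hlam
  have hbD : ∀ i, |(a i + lam) ^ (-(1 / 2) : ℝ)| ≤ lam ^ (-(1 / 2) : ℝ) := fun i => by
    rw [abs_of_pos (Real.rpow_pos_of_pos (hpos i) _)]
    exact Real.rpow_le_rpow_of_nonpos hlam (by linarith [ha i]) (by norm_num)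
  set P := diagonal e (fun i => (a i + lam)⁻¹)
  set D := diagonal e (fun i => (a i + lam) ^ (-(1 / 2) : ℝ)) with hD
  have hinv : Ring.inverse (covOp H q + lam • (1 : H →L[ℝ] H)) = P :=
    Ring.inverse_unit ⟨covOp H q + lam • 1, P, h1, h2⟩
  -- Both factors are diagonal in `e`, so the inverse can be distributed symmetrically as two
  -- inverse square roots. Each diagonal entry of the trace then is a second moment.
  have hCP : covOp H q * P = D ∘L (covOp H q ∘L D) := by
    refine ext_basis e fun i => ?_
    rw [ContinuousLinearMap.mul_def, ContinuousLinearMap.comp_apply,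
      ContinuousLinearMap.comp_apply, ContinuousLinearMap.comp_apply, diagonal_apply_basis e hb,
      diagonal_apply_basis e hbD, map_smul, map_smul, map_smul, hC, map_smul,
      diagonal_apply_basis e hbD, smul_comm (a i), smul_smul ((a i + lam) ^ _),
      ← Real.rpow_add (hpos i), ← Real.rpow_neg_one]
    norm_num
  have hterm : ∀ i, ⟪onb H i, (covOp H q * P) (onb H i)⟫
      = ∫ x, ⟪onb H i, D (feature H x)⟫ ^ 2 ∂q := fun i => by
    rw [hCP, ContinuousLinearMap.comp_apply, ← inner_diagonal_left e hbD, ← hD,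
      ContinuousLinearMap.comp_apply, real_inner_comm, inner_covOp hmeas hκ]
    refine integral_congr_ae (ae_of_all _ fun x => ?_)
    show ⟪feature H x, D (onb H i)⟫ * ⟪feature H x, D (onb H i)⟫ = _
    rw [← inner_diagonal_left e hbD, real_inner_comm]
    exact (sq _).symm
  have hDm : StronglyMeasurable fun x => D (feature H x) :=
    D.continuous.comp_stronglyMeasurable hmeas
  have hint : Integrable (fun x => ‖D (feature H x)‖ ^ 2) q :=
    integrable_norm_sq_of_norm_le hDm (L := ‖D‖ * κ) (ae_of_all _ fun x =>
      D.le_opNorm_of_le (hκ x))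
  -- The nonnegative terms dominate themselves: by Parseval their sum is `‖D (feature H x)‖²`, which
  -- is integrable.
  have hsum := hasSum_integral_of_dominated_convergence (μ := q)
    (F := fun i x => ⟪onb H i, D (feature H x)⟫ ^ 2) (f := fun x => ‖D (feature H x)‖ ^ 2)
    (fun i x => ⟪onb H i, D (feature H x)⟫ ^ 2)
    (fun i => by
      have hc : Continuous fun v : H => ⟪onb H i, v⟫ ^ 2 := by fun_prop
      exact (hc.comp_stronglyMeasurable hDm).aestronglyMeasurable)
    (fun i => ae_of_all _ fun x => by rw [Real.norm_of_nonneg (sq_nonneg _)])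
    (ae_of_all _ fun x => (hasSum_inner_sq (onb H) _).summable)
    (by simpa only [(hasSum_inner_sq (onb H) _).tsum_eq] using hint)
    (ae_of_all _ fun x => hasSum_inner_sq (onb H) _)
  rw [effDim, trace, hinv, ← hsum.tsum_eq]
  exact tsum_congr hterm

end Population

/-! ### Centering a bounded random vector. -/

section Centering

variable {Ω K : Type*} [MeasurableSpace Ω] {μ : Measure Ω} [IsProbabilityMeasure μ]
  [NormedAddCommGroup K] [InnerProductSpace ℝ K] [CompleteSpace K]

theorem centered_bounds {ζ : Ω → K} (hζ : StronglyMeasurable ζ) {L : ℝ}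
    (hL : ∀ᵐ ω ∂μ, ‖ζ ω‖ ≤ L) :
    (∀ᵐ ω ∂μ, ‖ζ ω - ∫ ω, ζ ω ∂μ‖ ≤ 2 * L) ∧ ∫ ω, (ζ ω - ∫ ω, ζ ω ∂μ) ∂μ = 0 ∧
      ∫ ω, ‖ζ ω - ∫ ω, ζ ω ∂μ‖ ^ 2 ∂μ ≤ ∫ ω, ‖ζ ω‖ ^ 2 ∂μ := by
  have hi := integrable_of_norm_le hζ hL
  have hi2 := integrable_norm_sq_of_norm_le hζ hL
  set m := ∫ ω, ζ ω ∂μ with hm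
  have hmL : ‖m‖ ≤ L := by simpa using norm_integral_le_of_norm_le_const hL
  refine ⟨?_, ?_, ?_⟩
  · filter_upwards [hL] with ω h
    linarith [norm_sub_le (ζ ω) m]
  · rw [integral_sub hi (integrable_const _)]
    simp [hm]
  · have e1 : ∀ ω, ‖ζ ω - m‖ ^ 2 = ‖ζ ω‖ ^ 2 + (-2) * ⟪m, ζ ω⟫ + ‖m‖ ^ 2 := fun ω => by
      rw [norm_sub_sq_real, real_inner_comm]; ring
    simp only [e1]
    have hint : Integrable (fun ω => ‖ζ ω‖ ^ 2 + (-2) * ⟪m, ζ ω⟫) μ :=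
      hi2.add ((hi.const_inner m).const_mul _)
    rw [integral_add hint (integrable_const _),
      integral_add hi2 ((hi.const_inner m).const_mul _), integral_const_mul,
      integral_inner hi, ← hm,
      real_inner_self_eq_norm_sq]
    simp
    nlinarith [sq_nonneg ‖m‖]

end Centering

/-! ### Scalar inequalities for index functions and filters. -/

section Scalar

theorem IsIndexFunction.nonneg {φ : ℝ → ℝ} (hφ : IsIndexFunction φ) {t : ℝ} (ht : 0 ≤ t) :
    0 ≤ φ t := by
  rw [← hφ.map_zero]
  exact hφ.strictMonoOn.monotoneOn (Set.mem_Ici.mpr le_rfl) ht ht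

theorem IsIndexFunction.mono {φ : ℝ → ℝ} (hφ : IsIndexFunction φ) {t t' : ℝ} (ht : 0 ≤ t)
    (h : t ≤ t') : φ t ≤ φ t' :=
  hφ.strictMonoOn.monotoneOn ht (ht.trans h) h

theorem IsIndexFunction.pos {φ : ℝ → ℝ} (hφ : IsIndexFunction φ) {t : ℝ} (ht : 0 < t) :
    0 < φ t := by
  rw [← hφ.map_zero]
  exact hφ.strictMonoOn (Set.mem_Ici.mpr le_rfl) ht.le ht

/-- Below `lam` monotonicity of `φ` suffices, with constant `1`; above `lam` the covering inequality
between `lam` and `a` gives `1 / c`. -/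
theorem Covers.mul_rpow_neg_le {s ν : ℝ} {φ : ℝ → ℝ} {c : ℝ} (hc : Covers s ν φ c)
    (hφ : IsIndexFunction φ) (hν : 0 ≤ ν) {lam a : ℝ} (hlam : lam ∈ Set.Ioc 0 s)
    (ha : a ∈ Set.Icc 0 s) :
    |φ a| * (a + lam) ^ (-ν) ≤ (max 1 (1 / c) * φ lam) * lam ^ (-ν) := by
  have hl := hlam.1
  have ha0 := ha.1
  have hφl := hφ.pos hl
  have hapos : 0 < a + lam := by linarith
  rw [abs_of_nonneg (hφ.nonneg ha.1)]
  rcases le_total a lam with h | h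
  · have h1 : φ a ≤ max 1 (1 / c) * φ lam :=
      (hφ.mono ha.1 h).trans (le_mul_of_one_le_left hφl.le (le_max_left _ _))
    have h2 : (a + lam) ^ (-ν) ≤ lam ^ (-ν) :=
      Real.rpow_le_rpow_of_nonpos hl (by linarith) (by linarith)
    exact mul_le_mul h1 h2 (by positivity) (by positivity)
  · have hapos' : 0 < a := hl.trans_le h
    have hφa := hφ.pos hapos'
    have h1 := hc.2 lam hlam a ⟨h, ha.2⟩
    have hc0 := hc.1
    have h2 : (a + lam) ^ (-ν) ≤ a ^ (-ν) :=
      Real.rpow_le_rpow_of_nonpos hapos' (by linarith) (by linarith)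
    have haν : 0 < a ^ ν := Real.rpow_pos_of_pos hapos' ν
    have hlν : 0 < lam ^ ν := Real.rpow_pos_of_pos hl ν
    calc φ a * (a + lam) ^ (-ν) ≤ φ a * a ^ (-ν) := mul_le_mul_of_nonneg_left h2 hφa.le
      _ ≤ 1 / c * φ lam * lam ^ (-ν) := by
          rw [Real.rpow_neg hapos'.le, Real.rpow_neg hl.le]
          rw [← mul_div_assoc, div_le_div_iff₀ hφl hφa] at h1
          rw [← div_eq_mul_inv, ← div_eq_mul_inv, div_le_div_iff₀ haν hlν, div_mul_eq_mul_div,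
            one_mul, div_mul_eq_mul_div, le_div_iff₀ hc0]
          linarith
      _ ≤ _ := by
          gcongr
          exact le_max_right _ _

variable {s : ℝ} {g : ℝ → ℝ → ℝ} {D B γ ν γν lam t : ℝ}

/-- As `t` tends to `0`, the bound `B / lam` forces `t g(t)` to `0`, so the residual tends to `1`.
-/
theorem IsRegularizationFamily.one_le (hg : IsRegularizationFamily s g D B γ)
    (hlam : lam ∈ Set.Ioc 0 s) : 1 ≤ γ := by
  have hB := hg.B_pos
  have hl := hlam.1
  refine le_of_forall_pos_le_add fun ε hε => ?_
  set t := min s (ε * lam / B) with ht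
  have ht0 : 0 < t := lt_min (hlam.1.trans_le hlam.2) (by positivity)
  have htm : t ∈ Set.Ioc 0 s := ⟨ht0, min_le_left _ _⟩
  have h1 := (abs_le.mp (hg.bound_residual lam hlam t htm)).2
  have h2 := hg.bound lam hlam t htm
  have h3 : t * g lam t ≤ ε := by
    calc t * g lam t ≤ t * |g lam t| := mul_le_mul_of_nonneg_left (le_abs_self _) ht0.le
      _ ≤ ε * lam / B * (B / lam) := mul_le_mul (min_le_right _ _) h2 (abs_nonneg _) (by positivity)
      _ = ε := by field_simp
  linarith

theorem HasQualification.nonneg (hν : HasQualification s g ν γν) (hlam : lam ∈ Set.Ioc 0 s) :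
    0 ≤ γν := by
  have h := hν.2 lam hlam lam hlam
  have hp := Real.rpow_pos_of_pos hlam.1 ν
  have h1 : 0 ≤ γν * lam ^ ν := le_trans (by positivity) h
  exact nonneg_of_mul_nonneg_left h1 hp

/-- For `t ≤ lam` use `t + lam ≤ 2 lam` and the residual bound `γ`; for `t ≥ lam` use `t + lam ≤ 2
t` and the qualification. At `t = 0` the residual is `1`, which `1 ≤ γ` covers. -/
theorem residual_bound (hg : IsRegularizationFamily s g D B γ) (hν : HasQualification s g ν γν)
    (hlam : lam ∈ Set.Ioc 0 s) (ht : t ∈ Set.Icc 0 s) {gt : ℝ} (hgt : t ≠ 0 → gt = g lam t) :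
    |1 - t * gt| * (t + lam) ^ ν ≤ (2 ^ ν * (γν + γ)) * lam ^ ν := by
  have hl := hlam.1
  have hγ := hg.one_le hlam
  have hγν := hν.nonneg hlam
  have hν0 := hν.1
  have hlν := Real.rpow_pos_of_pos hl ν
  rcases ht.1.eq_or_lt with h0 | h0
  · rw [← h0, zero_mul, sub_zero, abs_one, one_mul, zero_add]
    have h2 : 1 ≤ (2 : ℝ) ^ ν := Real.one_le_rpow one_le_two hν0.le
    have : 1 ≤ (2 : ℝ) ^ ν * (γν + γ) := one_le_mul_of_one_le_of_one_le h2 (by linarith)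
    exact le_mul_of_one_le_left hlν.le this
  · rw [hgt h0.ne']
    have htm : t ∈ Set.Ioc 0 s := ⟨h0, ht.2⟩
    have h1 := hg.bound_residual lam hlam t htm
    have h2 := hν.2 lam hlam t htm
    have htν := Real.rpow_pos_of_pos h0 ν
    rcases le_total t lam with h | h
    · calc |1 - t * g lam t| * (t + lam) ^ ν ≤ γ * (2 * lam) ^ ν := by
            refine mul_le_mul h1 (Real.rpow_le_rpow (by linarith) (by linarith) hν0.le)
              (by positivity) (by linarith)
        _ = 2 ^ ν * γ * lam ^ ν := by rw [Real.mul_rpow two_pos.le hl.le]; ring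
        _ ≤ _ := by gcongr; linarith
    · calc |1 - t * g lam t| * (t + lam) ^ ν ≤ |1 - t * g lam t| * (2 * t) ^ ν :=
            mul_le_mul_of_nonneg_left (Real.rpow_le_rpow (by linarith) (by linarith) hν0.le)
              (abs_nonneg _)
        _ = 2 ^ ν * (|1 - t * g lam t| * t ^ ν) := by rw [Real.mul_rpow two_pos.le h0.le]; ring
        _ ≤ 2 ^ ν * (γν * lam ^ ν) := by gcongr
        _ ≤ 2 ^ ν * ((γν + γ) * lam ^ ν) := by gcongr; linarith
        _ = _ := by ring

theorem filter_bound (hg : IsRegularizationFamily s g D B γ) (hlam : lam ∈ Set.Ioc 0 s)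
    (ht : t ∈ Set.Ioc 0 s) : |g lam t| * √(t + lam) ≤ (B + D) / √lam := by
  have hl := hlam.1
  have ht0 := ht.1
  have hB := hg.B_pos
  have hD := hg.D_pos
  have h1 := hg.bound lam hlam t ht
  have h2 := hg.bound_mul lam hlam t ht
  rw [abs_mul, abs_of_pos ht0] at h2
  have h3 : |g lam t| * lam ≤ B := by rwa [le_div_iff₀ hl] at h1
  refine abs_le_of_sq_le_sq' ?_ (by positivity) |>.2
  rw [mul_pow, Real.sq_sqrt (by linarith), div_pow, Real.sq_sqrt hl.le]
  calc |g lam t| ^ 2 * (t + lam) = |g lam t| * (t * |g lam t| + |g lam t| * lam) := by ring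
    _ ≤ B / lam * (D + B) := mul_le_mul h1 (add_le_add h2 h3) (by positivity) (by positivity)
    _ ≤ (B + D) ^ 2 / lam := by
        rw [div_mul_eq_mul_div]
        gcongr
        nlinarith

end Scalar

/-! ### The deterministic error bound. -/

section ErrorDecomposition

variable {X Y H G : Type*} [MeasurableSpace X] [NormedAddCommGroup Y] [InnerProductSpace ℝ Y]
  [CompleteSpace Y] [NormedAddCommGroup H] [InnerProductSpace ℝ H] [CompleteSpace H]
  [RKHS ℝ H X ℝ] [NormedAddCommGroup G] [InnerProductSpace ℝ G] [CompleteSpace G] [RKHS ℝ G X Y]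
  {n : ℕ} {ι : Type*}

theorem HSLe.neg {E F : Type*} [NormedAddCommGroup E] [InnerProductSpace ℝ E] [CompleteSpace E]
    [NormedAddCommGroup F] [InnerProductSpace ℝ F] [CompleteSpace F] {T : E →L[ℝ] F} {B : ℝ}
    (h : HSLe T B) : HSLe (-T) B := by
  refine ⟨h.1, ?_⟩
  simpa only [neg_apply, norm_neg] using h.2

omit [MeasurableSpace X] [NormedAddCommGroup Y] [InnerProductSpace ℝ Y] [CompleteSpace Y] in
theorem empCov_eigenvalue_le {β : X → ℝ} {b κ : ℝ} (hb : 0 ≤ b) (hβ : ∀ x, 0 ≤ β x ∧ β x ≤ b)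
    (hκ : ∀ x : X, ‖feature H x‖ ≤ κ) (hn : 0 < n) (z : Fin n → X × Y) {v : H}
    (hv : ‖v‖ = 1) {a : ℝ} (h : empCov H β z v = a • v) : a ≤ b * κ ^ 2 := by
  rw [(empCov_eigenvalue_nonneg (fun x => (hβ x).1) z hv h).1]
  have h1 : ∀ i ∈ Finset.univ, β (z i).1 * ⟪feature H (z i).1, v⟫ ^ 2 ≤ b * κ ^ 2 := fun i _ => by
    have h3 := abs_real_inner_le_norm (feature H (z i).1) v
    rw [hv, mul_one] at h3
    rw [← sq_abs]
    exact mul_le_mul (hβ _).2 (pow_le_pow_left₀ (abs_nonneg _) (h3.trans (hκ _)) 2) (sq_nonneg _) hb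
  have hn' : (0 : ℝ) < n := Nat.cast_pos.mpr hn
  calc (n : ℝ)⁻¹ * ∑ i, β (z i).1 * ⟪feature H (z i).1, v⟫ ^ 2
      ≤ (n : ℝ)⁻¹ * ∑ _i : Fin n, b * κ ^ 2 :=
        mul_le_mul_of_nonneg_left (Finset.sum_le_sum h1) (by positivity)
    _ = b * κ ^ 2 := by
        rw [Finset.sum_const, Finset.card_univ, Fintype.card_fin, nsmul_eq_mul, ← mul_assoc,
          inv_mul_cancel₀ hn'.ne', one_mul]

omit [MeasurableSpace X] in
/-- The error of the estimator on the event where the empirical operators are close to the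
population operators. -/
theorem norm_sub_estimator_le_of_close [TopologicalSpace.SeparableSpace H]
    (hG : ∀ (x t : X) (y : Y), RKHS.kernel G x t y = scalarKernel H x t • y)
    {κ : ℝ} (hκ : ∀ x : X, ‖feature H x‖ ≤ κ)
    {β : X → ℝ} {b : ℝ} (hb : 0 < b) (hβ : ∀ x, 0 ≤ β x ∧ β x ≤ b) {s : ℝ} (hs : b * κ ^ 2 ≤ s)
    {g : ℝ → ℝ → ℝ} {D B γ ν γν : ℝ} (hg : IsRegularizationFamily s g D B γ)
    (hν : HasQualification s g ν γν) {φ : ℝ → ℝ} (hφ : IsIndexFunction φ) {c : ℝ}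
    (hc : Covers s ν φ c) {fstar : G} {C : H →L[ℝ] H} {e : HilbertBasis ι ℝ H} {a : ι → ℝ}
    (hC : ∀ i, C (e i) = a i • e i) (ha : ∀ i, a i ∈ Set.Icc 0 s)
    {Cstar Co : H →L[ℝ] Y} {Bs Bo : ℝ} (hCs : HSLe Cstar Bs) (hCo : HSLe Co Bo)
    (hfC : ∀ x, fstar x = Cstar (feature H x))
    (hsrc : Cstar = Co ∘L diagonal e fun i => φ (a i)) (hn : 0 < n)
    {lam : ℝ} (hlam : lam ∈ Set.Ioc 0 s) (z : Fin n → X × Y) {τ η : ℝ} (hτ2 : τ / √lam ≤ 1 / 2)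
    (hτ : ‖diagonal e (fun i => (a i + lam) ^ (-(1 / 2) : ℝ)) * (empCov H β z - C)‖ ≤ τ)
    (hη : HSLe ((empCross H β z - Cstar ∘L empCov H β z) ∘L
      diagonal e (fun i => (a i + lam) ^ (-(1 / 2) : ℝ))) η) :
    ‖fstar - estimator G β (g lam) z‖ ≤
      Bs * (⌊ν⌋₊ * (τ / √lam) * (2 ^ ν * (γν + γ))) +
        Bo * (max 1 (1 / c) * φ lam * 2 ^ (ν - ⌊ν⌋₊) * (2 ^ ν * (γν + γ))) +
        η * (√2 * ((B + D) / √lam)) := by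
  obtain ⟨A, hA, hAf, hAe⟩ := exists_isTensor_rkhs (H := H) (G := G) hG
  obtain ⟨J, u, σ, hu⟩ := exists_eigenbasis (empCov H β z) (empCov_isCompactOperator β z)
    (empCov_isSymmetric β z)
  have hl := hlam.1
  have hγ := hg.one_le hlam
  have hγν := hν.nonneg hlam
  have hB := hg.B_pos
  have hD := hg.D_pos
  have hσ : ∀ j, σ j ∈ Set.Icc 0 s := fun j =>
    ⟨(empCov_eigenvalue_nonneg (fun x => (hβ x).1) z (u.orthonormal.1 j) (hu j)).2,
      (empCov_eigenvalue_le hb.le hβ hκ hn z (u.orthonormal.1 j) (hu j)).trans hs⟩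
  -- The family is bounded only on `(0, s]`, whereas `empCov` may have a kernel. The value `0` there
  -- is admissible for both the filter bound and the residual bound.
  let gt : ℝ → ℝ := fun t => if t = 0 then 0 else g lam t
  have hgt : ∀ t, t ≠ 0 → gt t = g lam t := fun t ht => if_neg ht
  have hΓ : ∀ j, |gt (σ j)| ≤ B / lam := fun j => by
    by_cases h : σ j = 0
    · simp only [gt, h, if_true, abs_zero]; positivity
    · rw [hgt _ h]; exact hg.bound lam hlam _ ⟨lt_of_le_of_ne (hσ j).1 (Ne.symm h), (hσ j).2⟩
  have hΓ2 : ∀ j, |gt (σ j)| * √(σ j + lam) ≤ (B + D) / √lam := fun j => by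
    by_cases h : σ j = 0
    · simp only [gt, h, if_true, abs_zero, zero_mul]; positivity
    · rw [hgt _ h]
      exact filter_bound hg hlam ⟨lt_of_le_of_ne (hσ j).1 (Ne.symm h), (hσ j).2⟩
  have hρ : ∀ j, |1 - σ j * gt (σ j)| * (σ j + lam) ^ ν ≤ (2 ^ ν * (γν + γ)) * lam ^ ν := fun j =>
    residual_bound hg hν hlam (hσ j) (hgt _)
  have ha0 : ∀ i, 0 ≤ a i := fun i => (ha i).1
  have hσ0 : ∀ j, 0 ≤ σ j := fun j => (hσ j).1
  have hε := norm_shift_inv_mul_le e ha0 hl hτ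
  have hφb : ∀ i, |φ (a i)| ≤ φ s := fun i => by
    rw [abs_of_nonneg (hφ.nonneg (ha0 i))]
    exact hφ.mono (ha0 i) (ha i).2
  have hΦ : 0 ≤ max 1 (1 / c) * φ lam :=
    mul_nonneg (zero_le_one.trans (le_max_left _ _)) (hφ.nonneg hl.le)
  have hres := hsLe_residual e u hC hu ha0 hσ0 hl hε hτ2 hν.1.le hCs hCo hφb hsrc hΦ
    (fun i => hc.mul_rpow_neg_le hφ hν.1.le hlam (ha i)) (by positivity) hρ
  have hfil := hsLe_filter e u hC hu ha0 hσ0 hl (hε.trans hτ2) hη (by positivity) hΓ2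
  refine norm_sub_estimator_le β (fun x => (hβ x).1) hn z (g lam) gt hgt hA hAf hAe u hu hΓ hCs hfC
    ?_
  -- The splitting into approximation error minus filtered noise, checked on the eigenbasis `u`.
  convert! hres.add hfil.neg using 1
  refine ext_basis u fun j => ?_
  have hρb : ∀ j, |1 - σ j * gt (σ j)| ≤ 1 + s * (B / lam) := fun j => by
    refine (abs_sub _ _).trans ?_
    rw [abs_one, abs_mul, abs_of_nonneg (hσ0 j)]
    gcongr
    · exact (hσ0 j).trans (hσ j).2
    · exact (hσ j).2
    · exact hΓ j
  simp only [add_apply, sub_apply, neg_apply, ContinuousLinearMap.comp_apply,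
    diagonal_apply_basis u hρb, diagonal_apply_basis u hΓ, map_sub, map_smul, hu, smul_sub,
    sub_smul, one_smul, smul_smul]
  rw [mul_comm (σ j)]
  abel

end ErrorDecomposition

/-! ### From averaged tensors to operator bounds. -/

section Events

variable {X Y H : Type*} [MeasurableSpace X] [NormedAddCommGroup Y] [InnerProductSpace ℝ Y]
  [CompleteSpace Y] [NormedAddCommGroup H] [InnerProductSpace ℝ H] [CompleteSpace H]
  [RKHS ℝ H X ℝ] {n : ℕ} {ι K : Type*} [NormedAddCommGroup K] [InnerProductSpace ℝ K]

theorem opNorm_le_of_inner_le {E F : Type*} [NormedAddCommGroup E] [InnerProductSpace ℝ E]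
    [NormedAddCommGroup F] [InnerProductSpace ℝ F] {T : E →L[ℝ] F} {τ : ℝ} (hτ : 0 ≤ τ)
    (h : ∀ v w, ⟪T v, w⟫ ≤ τ * (‖v‖ * ‖w‖)) : ‖T‖ ≤ τ := by
  refine T.opNorm_le_bound hτ fun v => ?_
  have h1 := h v (T v)
  rw [real_inner_self_eq_norm_sq] at h1
  rcases (norm_nonneg (T v)).eq_or_lt with h0 | h0
  · rw [← h0]; positivity
  · refine le_of_mul_le_mul_right ?_ h0
    linarith

omit [MeasurableSpace X] [NormedAddCommGroup Y] [InnerProductSpace ℝ Y] [CompleteSpace Y] in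
/-- Concentration of the covariance operator, in terms of the elementary tensors. -/
theorem norm_diagonal_mul_empCov_sub_le {A : H →L[ℝ] H →L[ℝ] K} (hA : IsTensor A) (β : X → ℝ)
    (z : Fin n → X × Y) {C : H →L[ℝ] H} {D : H →L[ℝ] H} (hD : ∀ v w, ⟪D v, w⟫ = ⟪v, D w⟫) {m : K}
    (hm : ∀ h y, ⟪m, A h y⟫ = ⟪C h, D y⟫) {τ : ℝ}
    (hτ : ‖(n : ℝ)⁻¹ • ∑ i, β (z i).1 • A (feature H (z i).1) (D (feature H (z i).1)) - m‖ ≤ τ) :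
    ‖D * (empCov H β z - C)‖ ≤ τ := by
  refine opNorm_le_of_inner_le ((norm_nonneg _).trans hτ) fun h y => ?_
  -- The matrix entries of the operator are pairings of the averaged tensor with elementary tensors,
  -- so the tensor norm dominates the operator norm.
  have h1 : ⟪(D * (empCov H β z - C)) h, y⟫ = ⟪(n : ℝ)⁻¹ • ∑ i, β (z i).1 •
      A (feature H (z i).1) (D (feature H (z i).1)) - m, A h y⟫ := by
    rw [ContinuousLinearMap.mul_def, ContinuousLinearMap.comp_apply, hD, sub_apply, inner_sub_left,
      inner_sub_left, hm, inner_empCov, real_inner_smul_left, sum_inner]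
    simp only [real_inner_smul_left, hA _ _ _ _, hD]
  rw [h1]
  refine (real_inner_le_norm _ _).trans ?_
  rw [hA.norm_apply]
  exact mul_le_mul_of_nonneg_right hτ (by positivity)

omit [MeasurableSpace X] in
/-- The Hilbert–Schmidt norm of the weighted noise, in terms of the elementary tensors. -/
theorem hsLe_empCross_sub {A : H →L[ℝ] Y →L[ℝ] K} (hA : IsTensor A) (β : X → ℝ)
    (z : Fin n → X × Y) {Cstar : H →L[ℝ] Y} {D : H →L[ℝ] H} (hD : ∀ v w, ⟪D v, w⟫ = ⟪v, D w⟫)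
    {η : ℝ} (hη : ‖(n : ℝ)⁻¹ • ∑ i, β (z i).1 • A (D (feature H (z i).1))
      ((z i).2 - Cstar (feature H (z i).1))‖ ≤ η) :
    HSLe ((empCross H β z - Cstar ∘L empCov H β z) ∘L D) η := by
  have h1 := (hasSum_apply_basis A (onb H) (fun i => D (feature H (z i).1))
    (fun i => β (z i).1 • ((z i).2 - Cstar (feature H (z i).1)))).const_smul (n : ℝ)⁻¹
  simp only [← map_smul] at h1
  have h2 := hA.hasSum_norm_sq (onb H) h1
  have h3 : ∀ j, ((empCross H β z - Cstar ∘L empCov H β z) ∘L D) (onb H j) = (n : ℝ)⁻¹ •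
      ∑ i, ⟪D (feature H (z i).1), onb H j⟫ • β (z i).1 •
        ((z i).2 - Cstar (feature H (z i).1)) := fun j => by
    rw [ContinuousLinearMap.comp_apply, sub_apply, ContinuousLinearMap.comp_apply, empCross_apply,
      empCov_apply, map_smul, map_sum, ← smul_sub, ← Finset.sum_sub_distrib]
    congr 1
    refine Finset.sum_congr rfl fun i _ => ?_
    rw [map_smul, ← smul_sub, hD, smul_smul, mul_comm]
  refine (hsLe_iff_hasSum (onb H)).mpr ⟨(norm_nonneg _).trans hη, ?_, ?_⟩
  · simpa only [h3] using h2.summable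
  · simp only [h3]
    rw [h2.tsum_eq]
    refine pow_le_pow_left₀ (norm_nonneg _) (le_trans (le_of_eq ?_) hη) 2
    congr 2
    simp only [map_smul]

end Events

/-! ### Moments of the weighted tensors under the source distribution. -/

section Moments

variable {X Y H : Type*} [MeasurableSpace X] [NormedAddCommGroup Y] [InnerProductSpace ℝ Y]
  [CompleteSpace Y] [TopologicalSpace.SeparableSpace Y] [MeasurableSpace Y] [BorelSpace Y]
  [NormedAddCommGroup H] [InnerProductSpace ℝ H] [CompleteSpace H]
  [RKHS ℝ H X ℝ] {K : Type*} [NormedAddCommGroup K] [InnerProductSpace ℝ K] [CompleteSpace K]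
  {pX qX : Measure X} [IsProbabilityMeasure pX] [IsProbabilityMeasure qX]
  {P : Kernel X Y} [IsMarkovKernel P] {β : X → ℝ} {b κ : ℝ}

omit [IsProbabilityMeasure pX] [IsProbabilityMeasure qX] in
theorem integral_reweight (hβmeas : Measurable β) (hβ : ∀ x, 0 ≤ β x)
    (hq : qX = pX.withDensity fun x => ENNReal.ofReal (β x)) {E : Type*} [NormedAddCommGroup E]
    [NormedSpace ℝ E] (f : X → E) : ∫ x, f x ∂qX = ∫ x, β x • f x ∂pX := by
  rw [hq, integral_withDensity_eq_integral_toReal_smul hβmeas.ennreal_ofReal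
    (ae_of_all _ fun x => ENNReal.ofReal_lt_top)]
  simp only [ENNReal.toReal_ofReal (hβ _)]

/-- The density `β` has mean `1`. This places the spectrum of the population covariance, contained
in `[0, κ²]`, inside `[0, s]`. -/
theorem one_le_of_reweight (hβmeas : Measurable β) (hβ : ∀ x, 0 ≤ β x ∧ β x ≤ b)
    (hq : qX = pX.withDensity fun x => ENNReal.ofReal (β x)) : 1 ≤ b := by
  have h := integral_reweight hβmeas (fun x => (hβ x).1) hq (fun _ => (1 : ℝ))
  simp only [integral_const, probReal_univ, smul_eq_mul, mul_one] at h
  rw [h]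
  calc ∫ x, β x ∂pX ≤ ∫ _, b ∂pX := integral_mono_of_nonneg (ae_of_all _ fun x => (hβ x).1)
        (integrable_const _) (ae_of_all _ fun x => (hβ x).2)
    _ = b := by simp

omit [NormedAddCommGroup Y] [InnerProductSpace ℝ Y] [CompleteSpace Y]
  [TopologicalSpace.SeparableSpace Y] [BorelSpace Y] in
theorem integral_fst_compProd {E : Type*} [NormedAddCommGroup E] [NormedSpace ℝ E] {f : X → E}
    (hf : AEStronglyMeasurable f pX) : ∫ z, f z.1 ∂(pX ⊗ₘ P) = ∫ x, f x ∂pX := by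
  have h : (pX ⊗ₘ P).map Prod.fst = pX := Measure.fst_compProd pX P
  conv_rhs => rw [← h]
  rw [integral_map measurable_fst.aemeasurable (by rwa [h])]

variable (hmeas : StronglyMeasurable (feature H : X → H)) (hκ : ∀ x : X, ‖feature H x‖ ≤ κ)
  (hβmeas : Measurable β) (hβ : ∀ x, 0 ≤ β x ∧ β x ≤ b)
include hmeas hβmeas

omit [CompleteSpace K] in
theorem stronglyMeasurable_covTensor (A : H →L[ℝ] H →L[ℝ] K) (D : H →L[ℝ] H) :
    StronglyMeasurable fun x : X => β x • A (feature H x) (D (feature H x)) := by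
  have hc : Continuous fun h : H => A h (D h) := by fun_prop
  exact hβmeas.stronglyMeasurable.smul (hc.comp_stronglyMeasurable hmeas)

omit [CompleteSpace Y] [CompleteSpace K] in
theorem stronglyMeasurable_noiseTensor (A : H →L[ℝ] Y →L[ℝ] K) (D : H →L[ℝ] H)
    (Cstar : H →L[ℝ] Y) : StronglyMeasurable fun z : X × Y =>
      β z.1 • A (D (feature H z.1)) (z.2 - Cstar (feature H z.1)) := by
  have := UniformSpace.secondCountable_of_separable Y
  have h1 : StronglyMeasurable fun z : X × Y => feature H z.1 :=
    hmeas.comp_measurable measurable_fst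
  have h2 : StronglyMeasurable fun z : X × Y => z.2 := measurable_snd.stronglyMeasurable
  have hc : Continuous fun p : H × Y => A (D p.1) (p.2 - Cstar p.1) := by fun_prop
  exact (hβmeas.comp measurable_fst).stronglyMeasurable.smul
    (hc.comp_stronglyMeasurable (h1.prodMk h2))

include hκ hβ

omit [IsProbabilityMeasure qX] in
-- The square contains `β²`: one factor is bounded by `b`, the other turns `pX` into `qX`. Hence the
-- second moment is linear in `b` and involves the mean that defines `N`.
theorem covTensor_moments {A : H →L[ℝ] H →L[ℝ] K} (hA : IsTensor A) {D : H →L[ℝ] H} {d : ℝ}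
    (hd : ‖D‖ ≤ d) (hb : 0 ≤ b) (hκ0 : 0 ≤ κ)
    (hq : qX = pX.withDensity fun x => ENNReal.ofReal (β x)) :
    (∀ x : X, ‖β x • A (feature H x) (D (feature H x))‖ ≤ b * κ * (d * κ)) ∧
    (∫ x, ‖β x • A (feature H x) (D (feature H x))‖ ^ 2 ∂pX
      ≤ b * κ ^ 2 * ∫ x, ‖D (feature H x)‖ ^ 2 ∂qX) ∧
    ∀ h y, ⟪∫ x, β x • A (feature H x) (D (feature H x)) ∂pX, A h y⟫
      = ∫ x, ⟪feature H x, h⟫ * ⟪D (feature H x), y⟫ ∂qX := by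
  have hd0 := (norm_nonneg D).trans hd
  have hnorm : ∀ x : X, ‖β x • A (feature H x) (D (feature H x))‖
      = β x * (‖feature H x‖ * ‖D (feature H x)‖) := fun x => by
    rw [norm_smul, hA.norm_apply, Real.norm_of_nonneg (hβ x).1]
  have hbound : ∀ x : X, ‖β x • A (feature H x) (D (feature H x))‖ ≤ b * κ * (d * κ) := fun x => by
    rw [hnorm, mul_assoc]
    have h1 := hβ x
    have h2 := hκ x
    have h3 : ‖D (feature H x)‖ ≤ d * κ := D.le_of_opNorm_le_of_le hd (hκ x)
    exact mul_le_mul h1.2 (mul_le_mul h2 h3 (norm_nonneg _) hκ0) (by positivity) hb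
  have hsm := stronglyMeasurable_covTensor hmeas hβmeas A D
  refine ⟨hbound, ?_, fun h y => ?_⟩
  · rw [integral_reweight hβmeas (fun x => (hβ x).1) hq, ← integral_const_mul]
    have hm : StronglyMeasurable fun x => β x • ‖D (feature H x)‖ ^ 2 :=
      hβmeas.stronglyMeasurable.smul ((D.continuous.comp_stronglyMeasurable hmeas).norm.pow 2)
    refine integral_mono_of_nonneg (ae_of_all _ fun x => sq_nonneg _) ?_ (ae_of_all _ fun x => ?_)
    · refine (Integrable.of_bound hm.aestronglyMeasurable (b * (d * κ) ^ 2)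
        (ae_of_all _ fun x => ?_)).const_mul _
      rw [norm_smul, Real.norm_of_nonneg (hβ x).1, norm_pow, norm_norm]
      have h3 : ‖D (feature H x)‖ ≤ d * κ := D.le_of_opNorm_le_of_le hd (hκ x)
      exact mul_le_mul (hβ x).2 (pow_le_pow_left₀ (norm_nonneg _) h3 2) (by positivity) hb
    · simp only [hnorm, smul_eq_mul]
      have h1 := hβ x
      have h2 := pow_le_pow_left₀ (norm_nonneg _) (hκ x) 2
      calc (β x * (‖feature H x‖ * ‖D (feature H x)‖)) ^ 2
          = (β x * ‖feature H x‖ ^ 2) * (β x * ‖D (feature H x)‖ ^ 2) := by ring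
        _ ≤ (b * κ ^ 2) * (β x * ‖D (feature H x)‖ ^ 2) :=
            mul_le_mul_of_nonneg_right (mul_le_mul h1.2 h2 (sq_nonneg _) hb)
              (mul_nonneg h1.1 (sq_nonneg _))
  · have hi : Integrable (fun x => β x • A (feature H x) (D (feature H x))) pX :=
      integrable_of_norm_le hsm (ae_of_all _ hbound)
    rw [real_inner_comm, ← integral_inner hi, integral_reweight hβmeas (fun x => (hβ x).1) hq]
    refine integral_congr_ae (ae_of_all _ fun x => ?_)
    simp only [real_inner_smul_right, hA _ _ _ _, smul_eq_mul]
    rw [real_inner_comm h, real_inner_comm y]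

omit [IsProbabilityMeasure qX] in
theorem noiseTensor_moments {A : H →L[ℝ] Y →L[ℝ] K} (hA : IsTensor A) {D : H →L[ℝ] H} {d : ℝ}
    (hd : ‖D‖ ≤ d) (hb : 0 ≤ b) (hκ0 : 0 ≤ κ)
    (hq : qX = pX.withDensity fun x => ENNReal.ofReal (β x)) {Cstar : H →L[ℝ] Y} {M' Bs : ℝ}
    (hM' : 0 ≤ M') (hY : ∀ᵐ z ∂(pX ⊗ₘ P), ‖z.2‖ ≤ M') (hBs : ‖Cstar‖ ≤ Bs)
    (hreg : ∀ᵐ x ∂qX, Cstar (feature H x) = ∫ y, y ∂(P x)) :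
    (∀ᵐ z ∂(pX ⊗ₘ P), ‖β z.1 • A (D (feature H z.1)) (z.2 - Cstar (feature H z.1))‖
      ≤ b * (d * κ) * (M' + Bs * κ)) ∧
    ∫ z, β z.1 • A (D (feature H z.1)) (z.2 - Cstar (feature H z.1)) ∂(pX ⊗ₘ P) = 0 ∧
    (∫ z, ‖β z.1 • A (D (feature H z.1)) (z.2 - Cstar (feature H z.1))‖ ^ 2 ∂(pX ⊗ₘ P)
      ≤ b * (M' + Bs * κ) ^ 2 * ∫ x, ‖D (feature H x)‖ ^ 2 ∂qX) := by
  have := UniformSpace.secondCountable_of_separable Y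
  have hd0 := (norm_nonneg D).trans hd
  have hBs0 := (norm_nonneg Cstar).trans hBs
  have hM0 : 0 ≤ M' + Bs * κ := by positivity
  have hDb : ∀ x : X, ‖D (feature H x)‖ ≤ d * κ := fun x => D.le_of_opNorm_le_of_le hd (hκ x)
  have hnorm : ∀ z : X × Y, ‖β z.1 • A (D (feature H z.1)) (z.2 - Cstar (feature H z.1))‖
      = β z.1 * (‖D (feature H z.1)‖ * ‖z.2 - Cstar (feature H z.1)‖) := fun z => by
    rw [norm_smul, hA.norm_apply, Real.norm_of_nonneg (hβ _).1]
  have hres : ∀ᵐ z ∂(pX ⊗ₘ P), ‖z.2 - Cstar (feature H z.1)‖ ≤ M' + Bs * κ := by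
    filter_upwards [hY] with z hz
    exact (norm_sub_le _ _).trans (add_le_add hz (Cstar.le_of_opNorm_le_of_le hBs (hκ _)))
  have hsm := stronglyMeasurable_noiseTensor hmeas hβmeas A D Cstar
  have hbound : ∀ᵐ z ∂(pX ⊗ₘ P), ‖β z.1 • A (D (feature H z.1)) (z.2 - Cstar (feature H z.1))‖
      ≤ b * (d * κ) * (M' + Bs * κ) := by
    filter_upwards [hres] with z hz
    rw [hnorm, mul_assoc]
    exact mul_le_mul (hβ _).2 (mul_le_mul (hDb _) hz (norm_nonneg _) (by positivity))
      (by positivity) hb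
  refine ⟨hbound, ?_, ?_⟩
  · rw [Measure.integral_compProd (integrable_of_norm_le hsm hbound)]
    have hYx : ∀ᵐ x ∂pX, ∀ᵐ y ∂(P x), ‖y‖ ≤ M' := Measure.ae_ae_of_ae_compProd hY
    -- The regression identity is known only almost everywhere for `qX`, that is, where `β ≠ 0`;
    -- elsewhere the weight annihilates the noise.
    have hreg' : ∀ᵐ x ∂pX, β x ≠ 0 → Cstar (feature H x) = ∫ y, y ∂(P x) := by
      rw [hq, ae_withDensity_iff hβmeas.ennreal_ofReal] at hreg
      filter_upwards [hreg] with x hx hβx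
      refine hx ?_
      rw [Ne, ENNReal.ofReal_eq_zero, not_le]
      exact lt_of_le_of_ne (hβ x).1 (Ne.symm hβx)
    rw [← integral_zero X K]
    refine integral_congr_ae ?_
    filter_upwards [hYx, hreg'] with x hx hx'
    have hi : Integrable (fun y : Y => y) (P x) :=
      Integrable.of_bound measurable_id.stronglyMeasurable.aestronglyMeasurable M' hx
    have h1 : ∫ y, A (D (feature H x)) (y - Cstar (feature H x)) ∂(P x)
        = A (D (feature H x)) ((∫ y, y ∂(P x)) - Cstar (feature H x)) := by
      have hsub : Integrable (fun y => y - Cstar (feature H x)) (P x) :=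
        hi.sub (integrable_const _)
      rw [ContinuousLinearMap.integral_comp_comm _ hsub, integral_sub hi (integrable_const _)]
      simp
    show ∫ y, β x • A (D (feature H x)) (y - Cstar (feature H x)) ∂(P x) = 0
    rw [integral_smul, h1]
    by_cases h : β x = 0
    · rw [h, zero_smul]
    · rw [hx' h, sub_self, map_zero, smul_zero]
  · rw [integral_reweight hβmeas (fun x => (hβ x).1) hq, ← integral_const_mul]
    have hm : StronglyMeasurable fun x => β x • ‖D (feature H x)‖ ^ 2 :=
      hβmeas.stronglyMeasurable.smul ((D.continuous.comp_stronglyMeasurable hmeas).norm.pow 2)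
    have hm2 : StronglyMeasurable fun x => b * (M' + Bs * κ) ^ 2 * (β x • ‖D (feature H x)‖ ^ 2) :=
      hm.const_mul _
    rw [← integral_fst_compProd (P := P) hm2.aestronglyMeasurable]
    refine integral_mono_of_nonneg (ae_of_all _ fun x => sq_nonneg _) ?_ ?_
    · refine Integrable.of_bound (hm2.comp_measurable measurable_fst).aestronglyMeasurable
        (b * (M' + Bs * κ) ^ 2 * (b * (d * κ) ^ 2)) (ae_of_all _ fun z => ?_)
      rw [norm_mul, norm_smul, Real.norm_of_nonneg (hβ _).1, norm_pow, norm_norm,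
        Real.norm_of_nonneg (by positivity)]
      have := mul_le_mul (hβ z.1).2 (pow_le_pow_left₀ (norm_nonneg _) (hDb z.1) 2)
        (by positivity) hb
      gcongr
    · filter_upwards [hres] with z hz
      simp only [hnorm, smul_eq_mul]
      have h1 := hβ z.1
      have h2 := pow_le_pow_left₀ (norm_nonneg _) hz 2
      calc (β z.1 * (‖D (feature H z.1)‖ * ‖z.2 - Cstar (feature H z.1)‖)) ^ 2
          = (β z.1 * ‖z.2 - Cstar (feature H z.1)‖ ^ 2) * (β z.1 * ‖D (feature H z.1)‖ ^ 2) := by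
            ring
        _ ≤ (b * (M' + Bs * κ) ^ 2) * (β z.1 * ‖D (feature H z.1)‖ ^ 2) :=
            mul_le_mul_of_nonneg_right (mul_le_mul h1.2 h2 (sq_nonneg _) hb)
              (mul_nonneg h1.1 (sq_nonneg _))

end Moments

/-! ### Collecting the constants. -/

section FinalBound

theorem inv_mul_sqrt_div_sqrt {b w N n lam : ℝ} (hb : 0 ≤ b) (hw : 0 ≤ w) (hN : 0 ≤ N) (hn : 0 < n)
    (hlam : 0 < lam) : n⁻¹ * √(n * (b * w ^ 2 * N)) / √lam = √b * w * √(N / (n * lam)) := by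
  have h1 : √(n * (b * w ^ 2 * N)) = √n * (√b * w * √N) := by
    rw [Real.sqrt_mul hn.le, Real.sqrt_mul (by positivity), Real.sqrt_mul hb, Real.sqrt_sq hw]
  have h2 : √(N / (n * lam)) = √N / (√n * √lam) := by
    rw [Real.sqrt_div hN, Real.sqrt_mul hn.le]
  have h3 : n⁻¹ * √n = (√n)⁻¹ := by
    have hsn := Real.sqrt_pos.mpr hn
    nth_rewrite 1 [← Real.mul_self_sqrt hn.le]
    field_simp
  rw [h1, h2, ← mul_assoc, h3]
  have := Real.sqrt_pos.mpr hn
  have := Real.sqrt_pos.mpr hlam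
  field_simp

/-- The threshold for the empirical covariance in the form of the sample size condition. -/
theorem threshold_eq {b κ N n lam l : ℝ} (hb : 0 ≤ b) (hN : 0 ≤ N) (hn : 0 < n)
    (hlam : 0 < lam) :
    n⁻¹ * (2 * (2 * (b * κ * ((√lam)⁻¹ * κ)) + √(n * (b * κ ^ 2 * N))) * l)
      = 2 * (2 * b * κ ^ 2 / (√lam * n) + √(b * κ ^ 2 * N / n)) * l := by
  have h3 : n⁻¹ * √n = (√n)⁻¹ := by
    have hsn := Real.sqrt_pos.mpr hn
    nth_rewrite 1 [← Real.mul_self_sqrt hn.le]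
    field_simp
  have h1 : √(b * κ ^ 2 * N / n) = n⁻¹ * √(n * (b * κ ^ 2 * N)) := by
    rw [Real.sqrt_mul hn.le, ← mul_assoc, h3, Real.sqrt_div (by positivity), div_eq_inv_mul]
  rw [h1]
  have := Real.sqrt_pos.mpr hlam
  field_simp

theorem final_bound {b κ N n lam l M E Bs Bo Γ μ ν Φ : ℝ} {m : ℕ} (hb : 0 ≤ b) (hκ : 0 ≤ κ)
    (hN : 0 ≤ N) (hn : 0 < n) (hlam : 0 < lam) (hl : 0 ≤ l) (hM : 0 ≤ M) (hE : 0 ≤ E)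
    (hBs : 0 ≤ Bs) (hΓ : 0 ≤ Γ) (hμ : 1 ≤ μ) (hm : (m : ℝ) ≤ ν) :
    Bs * (m * (n⁻¹ * (2 * (2 * (b * κ * ((√lam)⁻¹ * κ)) + √(n * (b * κ ^ 2 * N))) * l) / √lam)
        * (2 ^ ν * Γ)) +
      Bo * (μ * Φ * 2 ^ (ν - m) * (2 ^ ν * Γ)) +
      n⁻¹ * (√5 * (b * ((√lam)⁻¹ * κ) * M + √(n * (b * M ^ 2 * N))) * l) * (√2 * (E / √lam)) ≤
    ((2 ^ (2 * ν - m + 2) * Γ * μ * m * b * κ ^ 2 * Bs + 2 * √10 * b * M * κ * E) / (n * lam)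
      + (2 ^ (2 * ν - m + 1) * Γ * μ * m * √b * κ * Bs + √10 * √b * M * E) * √(N / (n * lam))) * l
      + 2 ^ (2 * ν - m) * Γ * μ * Bo * Φ := by
  have hsl := Real.sqrt_pos.mpr hlam
  have e1 := inv_mul_sqrt_div_sqrt hb hκ hN hn hlam
  have e2 := inv_mul_sqrt_div_sqrt hb hM hN hn hlam
  set y := √(N / (n * lam)) with hy
  have hy0 : 0 ≤ y := Real.sqrt_nonneg _
  have e3 : n⁻¹ * (√lam)⁻¹ / √lam = 1 / (n * lam) := by
    nth_rewrite 3 [← Real.mul_self_sqrt hlam.le]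
    field_simp
  set x := 1 / (n * lam) with hx
  have hx0 : 0 ≤ x := by positivity
  have e4 : √5 * √2 = √10 := by rw [← Real.sqrt_mul (by norm_num)]; norm_num
  have hτ : n⁻¹ * (2 * (2 * (b * κ * ((√lam)⁻¹ * κ)) + √(n * (b * κ ^ 2 * N))) * l) / √lam
      = (4 * b * κ ^ 2 * x + 2 * √b * κ * y) * l := by
    rw [← e3]
    calc _ = (4 * b * κ ^ 2 * (n⁻¹ * (√lam)⁻¹ / √lam)
          + 2 * (n⁻¹ * √(n * (b * κ ^ 2 * N)) / √lam)) * l := by ring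
      _ = _ := by rw [e1]; ring
  have hη : n⁻¹ * (√5 * (b * ((√lam)⁻¹ * κ) * M + √(n * (b * M ^ 2 * N))) * l) * (√2 * (E / √lam))
      = √10 * (b * M * κ * x + √b * M * y) * E * l := by
    rw [← e3, ← e4]
    calc _ = √5 * √2 * (b * M * κ * (n⁻¹ * (√lam)⁻¹ / √lam)
          + n⁻¹ * √(n * (b * M ^ 2 * N)) / √lam) * E * l := by ring
      _ = _ := by rw [e2]
  have p2 : (2 : ℝ) ^ (2 * ν - m + 2) = 4 * 2 ^ (2 * ν - m) := by
    rw [Real.rpow_add two_pos]; norm_num [mul_comm]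
  have p1 : (2 : ℝ) ^ (2 * ν - m + 1) = 2 * 2 ^ (2 * ν - m) := by
    rw [Real.rpow_add two_pos]; norm_num [mul_comm]
  have p0 : (2 : ℝ) ^ (ν - m) * 2 ^ ν = 2 ^ (2 * ν - m) := by
    rw [← Real.rpow_add two_pos]; congr 1; ring
  -- The perturbation term carries only `2 ^ ν`; it is enlarged to the power that occurs in the
  -- source term.
  have pν : (2 : ℝ) ^ ν ≤ 2 ^ (2 * ν - m) :=
    Real.rpow_le_rpow_of_exponent_le one_le_two (by linarith)
  rw [hτ, hη, p1, p2]
  set w := (2 : ℝ) ^ (2 * ν - m)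
  have hw : (2 : ℝ) ^ ν ≤ w * μ := pν.trans (le_mul_of_one_le_right (by positivity) hμ)
  have t1 : Bs * (m * ((4 * b * κ ^ 2 * x + 2 * √b * κ * y) * l) * (2 ^ ν * Γ))
      ≤ Bs * (m * ((4 * b * κ ^ 2 * x + 2 * √b * κ * y) * l) * (w * μ * Γ)) := by gcongr
  have t2 : Bo * (μ * Φ * 2 ^ (ν - m) * (2 ^ ν * Γ)) = w * Γ * μ * Bo * Φ := by
    rw [← p0]; ring
  -- The noise is already centred and yields `√10` here; the constant `2 √10` leaves slack.
  have t3 : √10 * (b * M * κ * x + √b * M * y) * E * l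
      ≤ √10 * (2 * (b * M * κ * x) + √b * M * y) * E * l := by
    have hz : 0 ≤ b * M * κ * x := by positivity
    gcongr √10 * (?_ + _) * E * l
    linarith
  rw [t2]
  refine (add_le_add (add_le_add t1 le_rfl) t3).trans (le_of_eq ?_)
  rw [div_eq_mul_one_div _ (n * lam), ← hx]
  ring

end FinalBound

/-! ### The source condition in an eigenbasis. -/

section Source

variable {E F : Type*} [NormedAddCommGroup E] [InnerProductSpace ℝ E] [CompleteSpace E]
  [NormedAddCommGroup F] [InnerProductSpace ℝ F] {ι : Type*}

theorem funcCalc_eq_diagonal {A : E →L[ℝ] E} (hA : (A : E →ₗ[ℝ] E).IsSymmetric)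
    (e : HilbertBasis ι ℝ E) {a : ι → ℝ} (he : ∀ i, A (e i) = a i • e i) {f : ℝ → ℝ} {M : ℝ}
    (hf : ∀ i, |f (a i)| ≤ M) (v : E) : funcCalc A f v = diagonal e (fun i => f (a i)) v := by
  refine funcCalc_eq A hA f (x := fun i => ⟪e i, v⟫ • e i) (μ := a) (fun i => ?_)
    (hasSum_inner_smul e v) ?_
  · rw [map_smul, he, smul_comm]
  · have h := hasSum_inner_smul e (diagonal e (fun i => f (a i)) v)
    simpa only [inner_diagonal e hf, mul_smul] using h

end Source

theorem norm_inv_smul_sum_sub_le {K : Type*} [NormedAddCommGroup K] [NormedSpace ℝ K] {n : ℕ}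
    (hn : 0 < n) (f : Fin n → K) (m : K) {t : ℝ} (h : ‖∑ i, (f i - m)‖ ≤ t) :
    ‖(n : ℝ)⁻¹ • ∑ i, f i - m‖ ≤ (n : ℝ)⁻¹ * t := by
  have hn' : (0 : ℝ) < n := Nat.cast_pos.mpr hn
  have e : (n : ℝ)⁻¹ • ∑ i, f i - m = (n : ℝ)⁻¹ • ∑ i, (f i - m) := by
    rw [Finset.sum_sub_distrib, Finset.sum_const, Finset.card_univ, Fintype.card_fin, smul_sub,
      ← Nat.cast_smul_eq_nsmul ℝ, inv_smul_smul₀ hn'.ne']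
  rw [e, norm_smul, Real.norm_of_nonneg (inv_nonneg.mpr hn'.le)]
  gcongr

end CovShift

/-! ### Assembly of the probabilistic bound. -/

open CovShift in
theorem mainTheorem2
    -- input space, output space, scalar RKHS `H` and vector-valued RKHS `G`
    {X : Type*} [TopologicalSpace X] [SecondCountableTopology X] [LocallyCompactSpace X] [T2Space X]
    [MeasurableSpace X] [BorelSpace X]
    {Y : Type*} [NormedAddCommGroup Y] [InnerProductSpace ℝ Y] [CompleteSpace Y]
    [TopologicalSpace.SeparableSpace Y] [MeasurableSpace Y] [BorelSpace Y]
    {H : Type*} [NormedAddCommGroup H] [InnerProductSpace ℝ H] [CompleteSpace H] [RKHS ℝ H X ℝ]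
    {G : Type*} [NormedAddCommGroup G] [InnerProductSpace ℝ G] [CompleteSpace G] [RKHS ℝ G X Y]
    -- `G` has the kernel `K(x, t) = k(x, t) Id`, where `k` is the kernel of `H`
    (hG : ∀ (x t : X) (y : Y), RKHS.kernel G x t y = CovShift.scalarKernel H x t • y)
    (hmeas : StronglyMeasurable (CovShift.feature H : X → H))
    -- bounded kernel
    (κ : ℝ) (hκ : 0 ≤ κ) (hk : ∀ x, CovShift.scalarKernel H x x ≤ κ ^ 2)
    -- source and target marginals, conditional distribution, reweighting function
    (pX qX : Measure X) [IsProbabilityMeasure pX] [IsProbabilityMeasure qX]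
    (P : Kernel X Y) [IsMarkovKernel P]
    (β : X → ℝ) (hβmeas : Measurable β) (b : ℝ) (hb : 0 < b)
    (hβ : ∀ x, 0 ≤ β x ∧ β x ≤ b)
    (hq : qX = pX.withDensity fun x => ENNReal.ofReal (β x))
    -- bounded outputs
    (M' : ℝ) (hM' : 0 < M') (hY : ∀ᵐ z ∂(pX ⊗ₘ P), ‖z.2‖ ≤ M')
    -- regularization family, qualification, index function
    (s : ℝ) (hs : b * κ ^ 2 ≤ s) (g : ℝ → ℝ → ℝ) (D B γ : ℝ)
    (hg : CovShift.IsRegularizationFamily s g D B γ)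
    (ν γν : ℝ) (hν : CovShift.HasQualification s g ν γν)
    (φ : ℝ → ℝ) (hφ : CovShift.IsIndexFunction φ)
    (c : ℝ) (hc : CovShift.Covers s ν φ c)
    -- the regression function, its operator and the source condition
    (fstar : G) (hreg : ∀ᵐ x ∂qX, fstar x = ∫ y, y ∂(P x))
    (Cstar Co : H →L[ℝ] Y) (hfC : ∀ x, fstar x = Cstar (CovShift.feature H x))
    (hCo : CovShift.IsHilbertSchmidt Co)
    (hsource : ∀ h, Cstar h = Co (CovShift.funcCalc (CovShift.covOp H qX) φ h))
    -- sample size, confidence level, regularization parameter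
    (n : ℕ) (hn : 0 < n) (δ : ℝ) (hδ : δ ∈ Set.Ioo (0 : ℝ) 1)
    (lam : ℝ) (hlam : lam ∈ Set.Ioc 0 s)
    (N : ℝ) (hN : N = CovShift.effDim (CovShift.covOp H qX) lam)
    (hcond : 2 * (2 * b * κ ^ 2 / (√lam * n) + √(b * κ ^ 2 * N / n)) * Real.log (2 / δ)
      ≤ √lam / 2)
    -- the constants
    (M A₁ A₂ A₃ : ℝ) (hM : M = M' + CovShift.hsNorm Cstar * κ)
    (hA₁ : A₁ = 2 ^ (2 * ν - ⌊ν⌋₊ + 2) * (γν + γ) * max 1 (1 / c) * ⌊ν⌋₊ * b * κ ^ 2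
        * CovShift.hsNorm Cstar + 2 * √10 * b * M * κ * (B + D))
    (hA₂ : A₂ = 2 ^ (2 * ν - ⌊ν⌋₊ + 1) * (γν + γ) * max 1 (1 / c) * ⌊ν⌋₊ * √b * κ
        * CovShift.hsNorm Cstar + √10 * √b * M * (B + D))
    (hA₃ : A₃ = 2 ^ (2 * ν - ⌊ν⌋₊) * (γν + γ) * max 1 (1 / c) * CovShift.hsNorm Co) :
    -- for an i.i.d. sample from `p = pX ⊗ P` the bound fails with probability at most `δ`
    Measure.pi (fun _ : Fin n => pX ⊗ₘ P)
      {z | ¬ ‖fstar - CovShift.estimator G β (g lam) z‖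
        ≤ (A₁ / (n * lam) + A₂ * √(N / (n * lam))) * Real.log (2 / δ) + A₃ * φ lam}
      ≤ ENNReal.ofReal δ := by
  have hsep := separableSpace_of_stronglyMeasurable_feature hmeas
  have hfeat := norm_feature_le (H := H) hκ hk
  have hb1 := one_le_of_reweight hβmeas hβ hq
  have hl := hlam.1
  have hsl := Real.sqrt_pos.mpr hl
  obtain ⟨ι, e, a, he⟩ := exists_eigenbasis (covOp H qX) (covOp_isCompactOperator hmeas hfeat)
    (covOp_isSymmetric hmeas hfeat)
  have ha : ∀ i, a i ∈ Set.Icc 0 s := fun i => by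
    have h := covOp_eigenvalue_mem hmeas hfeat (e.orthonormal.1 i) (he i)
    exact ⟨h.1, h.2.trans ((le_mul_of_one_le_left (sq_nonneg κ) hb1).trans hs)⟩
  have hpos : ∀ i, 0 < a i + lam := fun i => by linarith [(ha i).1]
  have hdm : ∀ i, |(a i + lam) ^ (-(1 / 2) : ℝ)| ≤ (√lam)⁻¹ := fun i => by
    rw [abs_of_pos (Real.rpow_pos_of_pos (hpos i) _), Real.sqrt_eq_rpow, ← Real.rpow_neg hl.le]
    exact Real.rpow_le_rpow_of_nonpos hl (by linarith [(ha i).1]) (by norm_num)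
  have hDsym := inner_diagonal_left e hdm
  have hDn := norm_diagonal_le e (inv_nonneg.mpr hsl.le) hdm
  have hNe := effDim_eq hmeas hfeat e he hl
  rw [← hN] at hNe
  have hN0 : 0 ≤ N := hNe ▸ integral_nonneg fun x => sq_nonneg _
  -- the source condition in the eigenbasis
  have hφb : ∀ i, |φ (a i)| ≤ φ s := fun i => by
    rw [abs_of_nonneg (hφ.nonneg (ha i).1)]
    exact hφ.mono (ha i).1 (ha i).2
  have hsrc : Cstar = Co ∘L diagonal e fun i => φ (a i) := by
    ext h
    rw [hsource, funcCalc_eq_diagonal (covOp_isSymmetric hmeas hfeat) e he hφb]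
    rfl
  -- `Cstar` is Hilbert–Schmidt because `Co` is and `φ(C)` is bounded.
  have hCs : HSLe Cstar (hsNorm Cstar) := by
    have h := hCo.hsLe.comp (norm_diagonal_le e (hφ.nonneg (hl.le.trans hlam.2)) hφb)
    rw [← hsrc] at h
    exact h.isHilbertSchmidt.hsLe
  simp only [hfC] at hreg
  -- moments of the two random elements
  obtain ⟨A, hA⟩ := exists_isTensor_lp H H
  obtain ⟨A', hA'⟩ := exists_isTensor_lp H Y
  set T := diagonal e (fun i => (a i + lam) ^ (-(1 / 2) : ℝ)) with hT
  obtain ⟨c1, c2, c3⟩ := covTensor_moments hmeas hfeat hβmeas hβ hA hDn hb.le hκ hq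
  obtain ⟨d1, d2, d3⟩ := noiseTensor_moments hmeas hfeat hβmeas hβ hA' hDn hb.le hκ hq hM'.le hY
    hCs.norm_le hreg
  have hsm := stronglyMeasurable_covTensor hmeas hβmeas A T
  have hsm' := stronglyMeasurable_noiseTensor hmeas hβmeas A' T Cstar
  rw [← hNe] at c2 d3
  rw [← hM] at d1 d3
  have hM0 : 0 ≤ M := by rw [hM]; have := hCs.1; positivity
  -- The covariance tensor is lifted to `X × Y` so that both sums live on the same sample space. It
  -- is not centred; centering doubles its sup bound, whence the inner factor `2` in the sample size
  -- condition.
  let ζ : X × Y → lp (fun _ : basisIndex H => H) 2 := fun z =>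
    β z.1 • A (feature H z.1) (T (feature H z.1))
  have hζ : StronglyMeasurable ζ := hsm.comp_measurable measurable_fst
  obtain ⟨z1, z2, z3⟩ := centered_bounds (μ := pX ⊗ₘ P) hζ (ae_of_all _ fun z => c1 z.1)
  have hζ2 : ∫ z, ‖ζ z‖ ^ 2 ∂(pX ⊗ₘ P)
      = ∫ x, ‖β x • A (feature H x) (T (feature H x))‖ ^ 2 ∂pX :=
    integral_fst_compProd (f := fun x => ‖β x • A (feature H x) (T (feature H x))‖ ^ 2)
      (hsm.norm.pow 2).aestronglyMeasurable
  have hζ1 : ∫ z, ζ z ∂(pX ⊗ₘ P) = ∫ x, β x • A (feature H x) (T (feature H x)) ∂pX :=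
    integral_fst_compProd (f := fun x => β x • A (feature H x) (T (feature H x)))
      hsm.aestronglyMeasurable
  have hm : ∀ h y, ⟪∫ z, ζ z ∂(pX ⊗ₘ P), A h y⟫ = ⟪covOp H qX h, T y⟫ := fun h y => by
    rw [hζ1, c3, inner_covOp hmeas hfeat]
    exact integral_congr_ae (ae_of_all _ fun x => congrArg _ (hDsym _ _))
  have hev := meas_norm_sum_gt_union_le (n := n) (hζ.sub stronglyMeasurable_const) hsm'
    (by positivity) (by positivity) z1 z2 (z3.trans (hζ2.le.trans c2)) d1 d2 d3 hδ
  refine (measure_mono fun z hz => ?_).trans hev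
  by_contra hzn
  rw [Set.mem_union, not_or] at hzn
  simp only [Set.mem_ofPred_eq, not_lt] at hzn
  refine hz ?_
  have hn' : (0 : ℝ) < n := Nat.cast_pos.mpr hn
  have hl0 : 0 ≤ Real.log (2 / δ) := by
    refine Real.log_nonneg ?_
    rw [le_div_iff₀ hδ.1]
    linarith [hδ.2]
  have hτ := norm_diagonal_mul_empCov_sub_le hA β z (C := covOp H qX) (fun v w => hDsym v w) hm
    (norm_inv_smul_sum_sub_le hn (fun i => ζ (z i)) _ hzn.1)
  have hη := hsLe_empCross_sub hA' β z (Cstar := Cstar) (fun v w => hDsym v w)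
    (η := (n : ℝ)⁻¹ * (√5 * (b * ((√lam)⁻¹ * κ) * M + √(n * (b * M ^ 2 * N))) *
      Real.log (2 / δ))) (by
    rw [norm_smul, Real.norm_of_nonneg (inv_nonneg.mpr hn'.le)]
    exact mul_le_mul_of_nonneg_left hzn.2 (inv_nonneg.mpr hn'.le))
  -- This is the sample size condition divided by `√lam`.
  have hτ2 : (n : ℝ)⁻¹ * (2 * (2 * (b * κ * ((√lam)⁻¹ * κ)) + √(n * (b * κ ^ 2 * N))) *
      Real.log (2 / δ)) / √lam ≤ 1 / 2 := by
    rw [threshold_eq hb.le hN0 hn' hl, div_le_iff₀ hsl]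
    linarith
  refine (norm_sub_estimator_le_of_close hG hfeat hb hβ hs hg hν hφ hc he ha hCs hCo.hsLe hfC
    hsrc hn hlam z hτ2 hτ hη).trans ?_
  rw [hA₁, hA₂, hA₃]
  exact final_bound hb.le hκ hN0 hn' hl hl0 hM0 (add_nonneg hg.B_pos.le hg.D_pos.le) hCs.1
    (add_nonneg (hν.nonneg hlam) hg.γ_pos.le) (le_max_left _ _) (Nat.floor_le hν.1.le)
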